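/- **Conventions.** A *regular germ* is a germ, at a point of the Riemann sphere $\mathbb S^2=\mathbb C\cup\{\infty\}$, of a holomorphic $\mathbb C$-valued function (holomorphy at $\infty$ is tested in the coordinate $1/z$; poles are not regular). Two regular germs are equivalent if one is obtained from the other by analytic continuation along some path in $\mathbb S^2$; a *multivalued function* $f$ is an equivalence class of regular germs, and it is *generated* by each of its germs. A point $b\in\mathbb S^2$ is *singular* for a germ $f_a$ if there is a path $\gamma:[0,1]\to\mathbb S^2$ from $a$ to $b$ along which $f_a$ has no analytic continuation, although it has one along $\gamma|_{[0,\tau]}$ for every $0\le\tau<1$. An *$\mathcal S$-function* is a multivalued function each of whose germs has an at most countable set of singular points. If $\Sigma$ is the set of singular points of $f$ and $x_0\notin\Sigma$, the *monodromy group* of $f$ is the group of those permutations of the set of germs of $f$ at $x_0$ that are induced by analytic continuation along loops in $\mathbb S^2\setminus\Sigma$ based at $x_0$; up to isomorphism it does not depend on $x_0$. The function $f$ is *single-valued* if it has at most one germ at each point. Operations on multivalued functions are performed on germs: a multivalued function is said to be obtained from $f_1,\dots,f_n$ by an operation if it is generated by some germ obtained by that operation from some germs of $f_1,\dots,f_n$.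 The operations considered are: composition $g\circ f$; the meromorphic operations $F(f_1,\dots,f_n)$, where $n$ is arbitrary and $F$ is a meromorphic function on $\mathbb C^n$; differentiation $f\mapsto f'$; and integration $f\mapsto y$ with $y'=f$. A class of multivalued functions is *stable* under an operation if it contains all functions obtained by the operation from functions of the class. A multivalued function is *strongly non-representable by quadratures* if it does not belong to the smallest class of multivalued functions that contains the basic elementary functions (complex constants, the independent variable $x$, $\exp$, $\ln$, $x^\alpha$ with $\alpha\in\mathbb C$, $\sin,\cos,\tan,\cot,\arcsin,\arccos,\arctan,\operatorname{arccot}$) and all single-valued $\mathcal S$-functions, and that is stable under composition, meromorphic operations, differentiation and integration. **Theorem.** (1) The class of all $\mathcal S$-functions having a solvable monodromy group is stable under composition, meromorphic operations, integration and differentiation. (2) If the monodromy group of an $\mathcal S$-function $f$ is not solvable, then $f$ is strongly non-representable by quadratures. -/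

import Mathlib

open Filter Topology

noncomputable section

/-! ### Holomorphic functions and germs on the Riemann sphere -/

/-- The Riemann sphere. -/
abbrev Sphere : Type := OnePoint ℂ

/-- The local coordinate `w = 1 / z` at `∞`: it sends `0` to `∞` and `w ≠ 0` to `1 / w`. -/
def invChart (w : ℂ) : Sphere :=
  if w = 0 then OnePoint.infty else ((w⁻¹ : ℂ) : Sphere)

/-- The (everywhere defined) function `h` is holomorphic near the point `x` of the sphere.
At `∞` this is tested in the coordinate `1 / z`. -/
def HolomorphicAt (h : Sphere → ℂ) (x : Sphere) : Prop :=
  x.elim (AnalyticAt ℂ (fun w : ℂ => h (invChart w)) 0)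
    (fun z => AnalyticAt ℂ (fun w : ℂ => h (w : Sphere)) z)

/-- A regular germ: a point of the Riemann sphere together with the germ at that point of a
holomorphic complex-valued function (so a pole is not a regular point). -/
structure RegularGerm where
  /-- the point at which the germ lives -/
  pt : Sphere
  /-- the germ -/
  germ : Germ (𝓝 pt) ℂ
  /-- the germ is holomorphic -/
  regular : ∃ h : Sphere → ℂ, germ = (h : Germ (𝓝 pt) ℂ) ∧ HolomorphicAt h pt

/-- `p` is the germ of the function `h` at the point `p.pt`. -/
def RegularGerm.IsGermOf (p : RegularGerm) (h : Sphere → ℂ) : Prop :=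
  p.germ = (h : Germ (𝓝 p.pt) ℂ)

/-- The topology of the espace étalé of the sheaf of holomorphic functions on the sphere: the
germs, at the points of an open set `U`, of a holomorphic function on `U` form an open set. -/
instance : TopologicalSpace RegularGerm :=
  TopologicalSpace.generateFrom
    {s | ∃ (U : Set Sphere) (h : Sphere → ℂ), IsOpen U ∧ (∀ x ∈ U, HolomorphicAt h x) ∧
      s = {p : RegularGerm | p.pt ∈ U ∧ p.IsGermOf h}}

/-! ### Analytic continuation, multivalued functions -/

/-- The germ `q` is obtained from the germ `p` by analytic continuation along the path `γ`. -/
def ContinuesTo {a b : Sphere} (γ : Path a b) (p q : RegularGerm) : Prop :=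
  ∃ Γ : Path p q, ∀ t, (Γ t).pt = γ t

theorem ContinuesTo.refl {a : Sphere} {p : RegularGerm} (h : p.pt = a) :
    ContinuesTo (Path.refl a) p p :=
  ⟨Path.refl p, fun _ => h⟩

theorem ContinuesTo.symm {a b : Sphere} {γ : Path a b} {p q : RegularGerm}
    (h : ContinuesTo γ p q) : ContinuesTo γ.symm q p := by
  obtain ⟨Γ, hΓ⟩ := h
  exact ⟨Γ.symm, fun _ => hΓ _⟩

theorem ContinuesTo.trans {a b c : Sphere} {γ : Path a b} {δ : Path b c} {p q r : RegularGerm}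
    (h : ContinuesTo γ p q) (h₁ : ContinuesTo δ q r) : ContinuesTo (γ.trans δ) p r := by
  obtain ⟨Γ, hΓ⟩ := h
  obtain ⟨Δ, hΔ⟩ := h₁
  refine ⟨Γ.trans Δ, fun t => ?_⟩
  rw [Path.trans_apply, Path.trans_apply]
  split_ifs
  · exact hΓ _
  · exact hΔ _

/-- The germ `p` has an analytic continuation along the truncated path `γ : [0, τ] → S²`. -/
def ContinuesUpTo {a b : Sphere} (γ : Path a b) (p : RegularGerm) (τ : unitInterval) : Prop :=
  ∃ Γ : unitInterval → RegularGerm, ContinuousOn Γ (Set.Icc 0 τ) ∧ Γ 0 = p ∧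
    ∀ t ∈ Set.Icc 0 τ, (Γ t).pt = γ t

/-- `b` is a singular point for the germ `p`. -/
def IsSingularPoint (p : RegularGerm) (b : Sphere) : Prop :=
  ∃ γ : Path p.pt b, ¬ ContinuesUpTo γ p 1 ∧ ∀ τ : unitInterval, τ < 1 → ContinuesUpTo γ p τ

/-- A multivalued analytic function: an equivalence class of regular germs, where two germs are
equivalent if one is an analytic continuation of the other along some path, i.e. if they are
joined by a path in the space of germs. -/
abbrev MultivaluedFunction : Type := ZerothHomotopy RegularGerm

namespace MultivaluedFunction

/-- The multivalued function generated by a germ. -/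
def generatedBy (p : RegularGerm) : MultivaluedFunction := ZerothHomotopy.mk p

/-- `p` is one of the regular germs of `f`. -/
def HasGerm (f : MultivaluedFunction) (p : RegularGerm) : Prop := generatedBy p = f

/-- The set of singular points of a multivalued function. -/
def singularSet (f : MultivaluedFunction) : Set Sphere :=
  {b | ∃ p, f.HasGerm p ∧ IsSingularPoint p b}

/-- `𝒮`-functions: each regular germ has an at most countable set of singular points. -/
def IsSFunction (f : MultivaluedFunction) : Prop :=
  ∀ p, f.HasGerm p → {b | IsSingularPoint p b}.Countable

/-- Single-valued functions: at most one germ at each point. -/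
def IsSingleValued (f : MultivaluedFunction) : Prop :=
  ∀ p q, f.HasGerm p → f.HasGerm q → p.pt = q.pt → p = q

/-! ### The monodromy group -/

/-- The set of all germs of `f` at the point `x₀`. -/
abbrev Fiber (f : MultivaluedFunction) (x₀ : Sphere) : Type :=
  {p : RegularGerm // f.HasGerm p ∧ p.pt = x₀}

/-- The permutation `σ` of the germs of `f` at `x₀` is the one induced by analytic continuation
along the loop `γ`. -/
def IsInducedBy (f : MultivaluedFunction) {x₀ : Sphere} (γ : Path x₀ x₀)
    (σ : Equiv.Perm (f.Fiber x₀)) : Prop :=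
  ∀ y, ContinuesTo γ y.1 (σ y).1

/-- The monodromy group of `f` with base point `x₀`: all permutations of the set of germs of `f`
at `x₀` that are induced by loops based at `x₀` in the complement of the singular set. -/
def monodromyGroup (f : MultivaluedFunction) (x₀ : Sphere) (hx₀ : x₀ ∉ f.singularSet) :
    Subgroup (Equiv.Perm (f.Fiber x₀)) where
  carrier := {σ | ∃ γ : Path x₀ x₀, (∀ t, γ t ∉ f.singularSet) ∧ f.IsInducedBy γ σ}
  one_mem' := ⟨Path.refl x₀, fun _ => hx₀, fun y => ContinuesTo.refl y.2.2⟩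
  mul_mem' := by
    rintro σ τ ⟨γ, hγ, hσ⟩ ⟨δ, hδ, hτ⟩
    refine ⟨δ.trans γ, fun t => ?_, fun y => (hτ y).trans (hσ (τ y))⟩
    rw [Path.trans_apply]
    split_ifs
    · exact hδ _
    · exact hγ _
  inv_mem' := by
    rintro σ ⟨γ, hγ, hσ⟩
    refine ⟨γ.symm, fun t => hγ _, fun y => ?_⟩
    have h := hσ (σ⁻¹ y)
    rw [show σ (σ⁻¹ y) = y from σ.apply_symm_apply y] at h
    exact h.symm

/-- The monodromy group is solvable (for all choices of the base point outside the singular set;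
different choices give isomorphic groups). -/
def HasSolvableMonodromyGroup (f : MultivaluedFunction) : Prop :=
  ∀ (x₀ : Sphere) (hx₀ : x₀ ∉ f.singularSet), Group.IsSolvable (f.monodromyGroup x₀ hx₀)

end MultivaluedFunction

open MultivaluedFunction

/-! ### Operations on germs and on multivalued functions -/

/-- The derivative with respect to the independent variable `z`.  If `h` is holomorphic at `∞`
then `h'(z)` tends to `0` as `z → ∞`, which is the value of the derivative at `∞`. -/
def sphereDeriv (h : Sphere → ℂ) (x : Sphere) : ℂ :=
  x.elim 0 (fun z => deriv (fun w : ℂ => h (w : Sphere)) z)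

/-- The germ `q` is the derivative of the germ `p`. -/
def IsGermDerivative (q p : RegularGerm) : Prop :=
  q.pt = p.pt ∧ ∃ h : Sphere → ℂ, p.IsGermOf h ∧ q.IsGermOf (sphereDeriv h)

/-- The germ `r` is the composition `q ∘ p`, where `q` is a germ at the value of `p`. -/
def IsGermComposition (r q p : RegularGerm) : Prop :=
  r.pt = p.pt ∧ ∃ h k : Sphere → ℂ, p.IsGermOf h ∧ q.pt = ((h p.pt : ℂ) : Sphere) ∧
    q.IsGermOf k ∧ r.IsGermOf (fun x => k ((h x : ℂ) : Sphere))

/-- Near `v` the meromorphic function `F` of `n` variables is the quotient `P / Q` of holomorphic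
functions.  (No condition is put on the values of `F` at the zeros of `Q`.) -/
def IsLocalQuotient {n : ℕ} (F P Q : (Fin n → ℂ) → ℂ) (v : Fin n → ℂ) : Prop :=
  AnalyticAt ℂ P v ∧ AnalyticAt ℂ Q v ∧ (¬ ∀ᶠ y in 𝓝 v, Q y = 0) ∧
    ∀ᶠ y in 𝓝 v, Q y ≠ 0 → F y = P y / Q y

/-- `F` is (the totalization of) a meromorphic function of `n` complex variables: everywhere
locally a quotient of holomorphic functions with a denominator that is not identically zero. -/
def IsMeromorphicFunction {n : ℕ} (F : (Fin n → ℂ) → ℂ) : Prop :=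
  ∀ v, ∃ P Q, IsLocalQuotient F P Q v

/-- The regular germ `q` is `F(p₁, …, pₙ)`: if `F = P / Q` near the point `(p₁, …, pₙ)(a)`, with
`Q(p₁, …, pₙ)` not identically zero near `a`, then `q` is the quotient of `P(p₁, …, pₙ)` by
`Q(p₁, …, pₙ)`. -/
def IsGermMeromorphicOp {n : ℕ} (F : (Fin n → ℂ) → ℂ) (q : RegularGerm)
    (p : Fin n → RegularGerm) : Prop :=
  ∃ (h : Fin n → Sphere → ℂ) (k : Sphere → ℂ) (P Q : (Fin n → ℂ) → ℂ),
    (∀ i, (p i).pt = q.pt ∧ (p i).IsGermOf (h i)) ∧ q.IsGermOf k ∧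
    IsLocalQuotient F P Q (fun i => h i q.pt) ∧
    (¬ ∀ᶠ x in 𝓝 q.pt, Q (fun i => h i x) = 0) ∧
    ∀ᶠ x in 𝓝 q.pt, k x * Q (fun i => h i x) = P (fun i => h i x)

/-- `φ` is representable as the derivative of `f`. -/
def IsDerivativeOf (φ f : MultivaluedFunction) : Prop :=
  ∃ q p, φ.HasGerm q ∧ f.HasGerm p ∧ IsGermDerivative q p

/-- `φ` is representable as an integral of `f`, i.e. it solves `φ' = f`. -/
def IsIntegralOf (φ f : MultivaluedFunction) : Prop :=
  IsDerivativeOf f φ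

/-- `φ` is representable as the composition `g ∘ f`. -/
def IsCompositionOf (φ g f : MultivaluedFunction) : Prop :=
  ∃ r q p, φ.HasGerm r ∧ g.HasGerm q ∧ f.HasGerm p ∧ IsGermComposition r q p

/-- `φ` is representable as `F(f₁, …, fₙ)`. -/
def IsMeromorphicOpOf {n : ℕ} (F : (Fin n → ℂ) → ℂ) (φ : MultivaluedFunction)
    (f : Fin n → MultivaluedFunction) : Prop :=
  ∃ (q : RegularGerm) (p : Fin n → RegularGerm),
    φ.HasGerm q ∧ (∀ i, (f i).HasGerm (p i)) ∧ IsGermMeromorphicOp F q p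

/-- The class `C` is stable under composition. -/
def StableUnderComposition (C : Set MultivaluedFunction) : Prop :=
  ∀ g ∈ C, ∀ f ∈ C, ∀ φ, IsCompositionOf φ g f → φ ∈ C

/-- The class `C` is stable under all meromorphic operations, in any number of variables. -/
def StableUnderMeromorphicOperations (C : Set MultivaluedFunction) : Prop :=
  ∀ (n : ℕ) (F : (Fin n → ℂ) → ℂ), IsMeromorphicFunction F →
    ∀ f : Fin n → MultivaluedFunction, (∀ i, f i ∈ C) →
      ∀ φ, IsMeromorphicOpOf F φ f → φ ∈ C

/-- The class `C` is stable under integration. -/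
def StableUnderIntegration (C : Set MultivaluedFunction) : Prop :=
  ∀ f ∈ C, ∀ φ, IsIntegralOf φ f → φ ∈ C

/-- The class `C` is stable under differentiation. -/
def StableUnderDifferentiation (C : Set MultivaluedFunction) : Prop :=
  ∀ f ∈ C, ∀ φ, IsDerivativeOf φ f → φ ∈ C

/-- The class of all `𝒮`-functions with a solvable monodromy group. -/
def SolvableSFunctions : Set MultivaluedFunction :=
  {f | f.IsSFunction ∧ f.HasSolvableMonodromyGroup}

/-! ### Basic elementary functions and representability by quadratures -/

/-- `f` is the multivalued function generated by a holomorphic germ, at a finite point, of the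
function `h` of a complex variable. -/
def IsGeneratedByFunction (h : ℂ → ℂ) (f : MultivaluedFunction) : Prop :=
  ∃ (p : RegularGerm) (z : ℂ), f.HasGerm p ∧ p.pt = (z : Sphere) ∧
    p.IsGermOf (fun x => x.elim 0 h)

/-- `f` is a multivalued inverse of the function `T`: it is generated by a germ `k`, at a finite
point, with `T (k (w)) = w`. -/
def IsInverseFunctionOf (T : ℂ → ℂ) (f : MultivaluedFunction) : Prop :=
  ∃ (p : RegularGerm) (z : ℂ) (k : Sphere → ℂ), f.HasGerm p ∧ p.pt = (z : Sphere) ∧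
    p.IsGermOf k ∧ ∀ᶠ w : ℂ in 𝓝 z, T (k (w : Sphere)) = w

/-- The list of basic elementary functions. -/
inductive IsBasicElementary : MultivaluedFunction → Prop
  | const (c : ℂ) (f) : IsGeneratedByFunction (fun _ => c) f → IsBasicElementary f
  | var (f) : IsGeneratedByFunction (fun z => z) f → IsBasicElementary f
  | exp (f) : IsGeneratedByFunction Complex.exp f → IsBasicElementary f
  | log (f) : IsGeneratedByFunction Complex.log f → IsBasicElementary f
  | pow (α : ℂ) (f) : IsGeneratedByFunction (fun z => z ^ α) f → IsBasicElementary f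
  | sin (f) : IsGeneratedByFunction Complex.sin f → IsBasicElementary f
  | cos (f) : IsGeneratedByFunction Complex.cos f → IsBasicElementary f
  | tan (f) : IsGeneratedByFunction Complex.tan f → IsBasicElementary f
  | cot (f) : IsGeneratedByFunction Complex.cot f → IsBasicElementary f
  | arcsin (f) : IsInverseFunctionOf Complex.sin f → IsBasicElementary f
  | arccos (f) : IsInverseFunctionOf Complex.cos f → IsBasicElementary f
  | arctan (f) : IsInverseFunctionOf Complex.tan f → IsBasicElementary f
  | arccot (f) : IsInverseFunctionOf Complex.cot f → IsBasicElementary f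

/-- The class of functions with basic functions: the basic elementary functions and all
single-valued `𝒮`-functions; and admissible operations: compositions, meromorphic operations,
differentiation and integration. -/
inductive InExtendedQuadratureClass : MultivaluedFunction → Prop
  | elementary (f) : IsBasicElementary f → InExtendedQuadratureClass f
  | singleValued (f) : f.IsSFunction → f.IsSingleValued → InExtendedQuadratureClass f
  | composition (φ g f) : InExtendedQuadratureClass g → InExtendedQuadratureClass f →
      IsCompositionOf φ g f → InExtendedQuadratureClass φ
  | meromorphic {n : ℕ} (F : (Fin n → ℂ) → ℂ) (φ) (f : Fin n → MultivaluedFunction) :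
      IsMeromorphicFunction F → (∀ i, InExtendedQuadratureClass (f i)) →
      IsMeromorphicOpOf F φ f → InExtendedQuadratureClass φ
  | differentiation (φ f) : InExtendedQuadratureClass f → IsDerivativeOf φ f →
      InExtendedQuadratureClass φ
  | integration (φ f) : InExtendedQuadratureClass f → IsIntegralOf φ f →
      InExtendedQuadratureClass φ

/-- `f` is strongly non-representable by quadratures. -/
def StronglyNonRepresentableByQuadratures (f : MultivaluedFunction) : Prop :=
  ¬ InExtendedQuadratureClass f

end

/-!
The germs of holomorphic functions form a surface spread over the sphere: it is Hausdorff by the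
identity theorem, its components are second countable by the Poincaré–Volterra theorem, and
continuing a germ along a path means lifting the path to this surface. On a surface a path can be
moved off a locally countable set, so the countable set of singular points of an `𝒮`-function may
be replaced by any larger countable set `A` without changing whether the monodromy group is
solvable. Solvability then says that, for some `n`, continuation along the `n`-fold iterated
commutators of loops avoiding `A` fixes every germ of the function.

In this form stability can be read off. The result of a differentiation or of a meromorphic
operation depends continuously on the germs operated on, and a loop that fixes these fixes the
result. If a loop fixes the germs of `y'`, it changes those of `y` by constants, and since
translations commute one further commutator fixes `y`. If `n`-fold commutators fix the germs of `f`
and `m`-fold ones those of `g`, then `(n + m)`-fold ones fix `g ∘ f`. Every basic elementary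
function arises by these operations from functions that are holomorphic off a countable set.
-/

noncomputable section

open MultivaluedFunction RegularGerm
open scoped commutatorElement

theorem isLocalHomeomorph_of_injOn_of_nhds_le {X Y : Type*} [TopologicalSpace X]
    [TopologicalSpace Y] {f : X → Y} (hf : Continuous f) (hinj : ∀ x, ∃ N ∈ 𝓝 x, Set.InjOn f N)
    (hop : ∀ x, ∀ V ∈ 𝓝 x, ∀ᶠ y in 𝓝 (f x), ∃ z ∈ V, f z = y) : IsLocalHomeomorph f := by
  have hopen : IsOpenMap f := IsOpenMap.of_nhds_le fun x V hV => by
    filter_upwards [hop x _ hV] with y ⟨z, hz, hzy⟩ using hzy ▸ hz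
  refine isLocalHomeomorph_iff_isOpenEmbedding_restrict.2 fun x => ?_
  obtain ⟨N, hN, hi⟩ := hinj x
  obtain ⟨U, hUN, hU, hxU⟩ := mem_nhds_iff.1 hN
  exact ⟨U, hU.mem_nhds hxU, .of_continuous_injective_isOpenMap hf.continuousOn.domRestrict
    (Set.injOn_iff_injective.1 (hi.mono hUN)) (hopen.domRestrict hU)⟩

/-! ### Charts of the sphere -/

theorem invChart_zero : invChart 0 = OnePoint.infty := if_pos rfl

theorem invChart_of_ne {w : ℂ} (hw : w ≠ 0) : invChart w = ((w⁻¹ : ℂ) : Sphere) := if_neg hw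

theorem invChart_eventuallyEq {w : ℂ} (hw : w ≠ 0) :
    invChart =ᶠ[𝓝 w] fun w => ((w⁻¹ : ℂ) : Sphere) := by
  filter_upwards [isOpen_ne.mem_nhds hw] with v hv using invChart_of_ne hv

theorem map_invChart_nhds (w : ℂ) : map invChart (𝓝 w) = 𝓝 (invChart w) := by
  by_cases hw : w = 0
  · subst hw
    rw [invChart_zero, OnePoint.nhds_infty_eq, ← nhdsNE_sup_pure, map_sup, map_pure, invChart_zero]
    congr 1
    have : map invChart (𝓝[≠] 0) = map (fun w : ℂ => ((w⁻¹ : ℂ) : Sphere)) (𝓝[≠] 0) :=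
      map_congr (by filter_upwards [self_mem_nhdsWithin] with v hv using invChart_of_ne hv)
    rw [this, coclosedCompact_eq_cocompact, ← Metric.cobounded_eq_cocompact,
      ← Filter.inv_nhdsNE_zero]
    rfl
  · rw [map_congr (invChart_eventuallyEq hw), invChart_of_ne hw, OnePoint.nhds_coe_eq,
      nhds_inv₀ hw]
    rfl

theorem invChart_injective : Function.Injective invChart := by
  intro v w h
  by_cases hv : v = 0 <;> by_cases hw : w = 0
  · rw [hv, hw]
  · rw [hv, invChart_zero, invChart_of_ne hw] at h
    exact absurd h.symm (OnePoint.coe_ne_infty _)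
  · rw [hw, invChart_zero, invChart_of_ne hv] at h
    exact absurd h (OnePoint.coe_ne_infty _)
  · rw [invChart_of_ne hv, invChart_of_ne hw] at h
    exact inv_injective (OnePoint.coe_injective h)

theorem isOpenEmbedding_invChart : IsOpenEmbedding invChart :=
  .of_continuous_injective_isOpenMap
    (continuous_iff_continuousAt.2 fun w => (map_invChart_nhds w).le) invChart_injective
    (IsOpenMap.of_nhds_le fun w => (map_invChart_nhds w).ge)

/-- The open embedding `e` is a holomorphic chart of the sphere, written as a parametrization by the
whole plane: holomorphy on the sphere may be tested after composition with `e`. It treats `∞` and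
the finite points on the same footing. -/
structure IsSphereChart (e : ℂ → Sphere) : Prop where
  isOpenEmbedding : IsOpenEmbedding e
  holomorphicAt_iff : ∀ (h : Sphere → ℂ) (w : ℂ),
    HolomorphicAt h (e w) ↔ AnalyticAt ℂ (fun v => h (e v)) w

theorem holomorphicAt_coe {h : Sphere → ℂ} {z : ℂ} :
    HolomorphicAt h (z : Sphere) ↔ AnalyticAt ℂ (fun w : ℂ => h (w : Sphere)) z := Iff.rfl

theorem isSphereChart_coe : IsSphereChart ((↑) : ℂ → Sphere) :=
  ⟨OnePoint.isOpenEmbedding_coe, fun _ _ => Iff.rfl⟩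

theorem isSphereChart_invChart : IsSphereChart invChart := by
  refine ⟨isOpenEmbedding_invChart, fun h w => ?_⟩
  by_cases hw : w = 0
  · subst hw
    rw [invChart_zero]
    rfl
  · have hE : (fun v => h (invChart v)) =ᶠ[𝓝 w] fun v : ℂ => h ((v⁻¹ : ℂ) : Sphere) := by
      filter_upwards [invChart_eventuallyEq hw] with v hv
      rw [hv]
    rw [analyticAt_congr hE, invChart_of_ne hw, holomorphicAt_coe]
    constructor
    · intro H
      exact H.comp (f := fun v : ℂ => v⁻¹) (analyticAt_inv hw)
    · intro H
      have H' : AnalyticAt ℂ (fun v : ℂ => h ((v⁻¹ : ℂ) : Sphere)) (w⁻¹)⁻¹ := by rwa [inv_inv]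
      simpa [Function.comp_def] using
        H'.comp (f := fun v : ℂ => v⁻¹) (analyticAt_inv (inv_ne_zero hw))

theorem exists_isSphereChart (x : Sphere) : ∃ e : ℂ → Sphere, ∃ w, IsSphereChart e ∧ e w = x := by
  induction x using OnePoint.rec with
  | infty => exact ⟨_, 0, isSphereChart_invChart, invChart_zero⟩
  | coe z => exact ⟨_, z, isSphereChart_coe, rfl⟩

theorem IsSphereChart.eventually_iff {e : ℂ → Sphere} (he : IsSphereChart e) {w : ℂ}
    {P : Sphere → Prop} : (∀ᶠ x in 𝓝 (e w), P x) ↔ ∀ᶠ v in 𝓝 w, P (e v) := by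
  rw [← he.isOpenEmbedding.map_nhds_eq, eventually_map]

theorem eventually_nhds_coe {z : ℂ} {P : Sphere → Prop} :
    (∀ᶠ x in 𝓝 (z : Sphere), P x) ↔ ∀ᶠ w : ℂ in 𝓝 z, P w :=
  isSphereChart_coe.eventually_iff

theorem HolomorphicAt.eventually {h : Sphere → ℂ} {x : Sphere} (hx : HolomorphicAt h x) :
    ∀ᶠ y in 𝓝 x, HolomorphicAt h y := by
  obtain ⟨e, w, he, rfl⟩ := exists_isSphereChart x
  rw [he.eventually_iff]
  filter_upwards [((he.holomorphicAt_iff h w).1 hx).eventually_analyticAt] with v hv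
  exact (he.holomorphicAt_iff h v).2 hv

theorem HolomorphicAt.congr {h k : Sphere → ℂ} {x : Sphere} (hx : HolomorphicAt h x)
    (hk : h =ᶠ[𝓝 x] k) : HolomorphicAt k x := by
  obtain ⟨e, w, he, rfl⟩ := exists_isSphereChart x
  rw [he.holomorphicAt_iff] at hx ⊢
  exact AnalyticAt.congr hx (he.eventually_iff.1 hk)

theorem HolomorphicAt.continuousAt {h : Sphere → ℂ} {x : Sphere} (hx : HolomorphicAt h x) :
    ContinuousAt h x := by
  obtain ⟨e, w, he, rfl⟩ := exists_isSphereChart x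
  rw [he.holomorphicAt_iff] at hx
  exact he.isOpenEmbedding.continuousAt_iff.1 hx.continuousAt

theorem holomorphicAt_const (c : ℂ) (x : Sphere) : HolomorphicAt (fun _ => c) x := by
  obtain ⟨e, w, he, rfl⟩ := exists_isSphereChart x
  exact (he.holomorphicAt_iff _ _).2 analyticAt_const

theorem HolomorphicAt.eventually_eq_or_eventually_ne {h k : Sphere → ℂ} {x : Sphere}
    (hh : HolomorphicAt h x) (hk : HolomorphicAt k x) :
    (∀ᶠ y in 𝓝 x, h y = k y) ∨ ∀ᶠ y in 𝓝[≠] x, h y ≠ k y := by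
  obtain ⟨e, w, he, rfl⟩ := exists_isSphereChart x
  rw [he.holomorphicAt_iff] at hh hk
  refine (hh.eventually_eq_or_eventually_ne hk).imp he.eventually_iff.2 fun H => ?_
  rw [eventually_nhdsWithin_iff] at H ⊢
  rw [he.eventually_iff]
  filter_upwards [H] with v hv hne
  exact hv fun h' => hne (congrArg e h')

/-! ### The space of germs -/

namespace RegularGerm

/-- A function representing the germ `p`, picked by choice. -/
def rep (p : RegularGerm) : Sphere → ℂ := p.regular.choose

theorem isGermOf_rep (p : RegularGerm) : p.IsGermOf p.rep := p.regular.choose_spec.1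

theorem IsGermOf.congr {p : RegularGerm} {h k : Sphere → ℂ} (hp : p.IsGermOf h)
    (hk : h =ᶠ[𝓝 p.pt] k) : p.IsGermOf k :=
  Eq.trans hp (Germ.coe_eq.2 hk)

theorem IsGermOf.eventuallyEq {p : RegularGerm} {h k : Sphere → ℂ} (hp : p.IsGermOf h)
    (hk : p.IsGermOf k) : h =ᶠ[𝓝 p.pt] k :=
  Germ.coe_eq.1 (Eq.trans hp.symm hk)

theorem IsGermOf.holomorphicAt {p : RegularGerm} {h : Sphere → ℂ} (hp : p.IsGermOf h) :
    HolomorphicAt h p.pt := by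
  obtain ⟨k, hk, hk'⟩ := p.regular
  exact hk'.congr (IsGermOf.eventuallyEq hk hp)

theorem IsGermOf.ext {p q : RegularGerm} {h : Sphere → ℂ} (hp : p.IsGermOf h)
    (hq : q.IsGermOf h) (hpt : p.pt = q.pt) : p = q := by
  obtain ⟨x, g, hg⟩ := p
  obtain ⟨y, g', hg'⟩ := q
  obtain rfl : x = y := hpt
  obtain rfl : g = g' := Eq.trans hp hq.symm
  rfl

open Classical in
/-- The germ at `x` of `h`; by convention the zero germ if `h` is not holomorphic at `x`, so that
families of germs can be written down without a proof of holomorphy. -/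
def ofFun (h : Sphere → ℂ) (x : Sphere) : RegularGerm :=
  if H : HolomorphicAt h x then ⟨x, h, h, rfl, H⟩
  else ⟨x, ((fun _ => 0 : Sphere → ℂ) : Germ (𝓝 x) ℂ), _, rfl, holomorphicAt_const 0 x⟩

@[simp] theorem ofFun_pt (h : Sphere → ℂ) (x : Sphere) : (ofFun h x).pt = x := by
  unfold ofFun
  split_ifs <;> rfl

theorem isGermOf_ofFun {h : Sphere → ℂ} {x : Sphere} (H : HolomorphicAt h x) :
    (ofFun h x).IsGermOf h := by
  unfold ofFun
  rw [dif_pos H]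
  rfl

theorem eq_ofFun {p : RegularGerm} {h : Sphere → ℂ} (hp : p.IsGermOf h) : p = ofFun h p.pt :=
  hp.ext (isGermOf_ofFun hp.holomorphicAt) (ofFun_pt _ _).symm

theorem isOpen_sheet {U : Set Sphere} {h : Sphere → ℂ} (hU : IsOpen U)
    (hh : ∀ x ∈ U, HolomorphicAt h x) : IsOpen {p : RegularGerm | p.pt ∈ U ∧ p.IsGermOf h} :=
  TopologicalSpace.isOpen_generateFrom_of_mem ⟨U, h, hU, hh, rfl⟩

theorem nhds_eq {p : RegularGerm} {h : Sphere → ℂ} (hp : p.IsGermOf h) :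
    𝓝 p = comap pt (𝓝 p.pt) ⊓ 𝓟 {q | q.IsGermOf h} := by
  apply le_antisymm
  · refine le_inf ?_ ?_
    · rw [← tendsto_iff_comap]
      intro V hV
      obtain ⟨U, hUV, hU, hpU⟩ := mem_nhds_iff.1 (inter_mem hV hp.holomorphicAt.eventually)
      exact mem_map.2 (mem_of_superset
        ((isOpen_sheet hU fun x hx => (hUV hx).2).mem_nhds ⟨hpU, hp⟩) fun q hq => (hUV hq.1).1)
    · rw [le_principal_iff]
      obtain ⟨U, hUV, hU, hpU⟩ := mem_nhds_iff.1 hp.holomorphicAt.eventually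
      refine mem_of_superset ((isOpen_sheet hU hUV).mem_nhds ⟨hpU, hp⟩) ?_
      exact fun q hq => hq.2
  · rw [TopologicalSpace.nhds_generateFrom]
    refine le_iInf₂ ?_
    rintro s ⟨hps, U, k, hU, -, rfl⟩
    rw [le_principal_iff, mem_inf_principal]
    filter_upwards [preimage_mem_comap (hp.eventuallyEq hps.2).eventually_nhds,
      preimage_mem_comap (hU.mem_nhds hps.1)] with q hq hqU hqh
    exact ⟨hqU, hqh.congr hq⟩

theorem tendsto_iff {α : Type*} {l : Filter α} {Φ : α → RegularGerm} {p : RegularGerm}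
    {h : Sphere → ℂ} (hp : p.IsGermOf h) :
    Tendsto Φ l (𝓝 p) ↔
      Tendsto (fun a => (Φ a).pt) l (𝓝 p.pt) ∧ ∀ᶠ a in l, (Φ a).IsGermOf h := by
  rw [nhds_eq hp, tendsto_inf, tendsto_comap_iff, tendsto_principal]
  rfl

theorem continuous_pt : Continuous pt :=
  continuous_iff_continuousAt.2 fun p => ((tendsto_iff p.isGermOf_rep).1 tendsto_id).1

theorem IsGermOf.eventually {p : RegularGerm} {h : Sphere → ℂ} (hp : p.IsGermOf h) :
    ∀ᶠ q in 𝓝 p, q.IsGermOf h :=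
  ((tendsto_iff hp).1 tendsto_id).2

theorem continuousAt_of_isGermOf {X : Type*} [TopologicalSpace X] {Φ : X → RegularGerm} {x : X}
    {k : Sphere → ℂ} (hpt : ContinuousAt (fun y => (Φ y).pt) x)
    (hk : ∀ᶠ y in 𝓝 x, (Φ y).IsGermOf k) : ContinuousAt Φ x :=
  (tendsto_iff hk.self_of_nhds).2 ⟨hpt, hk⟩

theorem tendsto_ofFun {p : RegularGerm} {h : Sphere → ℂ} (hp : p.IsGermOf h) :
    Tendsto (ofFun h) (𝓝 p.pt) (𝓝 p) := by
  refine (tendsto_iff hp).2 ⟨by simp only [ofFun_pt]; exact tendsto_id, ?_⟩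
  filter_upwards [hp.holomorphicAt.eventually] with x hx using isGermOf_ofFun hx

theorem eq_of_eventuallyEq {p q : RegularGerm} {h k : Sphere → ℂ} (hp : p.IsGermOf h)
    (hq : q.IsGermOf k) (hpt : p.pt = q.pt) (hk : h =ᶠ[𝓝 p.pt] k) : p = q :=
  (hp.congr hk).ext hq hpt

theorem disjoint_nhds_of_pt_eq {p q : RegularGerm} (hpt : p.pt = q.pt) (hpq : p ≠ q) :
    Disjoint (𝓝 p) (𝓝 q) := by
  obtain hpq' | hpq' := p.isGermOf_rep.holomorphicAt.eventually_eq_or_eventually_ne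
    (hpt ▸ q.isGermOf_rep.holomorphicAt)
  · exact absurd (eq_of_eventuallyEq p.isGermOf_rep q.isGermOf_rep hpt hpq') hpq
  refine disjoint_iff.2 (empty_mem_iff_bot.1 ?_)
  have hp : ∀ᶠ r in 𝓝 p ⊓ 𝓝 q, r.IsGermOf p.rep :=
    p.isGermOf_rep.eventually.filter_mono inf_le_left
  have hq : ∀ᶠ r in 𝓝 p ⊓ 𝓝 q, r.IsGermOf q.rep :=
    q.isGermOf_rep.eventually.filter_mono inf_le_right
  have hne : ∀ᶠ r in 𝓝 p ⊓ 𝓝 q, r.pt ≠ p.pt → p.rep r.pt ≠ q.rep r.pt :=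
    ((continuous_pt.tendsto p).eventually (eventually_nhdsWithin_iff.1 hpq')).filter_mono
      inf_le_left
  filter_upwards [hp, hq, hne] with r hrp hrq hr
  have hrep := hrp.eventuallyEq hrq
  by_cases hrpt : r.pt = p.pt
  · exact hpq (eq_of_eventuallyEq p.isGermOf_rep q.isGermOf_rep hpt (hrpt ▸ hrep))
  · exact hr hrpt hrep.self_of_nhds

instance : T2Space RegularGerm := by
  refine t2Space_iff_disjoint_nhds.2 fun p q hpq => ?_
  by_cases hpt : p.pt = q.pt
  · exact disjoint_nhds_of_pt_eq hpt hpq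
  · exact continuous_pt.continuousAt.disjoint (disjoint_nhds_nhds.2 hpt) continuous_pt.continuousAt

theorem isLocalHomeomorph_pt : IsLocalHomeomorph pt := by
  refine isLocalHomeomorph_of_injOn_of_nhds_le continuous_pt
    (fun p => ⟨_, p.isGermOf_rep.eventually, fun q hq r hr hqr => IsGermOf.ext hq hr hqr⟩)
    fun p V hV => ?_
  filter_upwards [(tendsto_ofFun p.isGermOf_rep).eventually hV] with x hx
  exact ⟨_, hx, ofFun_pt _ _⟩

/-- The value of a germ at its base point, through which germs are composed. -/
def val (p : RegularGerm) : ℂ := p.germ.value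

theorem IsGermOf.val_eq {p : RegularGerm} {h : Sphere → ℂ} (hp : p.IsGermOf h) :
    p.val = h p.pt := by
  rw [val, show p.germ = (h : Germ (𝓝 p.pt) ℂ) from hp, Germ.value_ofFun]

theorem continuous_val : Continuous val := by
  refine continuous_iff_continuousAt.2 fun p => ?_
  have hval : val =ᶠ[𝓝 p] fun q => p.rep q.pt :=
    p.isGermOf_rep.eventually.mono fun q hq => hq.val_eq
  exact (p.isGermOf_rep.holomorphicAt.continuousAt.comp continuous_pt.continuousAt).congr hval.symm

end RegularGerm

/-! ### Countable exceptional sets on surfaces -/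

/-- Every point of `X` has a neighbourhood that contains only countably many points of `S`: the
condition on exceptional sets that, unlike countability, passes to the preimage under a local
homeomorphism. -/
def LocallyCountable {X : Type*} [TopologicalSpace X] (S : Set X) : Prop :=
  ∀ x, ∃ N ∈ 𝓝 x, (S ∩ N).Countable

theorem LocallyCountable.preimage {X Y : Type*} [TopologicalSpace X]
    {f : X → Y} (hf : IsLocallyInjective f) {A : Set Y} (hA : A.Countable) :
    LocallyCountable (f ⁻¹' A) := fun x => by
  obtain ⟨U, hU, hxU, hinj⟩ := hf x
  exact ⟨U, hU.mem_nhds hxU, Set.MapsTo.countable_of_injOn (f := f) (fun y hy => hy.1)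
    (hinj.mono Set.inter_subset_right) hA⟩

section Charted

variable {E : Type*} [NormedAddCommGroup E] [NormedSpace ℝ E] {X : Type*} [TopologicalSpace X]
  [ChartedSpace E X]

variable (E) in
theorem exists_isOpenEmbedding_range_subset (x : X) {O : Set X} (hO : O ∈ 𝓝 x) :
    ∃ e : E → X, IsOpenEmbedding e ∧ x ∈ Set.range e ∧ Set.range e ⊆ O := by
  set φ := chartAt E x
  have hxφ : x ∈ φ.source := mem_chart_source E x
  have hpre : φ.target ∩ φ.symm ⁻¹' O ∈ 𝓝 (φ x) :=
    inter_mem (φ.open_target.mem_nhds (φ.map_source hxφ))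
      (φ.symm.continuousAt (φ.map_source hxφ) (by rwa [φ.left_inv hxφ]))
  obtain ⟨r, hr, hball⟩ := Metric.mem_nhds_iff.1 hpre
  set B := OpenPartialHomeomorph.univBall (φ x) r
  have hBsource : B.source = Set.univ := OpenPartialHomeomorph.univBall_source _ _
  have hmem : ∀ v, B v ∈ Metric.ball (φ x) r := fun v => by
    rw [← OpenPartialHomeomorph.univBall_target (φ x) hr]
    exact B.map_source (hBsource ▸ trivial)
  refine ⟨φ.symm ∘ B, (B.trans φ.symm).isOpenEmbedding ?_, ⟨0, ?_⟩, ?_⟩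
  · rw [OpenPartialHomeomorph.trans_source, hBsource]
    exact Set.eq_univ_of_forall fun v => ⟨trivial, (hball (hmem v)).1⟩
  · rw [Function.comp_apply, OpenPartialHomeomorph.univBall_apply_zero, φ.left_inv hxφ]
  · rintro _ ⟨v, rfl⟩
    exact (hball (hmem v)).2

namespace LocallyCountable

variable {S : Set X} (hS : LocallyCountable S) (hE : 1 < Module.rank ℝ E)
include hS hE

theorem exists_isPathConnected_diff {x : X} {O : Set X} (hO : O ∈ 𝓝 x) :
    ∃ W ∈ 𝓝 x, W ⊆ O ∧ IsPathConnected (W \ S) := by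
  obtain ⟨N, hN, hcount⟩ := hS x
  obtain ⟨e, he, hx, heON⟩ := exists_isOpenEmbedding_range_subset E x (inter_mem hO hN)
  have hmaps : Set.MapsTo e (e ⁻¹' S) (S ∩ N) := fun v hv => ⟨hv, (heON ⟨v, rfl⟩).2⟩
  have hpre := hmaps.countable_of_injOn he.injective.injOn hcount
  refine ⟨_, he.isOpen_range.mem_nhds hx, fun y hy => (heON hy).1, ?_⟩
  have := (hpre.isPathConnected_compl_of_one_lt_rank hE).image he.continuous
  rwa [Set.image_compl_preimage] at this

theorem frequently_notMem (x : X) : ∃ᶠ y in 𝓝 x, y ∉ S := by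
  refine frequently_iff.2 fun {O} hO => ?_
  obtain ⟨W, -, hWO, hW⟩ := hS.exists_isPathConnected_diff hE hO
  obtain ⟨y, hy, hyS⟩ := hW.nonempty
  exact ⟨y, hWO hy, hyS⟩

theorem joinedIn_diff {O : Set X} (hO : IsOpen O) {x y : X} (hxy : JoinedIn O x y)
    (hx : x ∉ S) (hy : y ∉ S) : JoinedIn (O \ S) x y := by
  obtain ⟨γ, hγ⟩ := hxy
  have hlocal : ∀ t, ∃ W ∈ 𝓝 (γ t), ∀ y ∈ W \ S, ∀ z ∈ W \ S, JoinedIn (O \ S) y z := fun t => by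
    obtain ⟨W, hW, hWO, hWS⟩ := hS.exists_isPathConnected_diff hE (hO.mem_nhds (hγ t))
    exact ⟨W, hW, fun y hy z hz =>
      (hWS.joinedIn y hy z hz).mono (Set.sdiff_subset_sdiff_left hWO)⟩
  -- a point of `S` on `γ` cannot be joined to `x` itself, but all nearby points off `S` can
  set P : Set unitInterval := {t | ∀ᶠ z in 𝓝 (γ t), z ∉ S → JoinedIn (O \ S) x z}
  have hopen : IsOpen P := isOpen_iff_mem_nhds.2 fun t ht =>
    γ.continuous.continuousAt.eventually (eventually_eventually_nhds.2 ht)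
  have hclosed : IsClosed P := by
    refine isOpen_compl_iff.1 (isOpen_iff_mem_nhds.2 fun t ht => ?_)
    obtain ⟨W, hW, hjoin⟩ := hlocal t
    filter_upwards [γ.continuous.continuousAt.eventually (eventually_mem_nhds_iff.2 hW)]
      with s hs hsP
    obtain ⟨z, hzS, hz, hzW⟩ :=
      ((hS.frequently_notMem hE (γ s)).and_eventually (hsP.and hs)).exists
    exact ht (mem_of_superset hW fun z' hz' hz'S =>
      (hz hzS).trans (hjoin _ ⟨hzW, hzS⟩ _ ⟨hz', hz'S⟩))
  have h0 : (0 : unitInterval) ∈ P := by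
    obtain ⟨W, hW, hjoin⟩ := hlocal 0
    have hxW : x ∈ W := γ.source ▸ mem_of_mem_nhds hW
    exact mem_of_superset hW fun z hz hzS => hjoin x ⟨hxW, hx⟩ z ⟨hz, hzS⟩
  have h1 : (1 : unitInterval) ∈ P :=
    (IsClopen.eq_univ ⟨hclosed, hopen⟩ ⟨0, h0⟩).symm ▸ trivial
  have hend := Eventually.self_of_nhds h1
  rw [γ.target] at hend
  exact hend hy

end LocallyCountable

end Charted

theorem one_lt_rank_real_complex : 1 < Module.rank ℝ ℂ := by simp

/-- The source of a local homeomorphism to a charted space is charted by the same model. -/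
@[reducible] def chartedSpaceOfLocalHomeomorph (H : Type*) [TopologicalSpace H] {X Y : Type*}
    [TopologicalSpace X] [TopologicalSpace Y] [ChartedSpace H Y] {π : X → Y}
    (hπ : IsLocalHomeomorph π) : ChartedSpace H X where
  atlas := Set.range fun x => (hπ.localInverseAt x).symm.trans (chartAt H (π x))
  chartAt x := (hπ.localInverseAt x).symm.trans (chartAt H (π x))
  mem_chart_source x := by simp
  chart_mem_atlas x := ⟨x, rfl⟩

instance : ChartedSpace ℂ Sphere where
  atlas := Set.univ
  chartAt x :=
    let hx := (exists_isSphereChart x).choose_spec.choose_spec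
    (hx.1.isOpenEmbedding.toOpenPartialHomeomorph _).symm
  mem_chart_source x :=
    let hx := (exists_isSphereChart x).choose_spec.choose_spec
    ⟨_, trivial, hx.2⟩
  chart_mem_atlas _ := trivial

instance : SecondCountableTopology Sphere :=
  ChartedSpace.secondCountable_of_sigmaCompact ℂ Sphere

instance : LocallyPathConnectedSpace Sphere := ChartedSpace.locallyPathConnectedSpace ℂ Sphere

instance : ChartedSpace ℂ RegularGerm :=
  chartedSpaceOfLocalHomeomorph ℂ RegularGerm.isLocalHomeomorph_pt

instance : LocallyPathConnectedSpace RegularGerm :=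
  ChartedSpace.locallyPathConnectedSpace ℂ RegularGerm

theorem exists_path_notMem {A : Set Sphere} (hA : A.Countable) {x y : Sphere} (hx : x ∉ A)
    (hy : y ∉ A) : ∃ γ : Path x y, ∀ t, γ t ∉ A := by
  have : PathConnectedSpace Sphere := .of_locallyPathConnectedSpace
  have hA' : LocallyCountable A := fun z => ⟨Set.univ, univ_mem, hA.mono Set.inter_subset_left⟩
  obtain ⟨γ, hγ⟩ := hA'.joinedIn_diff one_lt_rank_real_complex isOpen_univ
    (joinedIn_univ.2 (PathConnectedSpace.joined x y)) hx hy
  exact ⟨γ, fun t => (hγ t).2⟩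

/-! ### The Poincaré–Volterra theorem -/

theorem exists_countable_sUnion_eq_univ {X : Type*} [TopologicalSpace X] [PreconnectedSpace X]
    {𝒲 : Set (Set X)} (hopen : ∀ W ∈ 𝒲, IsOpen W) (hcover : ⋃₀ 𝒲 = Set.univ)
    (hstar : ∀ W ∈ 𝒲, {W' ∈ 𝒲 | (W ∩ W').Nonempty}.Countable) :
    ∃ 𝒢 ⊆ 𝒲, 𝒢.Countable ∧ ⋃₀ 𝒢 = Set.univ := by
  rcases isEmpty_or_nonempty X with _ | ⟨⟨x₀⟩⟩
  · exact ⟨∅, Set.empty_subset _, Set.countable_empty, Subsingleton.elim _ _⟩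
  have hmem (x : X) : ∃ W ∈ 𝒲, x ∈ W := Set.mem_sUnion.1 (hcover ▸ Set.mem_univ x)
  obtain ⟨W₀, hW₀, hxW₀⟩ := hmem x₀
  -- the members of the cover that are linked to `W₀` by a chain of overlapping members
  let next : Set (Set X) → Set (Set X) := fun 𝒢 => ⋃ W ∈ 𝒢, {W' ∈ 𝒲 | (W ∩ W').Nonempty}
  let G : ℕ → Set (Set X) := fun n => next^[n] {W₀}
  have hGsucc (n) : G (n + 1) = next (G n) := Function.iterate_succ_apply' _ _ _
  have hG (n) : G n ⊆ 𝒲 ∧ (G n).Countable := by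
    induction n with
    | zero => exact ⟨Set.singleton_subset_iff.2 hW₀, Set.countable_singleton W₀⟩
    | succ n ih =>
      rw [hGsucc]
      exact ⟨Set.iUnion₂_subset fun W _ W' hW' => hW'.1,
        ih.2.biUnion fun W hW => hstar W (ih.1 hW)⟩
  have hsub : ⋃ n, G n ⊆ 𝒲 := Set.iUnion_subset fun n => (hG n).1
  refine ⟨⋃ n, G n, hsub, Set.countable_iUnion fun n => (hG n).2,
    IsClopen.eq_univ ⟨?_, isOpen_sUnion fun W hW => hopen W (hsub hW)⟩
      ⟨x₀, W₀, Set.mem_iUnion.2 ⟨0, rfl⟩, hxW₀⟩⟩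
  refine isClosed_of_closure_subset fun x hx => ?_
  obtain ⟨W', hW', hxW'⟩ := hmem x
  obtain ⟨y, hyW', W, hW, hyW⟩ := mem_closure_iff.1 hx W' (hopen W' hW') hxW'
  obtain ⟨n, hn⟩ := Set.mem_iUnion.1 hW
  exact ⟨W', Set.mem_iUnion.2 ⟨n + 1, hGsucc n ▸ Set.mem_biUnion hn ⟨hW', y, hyW, hyW'⟩⟩, hxW'⟩

section Sheets

variable {X Y : Type*} [TopologicalSpace X] [TopologicalSpace Y]

/-- `W` is a sheet of the map `π` over `b`: an open set that `π` sends homeomorphically onto `b`.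
It is encoded as the image of a section of `π` over `b`. -/
def IsSheet (π : X → Y) (b : Set Y) (W : Set X) : Prop :=
  IsOpen W ∧ ∃ σ : Y → X, ContinuousOn σ b ∧ (∀ y ∈ b, π (σ y) = y) ∧ W = σ '' b

variable {π : X → Y} {b : Set Y} {W W' : Set X}

theorem IsSheet.eq [T2Space X] (hπ : IsLocallyInjective π) (hb : IsPreconnected b)
    (hW : IsSheet π b W) (hW' : IsSheet π b W') {x : X} (hx : x ∈ W) (hx' : x ∈ W') : W = W' := by
  obtain ⟨-, σ, hσ, hσπ, rfl⟩ := hW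
  obtain ⟨-, τ, hτ, hτπ, rfl⟩ := hW'
  obtain ⟨y, hy, rfl⟩ := hx
  obtain ⟨z, hz, hzy⟩ := hx'
  obtain rfl : z = y := by rw [← hτπ z hz, hzy, hσπ y hy]
  have hcomp : Set.EqOn (π ∘ σ) (π ∘ τ) b := fun u hu => (hσπ u hu).trans (hτπ u hu).symm
  exact Set.image_congr
    ((T2Space.isSeparatedMap π).eqOn_of_comp_eqOn hπ hb hσ hτ hcomp hy hzy.symm)

theorem IsSheet.isOpenEmbedding (hπ : IsLocalHomeomorph π) (hW : IsSheet π b W) :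
    IsOpenEmbedding (fun x : W => π x) := by
  obtain ⟨hWo, σ, -, hσπ, rfl⟩ := hW
  refine (hπ.comp hWo.isOpenEmbedding_subtypeVal.isLocalHomeomorph).isOpenEmbedding_of_injective ?_
  rintro ⟨_, y, hy, rfl⟩ ⟨_, z, hz, rfl⟩ (hyz : π (σ y) = π (σ z))
  rw [hσπ y hy, hσπ z hz] at hyz
  simp only [hyz]

theorem exists_isSheet (hπ : IsLocalHomeomorph π) {B : Set (Set Y)}
    (hB : TopologicalSpace.IsTopologicalBasis B) (x : X) : ∃ b ∈ B, ∃ W, IsSheet π b W ∧ x ∈ W := by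
  set s := hπ.localInverseAt x
  obtain ⟨b, hb, hxb, hbs⟩ := hB.exists_subset_of_mem_open
    (show π x ∈ s.source from hπ.apply_self_mem_localInverseAt_source) s.open_source
  exact ⟨b, hb, s '' b, ⟨s.isOpen_image_of_subset_source (hB.isOpen hb) hbs, s,
    s.continuousOn.mono hbs, fun y hy => hπ.apply_localInverseAt_of_mem (hbs hy), rfl⟩,
    π x, hxb, hπ.localInverseAt_apply_self⟩

theorem countable_setOf_isSheet_inter_nonempty [T2Space X] [SecondCountableTopology Y]
    (hπ : IsLocalHomeomorph π) {B : Set (Set Y)} (hB : B.Countable)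
    (hBconn : ∀ b ∈ B, IsPreconnected b) (hW : IsSheet π b W) :
    {W' | (∃ c ∈ B, IsSheet π c W') ∧ (W ∩ W').Nonempty}.Countable := by
  have := (hW.isOpenEmbedding hπ).isEmbedding.secondCountableTopology
  obtain ⟨D, hD, hDdense⟩ := TopologicalSpace.exists_countable_dense W
  refine (hB.biUnion (t := fun c _ => ⋃ d ∈ D, {W' | IsSheet π c W' ∧ ↑d ∈ W'}) fun c hc =>
    hD.biUnion fun d _ => Set.Subsingleton.countable fun W₁ hW₁ W₂ hW₂ =>
      hW₁.1.eq hπ.isLocallyInjective (hBconn c hc) hW₂.1 hW₁.2 hW₂.2).mono ?_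
  rintro W' ⟨⟨c, hc, hW'⟩, x, hxW, hxW'⟩
  obtain ⟨d, hdW', hdD⟩ := hDdense.inter_open_nonempty _
    (hW'.1.preimage continuous_subtype_val) ⟨⟨x, hxW⟩, hxW'⟩
  exact Set.mem_biUnion hc (Set.mem_biUnion hdD ⟨hW', hdW'⟩)

theorem secondCountableTopology_of_isLocalHomeomorph [T2Space X] [PreconnectedSpace X]
    [SecondCountableTopology Y] [LocallyConnectedSpace Y] (hπ : IsLocalHomeomorph π) :
    SecondCountableTopology X := by
  obtain ⟨B, hBsub, hBcount, hB⟩ :=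
    (TopologicalSpace.IsTopologicalBasis.isOpen_isPreconnected (α := Y)).exists_countable
  set 𝒲 : Set (Set X) := {W | ∃ b ∈ B, IsSheet π b W}
  have hcover : ⋃₀ 𝒲 = Set.univ := Set.eq_univ_of_forall fun x => by
    obtain ⟨b, hb, W, hW, hxW⟩ := exists_isSheet hπ hB x
    exact ⟨W, ⟨b, hb, hW⟩, hxW⟩
  have hopen : ∀ W ∈ 𝒲, IsOpen W := fun W ⟨_, _, hW⟩ => hW.1
  obtain ⟨𝒢, hsub, hcount, huniv⟩ := exists_countable_sUnion_eq_univ hopen hcover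
    fun W ⟨_, _, hW⟩ =>
      countable_setOf_isSheet_inter_nonempty hπ hBcount (fun c hc => (hBsub hc).2) hW
  have : Countable 𝒢 := hcount.to_subtype
  have (W : 𝒢) : SecondCountableTopology (W : Set X) := by
    obtain ⟨b, -, hW⟩ := hsub W.2
    exact (hW.isOpenEmbedding hπ).isEmbedding.secondCountableTopology
  exact TopologicalSpace.secondCountableTopology_of_countable_cover
    (U := fun W : 𝒢 => (W : Set X)) (fun W => hopen W (hsub W.2))
    (Set.sUnion_eq_iUnion.symm.trans huniv)

theorem countable_of_subset_pathComponent [T2Space X] [LocallyPathConnectedSpace X]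
    [SecondCountableTopology Y] [LocallyConnectedSpace Y] (hπ : IsLocalHomeomorph π) {x : X}
    {Z : Set X} (hZ : Z ⊆ pathComponent x) (hloc : ∀ z ∈ Z, ∃ N ∈ 𝓝 z, (Z ∩ N).Countable) :
    Z.Countable := by
  have : PreconnectedSpace (pathComponent x) :=
    Subtype.preconnectedSpace isPathConnected_pathComponent.isConnected.isPreconnected
  have : SecondCountableTopology (pathComponent x) := secondCountableTopology_of_isLocalHomeomorph
    (hπ.comp (IsOpen.pathComponent x).isOpenEmbedding_subtypeVal.isLocalHomeomorph)
  have hZ' : IsLindelof (Subtype.val '' (Subtype.val ⁻¹' Z : Set (pathComponent x))) :=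
    (HereditarilyLindelofSpace.isLindelof _).image continuous_subtype_val
  rw [Subtype.image_preimage_coe, Set.inter_eq_right.2 hZ] at hZ'
  refine hZ'.induction_on (fun _ _ hst ht => ht.mono hst) (fun S hS hSc => hS.sUnion hSc)
    fun z hz => ?_
  obtain ⟨N, hN, hZN⟩ := hloc z hz
  exact ⟨Z ∩ N, inter_mem_nhdsWithin Z hN, hZN⟩

end Sheets

/-! ### Analytic continuation -/

namespace RegularGerm

theorem lift_eqOn {T : Type*} [TopologicalSpace T] {s : Set T} (hs : IsPreconnected s)
    {G H : T → RegularGerm} (hG : ContinuousOn G s) (hH : ContinuousOn H s)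
    (hpt : ∀ t ∈ s, (G t).pt = (H t).pt) {a : T} (ha : a ∈ s) (hGH : G a = H a) :
    s.EqOn G H :=
  (T2Space.isSeparatedMap pt).eqOn_of_comp_eqOn isLocalHomeomorph_pt.isLocallyInjective hs hG hH
    hpt ha hGH

theorem continuousAt_ofFun {h : Sphere → ℂ} {x : Sphere} (hx : HolomorphicAt h x) :
    ContinuousAt (ofFun h) x := by
  have := tendsto_ofFun (isGermOf_ofFun hx)
  rwa [ofFun_pt] at this

theorem isGermOf_of_isPreconnected {T : Type*} [TopologicalSpace T] {s : Set T}
    (hs : IsPreconnected s) {G : T → RegularGerm} (hG : ContinuousOn G s) {h : Sphere → ℂ}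
    (hh : ∀ t ∈ s, HolomorphicAt h (G t).pt) {a : T} (ha : a ∈ s) (hGa : (G a).IsGermOf h)
    {t : T} (ht : t ∈ s) : (G t).IsGermOf h := by
  have : s.EqOn G (fun t => ofFun h (G t).pt) := by
    refine lift_eqOn hs hG (fun u hu => ?_) (fun u _ => (ofFun_pt _ _).symm) ha (eq_ofFun hGa)
    exact ContinuousAt.comp_continuousWithinAt (f := fun t => (G t).pt)
      (continuousAt_ofFun (hh u hu)) (continuous_pt.continuousAt.comp_continuousWithinAt (hG u hu))
  rw [this ht]
  exact isGermOf_ofFun (hh t ht)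

theorem isGermOf_of_joinedIn {U : Set Sphere} {h : Sphere → ℂ} (hh : ∀ x ∈ U, HolomorphicAt h x)
    {p q : RegularGerm} (hpq : JoinedIn (pt ⁻¹' U) p q) (hp : p.IsGermOf h) : q.IsGermOf h := by
  obtain ⟨Γ, hΓ⟩ := hpq
  have := isGermOf_of_isPreconnected (t := 1) isPreconnected_univ Γ.continuous.continuousOn
    (fun t _ => hh _ (hΓ t)) (Set.mem_univ 0) (by rwa [Γ.source]) trivial
  rwa [Γ.target] at this

end RegularGerm

theorem continuesTo_of_continuous {a b : Sphere} (γ : Path a b) {G : unitInterval → RegularGerm}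
    (hG : Continuous G) (hpt : ∀ t, (G t).pt = γ t) : ContinuesTo γ (G 0) (G 1) :=
  ⟨⟨⟨G, hG⟩, rfl, rfl⟩, hpt⟩

theorem ContinuesTo.pt_eq_left {a b : Sphere} {γ : Path a b} {p q : RegularGerm}
    (h : ContinuesTo γ p q) : p.pt = a := by
  obtain ⟨Γ, hΓ⟩ := h
  have := hΓ 0
  rwa [Γ.source, γ.source] at this

theorem ContinuesTo.pt_eq_right {a b : Sphere} {γ : Path a b} {p q : RegularGerm}
    (h : ContinuesTo γ p q) : q.pt = b := h.symm.pt_eq_left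

theorem ContinuesTo.unique {a b : Sphere} {γ : Path a b} {p q r : RegularGerm}
    (h : ContinuesTo γ p q) (h' : ContinuesTo γ p r) : q = r := by
  obtain ⟨Γ, hΓ⟩ := h
  obtain ⟨Δ, hΔ⟩ := h'
  have := lift_eqOn (a := 0) isPreconnected_univ Γ.continuous.continuousOn
    Δ.continuous.continuousOn (fun t _ => (hΓ t).trans (hΔ t).symm) trivial
    (Γ.source.trans Δ.source.symm) (Set.mem_univ 1)
  rwa [Γ.target, Δ.target] at this

theorem ContinuesTo.generatedBy_eq {a b : Sphere} {γ : Path a b} {p q : RegularGerm}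
    (h : ContinuesTo γ p q) : generatedBy p = generatedBy q := by
  obtain ⟨Γ, -⟩ := h
  exact Quotient.sound ⟨Γ⟩

theorem joined_of_generatedBy_eq {p q : RegularGerm} (h : generatedBy p = generatedBy q) :
    Joined p q := Quotient.exact h

theorem continuesUpTo_one_iff {a b : Sphere} {γ : Path a b} {p : RegularGerm} :
    ContinuesUpTo γ p 1 ↔ ∃ q, ContinuesTo γ p q := by
  constructor
  · rintro ⟨Γ, hΓ, h0, hpt⟩
    have : Set.Icc (0 : unitInterval) 1 = Set.univ := Set.eq_univ_of_forall fun t => ⟨t.2.1, t.2.2⟩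
    rw [this, continuousOn_univ] at hΓ
    exact ⟨Γ 1, h0 ▸ continuesTo_of_continuous γ hΓ fun t => hpt t ⟨t.2.1, t.2.2⟩⟩
  · rintro ⟨q, Γ, hΓ⟩
    exact ⟨Γ, Γ.continuous.continuousOn, Γ.source, fun t _ => hΓ t⟩

theorem ContinuesUpTo.mono {a b : Sphere} {γ : Path a b} {p : RegularGerm} {σ τ : unitInterval}
    (h : ContinuesUpTo γ p τ) (hστ : σ ≤ τ) : ContinuesUpTo γ p σ := by
  obtain ⟨Γ, hΓ, h0, hpt⟩ := h
  have : Set.Icc 0 σ ⊆ Set.Icc 0 τ := Set.Icc_subset_Icc_right hστ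
  exact ⟨Γ, hΓ.mono this, h0, fun t ht => hpt t (this ht)⟩

theorem continuesUpTo_zero {a b : Sphere} {γ : Path a b} {p : RegularGerm} (hp : p.pt = a) :
    ContinuesUpTo γ p 0 := by
  refine ⟨fun _ => p, continuousOn_const, rfl, fun t ht => ?_⟩
  rw [Set.Icc_self] at ht
  rw [ht, γ.source, hp]

theorem continuesUpTo_extend {a b : Sphere} {γ : Path a b} {p : RegularGerm} {t τ : unitInterval}
    {Γ : unitInterval → RegularGerm} (hΓ : ContinuousOn Γ (Set.Icc 0 t)) (h0 : Γ 0 = p)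
    (hpt : ∀ s ∈ Set.Icc 0 t, (Γ s).pt = γ s) (htτ : t ≤ τ) {k : Sphere → ℂ}
    (hk : ∀ s ∈ Set.Icc t τ, HolomorphicAt k (γ s)) (hΓk : (Γ t).IsGermOf k) :
    ContinuesUpTo γ p τ := by
  classical
  have ht : t ∈ Set.Icc 0 t := ⟨t.2.1, le_rfl⟩
  set G : unitInterval → RegularGerm := fun s => if s ≤ t then Γ s else ofFun k (γ s)
  have hGΓ : (Set.Icc 0 t).EqOn G Γ := fun s hs => if_pos hs.2
  have hGk : (Set.Icc t τ).EqOn G (fun s => ofFun k (γ s)) := fun s hs => by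
    rcases hs.1.eq_or_lt with rfl | hts
    · exact (hGΓ ht).trans ((eq_ofFun hΓk).trans (by rw [hpt t ht]))
    · exact if_neg hts.not_ge
  have hkcont : ContinuousOn (fun s => ofFun k (γ s)) (Set.Icc t τ) := fun s hs =>
    ((continuousAt_ofFun (hk s hs)).comp γ.continuous.continuousAt).continuousWithinAt
  refine ⟨G, ?_, (hGΓ ⟨le_rfl, t.2.1⟩).trans h0, fun s hs => ?_⟩
  · rw [← Set.Icc_union_Icc_eq_Icc (show 0 ≤ t from t.2.1) htτ]
    exact (hΓ.congr hGΓ).union_of_isClosed (hkcont.congr hGk) isClosed_Icc isClosed_Icc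
  · rcases le_total s t with hst | hts
    · rw [hGΓ ⟨hs.1, hst⟩, hpt s ⟨hs.1, hst⟩]
    · rw [hGk ⟨hts, hs.2⟩, ofFun_pt]

theorem ContinuesUpTo.eventually {a b : Sphere} {γ : Path a b} {p : RegularGerm}
    {t : unitInterval} (h : ContinuesUpTo γ p t) : ∀ᶠ τ in 𝓝 t, ContinuesUpTo γ p τ := by
  obtain ⟨Γ, hΓ, h0, hpt⟩ := h
  have hhol : HolomorphicAt (Γ t).rep (γ t) :=
    hpt t ⟨t.2.1, le_rfl⟩ ▸ (Γ t).isGermOf_rep.holomorphicAt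
  have hev := γ.continuous.continuousAt.eventually hhol.eventually
  have hright : ∀ᶠ τ in 𝓝 t, ∀ s ∈ Set.Icc t τ, HolomorphicAt (Γ t).rep (γ s) :=
    (tendsto_const_nhds.Icc tendsto_id).eventually hev.smallSets
  filter_upwards [hright] with τ hτ
  rcases le_total τ t with hτt | htτ
  · exact ContinuesUpTo.mono ⟨Γ, hΓ, h0, hpt⟩ hτt
  · exact continuesUpTo_extend hΓ h0 hpt htτ hτ (Γ t).isGermOf_rep

theorem continuesUpTo_one_of_closed {a b : Sphere} {γ : Path a b} {p : RegularGerm}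
    (hp : p.pt = a) (hcl : ∀ τ : unitInterval, 0 < τ → (∀ σ < τ, ContinuesUpTo γ p σ) →
      ContinuesUpTo γ p τ) : ContinuesUpTo γ p 1 := by
  have hopen : IsOpen {τ | ContinuesUpTo γ p τ} :=
    isOpen_iff_mem_nhds.2 fun τ hτ => ContinuesUpTo.eventually hτ
  have hclosed : IsClosed {τ | ContinuesUpTo γ p τ} := by
    refine isClosed_of_closure_subset fun τ hτ => ?_
    rcases eq_or_ne τ 0 with rfl | hτ0
    · exact continuesUpTo_zero hp
    · refine hcl τ (lt_of_le_of_ne τ.2.1 hτ0.symm) fun σ hσ => ?_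
      obtain ⟨s, hσs, hs⟩ := mem_closure_iff.1 hτ (Set.Ioi σ) isOpen_Ioi hσ
      exact ContinuesUpTo.mono hs (le_of_lt hσs)
  exact (IsClopen.eq_univ ⟨hclosed, hopen⟩ ⟨0, continuesUpTo_zero hp⟩).ge trivial

theorem continuesUpTo_iff_of_eq_mul {a b c : Sphere} {γ : Path a b} {δ : Path a c}
    {τ : unitInterval} (hτ : 0 < τ) (hδ : ∀ s, δ s = γ (τ * s)) {p : RegularGerm}
    {s : unitInterval} : ContinuesUpTo δ p s ↔ ContinuesUpTo γ p (τ * s) := by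
  have hτ' : (0 : ℝ) < τ := hτ
  constructor
  · rintro ⟨G, hG, h0, hpt⟩
    let ρ : unitInterval → unitInterval := fun t => Set.projIcc 0 1 zero_le_one (t / τ)
    have hρ : Continuous ρ := continuous_projIcc.comp (by fun_prop)
    have hρs : ∀ t ∈ Set.Icc 0 (τ * s), τ * ρ t = t ∧ ρ t ∈ Set.Icc 0 s := fun t ht => by
      have hts : (t : ℝ) / τ ≤ s := (div_le_iff₀' hτ').2 ht.2
      have hρt : (ρ t : ℝ) = t / τ := congrArg Subtype.val
        (Set.projIcc_of_mem zero_le_one ⟨div_nonneg t.2.1 hτ'.le, hts.trans s.2.2⟩)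
      refine ⟨Subtype.ext ?_, (ρ t).2.1, Subtype.coe_le_coe.1 (hρt ▸ hts)⟩
      rw [Set.Icc.coe_mul, hρt, mul_div_cancel₀ _ hτ'.ne']
    refine ⟨G ∘ ρ, hG.comp hρ.continuousOn fun t ht => (hρs t ht).2, ?_, fun t ht => ?_⟩
    · rw [Function.comp_apply, ← h0]
      exact congrArg G (Subtype.ext (by simp [ρ]))
    · rw [Function.comp_apply, hpt _ (hρs t ht).2, hδ, (hρs t ht).1]
  · rintro ⟨Γ, hΓ, h0, hpt⟩
    have hmul : ∀ u ∈ Set.Icc 0 s, τ * u ∈ Set.Icc 0 (τ * s) := fun u hu =>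
      ⟨(τ * u).2.1, Subtype.coe_le_coe.1 (mul_le_mul_of_nonneg_left hu.2 hτ'.le)⟩
    exact ⟨fun u => Γ (τ * u), hΓ.comp (by fun_prop) hmul, by simpa only [mul_zero] using h0,
      fun u hu => (hpt _ (hmul u hu)).trans (hδ u).symm⟩

theorem continuesUpTo_one_of_forall_not_isSingularPoint {p : RegularGerm} {b : Sphere}
    (γ : Path p.pt b) (hγ : ∀ t, ¬ IsSingularPoint p (γ t)) : ContinuesUpTo γ p 1 := by
  refine continuesUpTo_one_of_closed rfl fun τ hτ hσ => by_contra fun hn => hγ τ ?_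
  let δ : Path p.pt (γ τ) := ⟨⟨fun s => γ (τ * s), by fun_prop⟩, by simp, by simp⟩
  have hδ {s : unitInterval} : ContinuesUpTo δ p s ↔ ContinuesUpTo γ p (τ * s) :=
    continuesUpTo_iff_of_eq_mul hτ fun _ => rfl
  refine ⟨δ, by rwa [hδ, mul_one], fun s hs => hδ.2 (hσ _ ?_)⟩
  exact Subtype.coe_lt_coe.1 (mul_lt_of_lt_one_right (show (0 : ℝ) < τ from hτ) hs)

/-! ### Singular points lie in every countable forbidden set -/

theorem exists_continuousOn_concat {Y : Type*} [TopologicalSpace Y] (y : ℕ → Y) (S : ℕ → Set Y)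
    (h : ∀ n, JoinedIn (S n) (y n) (y (n + 1))) :
    ∃ β : ℝ → Y, ContinuousOn β (Set.Ici 0) ∧ (∀ n : ℕ, β n = y n) ∧
      ∀ n : ℕ, ∀ t ∈ Set.Icc (n : ℝ) (n + 1), β t ∈ S n := by
  choose P hP using h
  set β : ℝ → Y := fun t => (P ⌊t⌋₊).extend (t - ⌊t⌋₊) with hβ
  have hβn : ∀ n : ℕ, β n = y n := fun n => by simp [hβ]
  have hβP (n : ℕ) : (Set.Icc (n : ℝ) (n + 1)).EqOn β fun t => (P n).extend (t - n) := by
    intro t ht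
    rcases ht.2.lt_or_eq with hlt | rfl
    · have hfloor : ⌊t⌋₊ = n := (Nat.floor_eq_iff (n.cast_nonneg.trans ht.1)).2 ⟨ht.1, hlt⟩
      change (P ⌊t⌋₊).extend (t - ⌊t⌋₊) = _
      rw [hfloor]
    · rw [← Nat.cast_succ, hβn]
      simp
  have hcover : Set.Ici (0 : ℝ) ⊆ ⋃ n : ℕ, Set.Icc (n : ℝ) (n + 1) := fun t ht =>
    Set.mem_iUnion.2 ⟨⌊t⌋₊, Nat.floor_le ht, (Nat.lt_floor_add_one t).le⟩
  have hfinite : LocallyFinite fun n : ℕ => Set.Icc (n : ℝ) (n + 1) := fun t => by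
    refine ⟨Set.Iio (t + 1), Iio_mem_nhds (lt_add_one t),
      (Set.finite_Iic ⌊t + 1⌋₊).subset ?_⟩
    rintro n ⟨s, hs, hst⟩
    exact Nat.le_floor (hs.1.trans (le_of_lt hst))
  refine ⟨β, ContinuousOn.mono (hfinite.continuousOn_iUnion (fun n => isClosed_Icc) fun n => ?_)
    hcover, hβn, fun n t ht => ?_⟩
  · exact ((P n).continuous_extend.comp (continuous_sub_right _)).continuousOn.congr (hβP n)
  · have ht' : t - n ∈ unitInterval := ⟨by linarith [ht.1], by linarith [ht.2]⟩
    exact ((hβP n ht).trans (Path.extend_apply _ ht')) ▸ hP n _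

theorem exists_continuousOn_Iio_concat {Y : Type*} [TopologicalSpace Y] {y : ℕ → Y}
    {S : ℕ → Set Y} (hS : Antitone S) (h : ∀ n, JoinedIn (S n) (y n) (y (n + 1))) :
    ∃ β : unitInterval → Y, ContinuousOn β (Set.Iio 1) ∧ β 0 = y 0 ∧ (∀ s < 1, β s ∈ S 0) ∧
      ∀ n, ∀ᶠ s in 𝓝[<] 1, JoinedIn (S n) (y n) (β s) := by
  obtain ⟨β, hβ, hβy, hβS⟩ := exists_continuousOn_concat y S h
  have hβS' (n : ℕ) (t : ℝ) (ht : n ≤ t) : β t ∈ S n :=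
    hS (Nat.le_floor ht) (hβS ⌊t⌋₊ t ⟨Nat.floor_le (n.cast_nonneg.trans ht),
      (Nat.lt_floor_add_one t).le⟩)
  let ρ : unitInterval → ℝ := fun s => s / (1 - s)
  have hρ0 (s) : 0 ≤ ρ s := div_nonneg s.2.1 (sub_nonneg.2 s.2.2)
  have hρ : ContinuousOn ρ (Set.Iio 1) := ContinuousOn.div (by fun_prop) (by fun_prop)
    fun s hs => (sub_pos.2 (show (s : ℝ) < 1 from hs)).ne'
  have hρtop : Tendsto ρ (𝓝[<] 1) atTop := by
    refine Tendsto.pos_mul_atTop one_pos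
      (tendsto_nhdsWithin_of_tendsto_nhds (continuous_subtype_val.tendsto 1))
      (tendsto_inv_nhdsGT_zero.comp (tendsto_nhdsWithin_iff.2 ⟨?_, ?_⟩))
    · refine tendsto_nhdsWithin_of_tendsto_nhds (Continuous.tendsto' (by fun_prop) _ _ (by simp))
    · filter_upwards [self_mem_nhdsWithin] with s hs using
        sub_pos.2 (show (s : ℝ) < 1 from hs)
  refine ⟨β ∘ ρ, hβ.comp hρ fun s _ => hρ0 s, ?_, fun s _ => hβS' 0 _ (by simpa using hρ0 s),
    fun n => ?_⟩
  · simpa [ρ] using hβy 0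
  · filter_upwards [hρtop.eventually_ge_atTop (n : ℝ)] with s hs
    have hpath : IsPathConnected (β '' Set.Icc (n : ℝ) (ρ s)) :=
      ((convex_Icc (n : ℝ) (ρ s)).isPathConnected ⟨n, Set.left_mem_Icc.2 hs⟩).image'
        (hβ.mono fun t ht => n.cast_nonneg.trans ht.1)
    refine (hpath.joinedIn _ ⟨n, Set.left_mem_Icc.2 hs, hβy n⟩ _
      ⟨ρ s, Set.right_mem_Icc.2 hs, rfl⟩).mono ?_
    rintro _ ⟨t, ht, rfl⟩
    exact hβS' n t ht.1

theorem exists_hasAntitoneBasis_isOpen {Y : Type*} [TopologicalSpace Y] (b : Y)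
    [(𝓝 b).IsCountablyGenerated] :
    ∃ D : ℕ → Set Y, (𝓝 b).HasAntitoneBasis D ∧ D 0 = Set.univ ∧ ∀ n, IsOpen (D n) := by
  obtain ⟨V, hV, hbasis⟩ := (nhds_basis_opens b).exists_antitone_subbasis
  refine ⟨fun n => n.casesOn Set.univ V, ⟨?_, antitone_nat_of_succ_le ?_⟩, rfl, ?_⟩
  · refine hbasis.1.to_hasBasis (fun n _ => ⟨n + 1, trivial, subset_rfl⟩) fun n _ => ?_
    cases n with
    | zero => exact ⟨0, trivial, Set.subset_univ _⟩
    | succ n => exact ⟨n, trivial, subset_rfl⟩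
  · rintro (_ | n)
    exacts [Set.subset_univ _, hbasis.2 n.le_succ]
  · rintro (_ | n)
    exacts [isOpen_univ, (hV n).2]

theorem isPathConnected_Icc_unitInterval {s t : unitInterval} (h : s ≤ t) :
    IsPathConnected (Set.Icc s t) := by
  rw [IsInducing.subtypeVal.isPathConnected_iff, Set.image_subtype_val_Icc]
  exact (convex_Icc _ _).isPathConnected ⟨s, le_rfl, h⟩

theorem joinedIn_of_continuousOn_Iio {X : Type*} [TopologicalSpace X] {G : unitInterval → X}
    (hG : ContinuousOn G (Set.Iio 1)) {s s' : unitInterval} (hss' : s ≤ s') (hs' : s' < 1)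
    {O : Set X} (hO : ∀ u ∈ Set.Ico s 1, G u ∈ O) : JoinedIn O (G s) (G s') := by
  have hpath := (isPathConnected_Icc_unitInterval hss').image'
    (hG.mono fun u hu => hu.2.trans_lt hs')
  refine (hpath.joinedIn _ ⟨s, Set.left_mem_Icc.2 hss', rfl⟩ _
    ⟨s', Set.right_mem_Icc.2 hss', rfl⟩).mono ?_
  rintro _ ⟨u, hu, rfl⟩
  exact hO u ⟨hu.1, hu.2.trans_lt hs'⟩

theorem LocallyCountable.exists_continuousOn_notMem_of_tendsto {E X Y : Type*}
    [NormedAddCommGroup E] [NormedSpace ℝ E] [TopologicalSpace X] [ChartedSpace E X]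
    [LocallyPathConnectedSpace X] [TopologicalSpace Y] {S : Set X} (hS : LocallyCountable S)
    (hE : 1 < Module.rank ℝ E) {f : X → Y} (hf : Continuous f) {b : Y}
    [(𝓝 b).IsCountablyGenerated] {G : unitInterval → X} (hG : ContinuousOn G (Set.Iio 1))
    (hlim : Tendsto (f ∘ G) (𝓝[<] 1) (𝓝 b)) (h0 : G 0 ∉ S) :
    ∃ β : unitInterval → X, ContinuousOn β (Set.Iio 1) ∧ β 0 = G 0 ∧ (∀ s < 1, β s ∉ S) ∧
      ∀ O ∈ 𝓝 b, ∀ᶠ s in 𝓝[<] 1, JoinedIn (f ⁻¹' O) (G s) (β s) := by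
  obtain ⟨D, hD, hD0, hDo⟩ := exists_hasAntitoneBasis_isOpen b
  have hpre (n) : IsOpen (f ⁻¹' D n) := (hDo n).preimage hf
  have hchoice (n : ℕ) : ∃ t < (1 : unitInterval), ∃ y ∉ S, (∀ u ∈ Set.Ico t 1, f (G u) ∈ D n) ∧
      JoinedIn (f ⁻¹' D n) (G t) y ∧ (n = 0 → y = G 0) := by
    cases n with
    | zero => exact ⟨0, zero_lt_one, G 0, h0, fun u _ => hD0 ▸ trivial,
        JoinedIn.refl (hD0 ▸ trivial), fun _ => rfl⟩
    | succ n =>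
      obtain ⟨t, ht, htD⟩ := (nhdsLT_basis_Ico_of_exists_lt ⟨0, zero_lt_one⟩).mem_iff.1
        (hlim.eventually (hD.1.mem_of_mem (i := n + 1) trivial))
      have htD' : f (G t) ∈ D (n + 1) := htD ⟨le_rfl, ht⟩
      obtain ⟨y, hyS, hy⟩ := ((hS.frequently_notMem hE (G t)).and_eventually
        (pathComponentIn_mem_nhds ((hpre (n + 1)).mem_nhds htD'))).exists
      exact ⟨t, ht, y, hyS, fun u hu => htD hu, hy, fun hn => absurd hn n.succ_ne_zero⟩
  choose t ht y hyS htD htj hy0 using hchoice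
  have hstep (n) : JoinedIn (f ⁻¹' D n \ S) (y n) (y (n + 1)) := by
    have hsub : f ⁻¹' D (n + 1) ⊆ f ⁻¹' D n := Set.preimage_mono (hD.2 n.le_succ)
    refine hS.joinedIn_diff hE (hpre n)
      ((htj n).symm.trans (JoinedIn.trans ?_ ((htj (n + 1)).mono hsub))) (hyS _) (hyS _)
    rcases le_total (t n) (t (n + 1)) with hle | hle
    · exact joinedIn_of_continuousOn_Iio hG hle (ht _) (htD n)
    · exact ((joinedIn_of_continuousOn_Iio hG hle (ht _) (htD (n + 1))).mono hsub).symm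
  obtain ⟨β, hβ, hβ0, hβS, hβj⟩ := exists_continuousOn_Iio_concat
    (fun m n hmn => Set.sdiff_subset_sdiff_left (Set.preimage_mono (hD.2 hmn))) hstep
  refine ⟨β, hβ, hβ0.trans (hy0 0 rfl), fun s hs => (hβS s hs).2, fun O hO => ?_⟩
  obtain ⟨n, -, hn⟩ := hD.1.mem_iff.1 hO
  filter_upwards [hβj n, Ioo_mem_nhdsLT (ht n)] with s hs hst
  exact ((joinedIn_of_continuousOn_Iio hG hst.1.le hst.2 (htD n)).symm.trans
    ((htj n).trans (hs.mono Set.sdiff_subset))).mono (Set.preimage_mono hn)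

theorem exists_path_of_tendsto {Y : Type*} [TopologicalSpace Y] {g : unitInterval → Y} {a b : Y}
    (hg : ContinuousOn g (Set.Iio 1)) (h0 : g 0 = a) (hlim : Tendsto g (𝓝[<] 1) (𝓝 b)) :
    ∃ γ : Path a b, ∀ s < 1, γ s = g s := by
  classical
  have hne : {(1 : unitInterval)}ᶜ = Set.Iio 1 := Set.ext fun s => (lt_top_iff_ne_top (a := s)).symm
  have hcont : Continuous (Function.update g 1 b) := by
    refine continuous_iff_continuousAt.2 fun s => ?_
    rcases eq_or_ne s 1 with rfl | hs
    · rwa [continuousAt_update_same, hne]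
    · rw [continuousAt_update_of_ne hs]
      exact hg.continuousAt (hne ▸ isOpen_ne.mem_nhds hs)
  exact ⟨⟨⟨_, hcont⟩, (Function.update_of_ne zero_ne_one _ _).trans h0, Function.update_self _ _ _⟩,
    fun s hs => Function.update_of_ne hs.ne _ _⟩

/-- The germ `p` continues along every path that avoids `A`. -/
def ContinuableOff (A : Set Sphere) (p : RegularGerm) : Prop :=
  ∀ ⦃b : Sphere⦄ (γ : Path p.pt b), (∀ t, γ t ∉ A) → ContinuesUpTo γ p 1

theorem exists_lift_Iio {a b : Sphere} {γ : Path a b} {p : RegularGerm}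
    (h : ∀ τ : unitInterval, τ < 1 → ContinuesUpTo γ p τ) :
    ∃ Γ : unitInterval → RegularGerm, ContinuousOn Γ (Set.Iio 1) ∧ Γ 0 = p ∧
      ∀ t < 1, (Γ t).pt = γ t := by
  have : Nonempty RegularGerm := ⟨p⟩
  choose! G hG hG0 hGpt using h
  have hagree : ∀ τ < 1, (Set.Icc 0 τ).EqOn (fun t => G t t) (G τ) := by
    intro τ hτ t ht
    have ht1 : t < 1 := ht.2.trans_lt hτ
    have hsub : Set.Icc 0 t ⊆ Set.Icc 0 τ := Set.Icc_subset_Icc_right ht.2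
    exact lift_eqOn isPreconnected_Icc (hG t ht1) ((hG τ hτ).mono hsub)
      (fun u hu => (hGpt t ht1 u hu).trans (hGpt τ hτ u (hsub hu)).symm)
      (Set.left_mem_Icc.2 ht.1) ((hG0 t ht1).trans (hG0 τ hτ).symm) (Set.right_mem_Icc.2 ht.1)
  refine ⟨fun t => G t t, fun t ht => ?_, hG0 0 zero_lt_one,
    fun t ht => hGpt t ht t (Set.right_mem_Icc.2 t.2.1)⟩
  obtain ⟨τ, htτ, hτ⟩ := exists_between (show t < 1 from ht)
  exact ((((hG τ hτ).congr (hagree τ hτ)) t ⟨t.2.1, htτ.le⟩).mono_of_mem_nhdsWithin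
    (mem_nhdsWithin_of_mem_nhds (mem_of_superset (Iio_mem_nhds htτ)
      fun u hu => ⟨u.2.1, le_of_lt hu⟩)))

theorem ContinuableOff.exists_tendsto {A : Set Sphere} {β : unitInterval → RegularGerm}
    (hc : ContinuableOff A (β 0)) (hβ : ContinuousOn β (Set.Iio 1)) (hβA : ∀ s < 1, (β s).pt ∉ A)
    {b : Sphere} (hbA : b ∉ A) (hβb : Tendsto (pt ∘ β) (𝓝[<] 1) (𝓝 b)) :
    ∃ q : RegularGerm, q.pt = b ∧ Tendsto β (𝓝[<] 1) (𝓝 q) := by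
  obtain ⟨δ, hδ⟩ := exists_path_of_tendsto (continuous_pt.comp_continuousOn hβ) rfl hβb
  have hδA (s) : δ s ∉ A := by
    rcases eq_or_lt_of_le (show s ≤ 1 from s.2.2) with rfl | hs
    · rwa [δ.target]
    · exact hδ s hs ▸ hβA s hs
  obtain ⟨q, Δ, hΔ⟩ := continuesUpTo_one_iff.1 (hc δ hδA)
  have hΔβ : (Set.Iio 1).EqOn Δ β := lift_eqOn isPreconnected_Iio Δ.continuous.continuousOn hβ
    (fun s hs => (hΔ s).trans (hδ s hs)) (Set.mem_Iio.2 zero_lt_one) Δ.source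
  have hΔq : Tendsto Δ (𝓝[<] 1) (𝓝 q) :=
    tendsto_nhdsWithin_of_tendsto_nhds (Δ.continuous.tendsto' 1 q Δ.target)
  exact ⟨q, ContinuesTo.pt_eq_right ⟨Δ, hΔ⟩, hΔq.congr' (eventually_mem_nhdsWithin.mono hΔβ)⟩

/- A path along which `p` has no continuation may be replaced by one that, except at its end point
`b`, avoids `A`: the continuation along the part before `b` is pushed off the germs over `A`. -/
theorem IsSingularPoint.mem_of_continuableOff {A : Set Sphere} (hA : A.Countable)
    {p : RegularGerm} (hp : p.pt ∉ A) (hc : ContinuableOff A p) {b : Sphere}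
    (hb : IsSingularPoint p b) : b ∈ A := by
  obtain ⟨γ, hγ1, hγ⟩ := hb
  by_contra hbA
  obtain ⟨Γ, hΓ, rfl, hΓpt⟩ := exists_lift_Iio hγ
  have hγb : Tendsto γ (𝓝[<] 1) (𝓝 b) :=
    tendsto_nhdsWithin_of_tendsto_nhds (γ.continuous.tendsto' 1 b γ.target)
  have hΓb : Tendsto (pt ∘ Γ) (𝓝[<] 1) (𝓝 b) :=
    hγb.congr' (eventually_mem_nhdsWithin.mono fun s hs => (hΓpt s hs).symm)
  obtain ⟨β, hβ, hβ0, hβA, hβΓ⟩ :=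
    (LocallyCountable.preimage isLocalHomeomorph_pt.isLocallyInjective hA
      ).exists_continuousOn_notMem_of_tendsto one_lt_rank_real_complex continuous_pt hΓ hΓb hp
  have hβb : Tendsto (pt ∘ β) (𝓝[<] 1) (𝓝 b) := fun O hO =>
    (hβΓ O hO).mono fun s hs => hs.target_mem
  obtain ⟨q, hqb, hβq⟩ := ContinuableOff.exists_tendsto (hβ0.symm ▸ hc) hβ hβA hbA hβb
  have hβrep : ∀ᶠ s in 𝓝[<] 1, (β s).IsGermOf q.rep := hβq.eventually q.isGermOf_rep.eventually
  have hrep : ∀ᶠ x in 𝓝 b, HolomorphicAt q.rep x := hqb ▸ q.isGermOf_rep.holomorphicAt.eventually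
  obtain ⟨t, ht, hγt⟩ := (nhdsLT_basis_Ico_of_exists_lt ⟨0, zero_lt_one⟩).mem_iff.1
    (hγb.eventually hrep)
  have : (𝓝[<] (1 : unitInterval)).NeBot := nhdsLT_neBot_of_exists_lt ⟨0, zero_lt_one⟩
  obtain ⟨s, hs, hst, hs1⟩ := ((hβrep.and (hβΓ _ hrep)).and (Ioo_mem_nhdsLT ht)).exists
  have hΓs : (Γ s).IsGermOf q.rep := isGermOf_of_joinedIn (fun x hx => hx) hs.2.symm hs.1
  refine hγ1 (continuesUpTo_extend (hΓ.mono fun u hu => hu.2.trans_lt hs1) rfl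
    (fun u hu => hΓpt u (hu.2.trans_lt hs1)) hs1.le (fun u hu => ?_) hΓs)
  rcases eq_or_lt_of_le hu.2 with rfl | hu1
  · exact γ.target.symm ▸ hrep.self_of_nhds
  · exact hγt ⟨hst.le.trans hu.1, hu1⟩

/-! ### Tuples of germs at a common point -/

/-- Families of germs at a common point of the sphere, on which continuation acts simultaneously.
The base point is recorded so that it exists for the empty family too. -/
abbrev GermTuple (ι : Type*) : Type _ :=
  {τ : Sphere × (ι → RegularGerm) // ∀ i, (τ.2 i).pt = τ.1}

namespace GermTuple

variable {ι : Type*}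

/-- The common base point. -/
def base (τ : GermTuple ι) : Sphere := τ.1.1

/-- The germs of the family. -/
def germ (τ : GermTuple ι) (i : ι) : RegularGerm := τ.1.2 i

theorem germ_pt (τ : GermTuple ι) (i : ι) : (τ.germ i).pt = τ.base := τ.2 i

theorem continuous_base : Continuous (base (ι := ι)) := continuous_fst.comp continuous_subtype_val

theorem continuous_germ (i : ι) : Continuous fun τ : GermTuple ι => τ.germ i :=
  (continuous_apply i).comp (continuous_snd.comp continuous_subtype_val)

theorem ext {τ τ' : GermTuple ι} (hb : τ.base = τ'.base) (h : ∀ i, τ.germ i = τ'.germ i) :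
    τ = τ' := Subtype.ext (Prod.ext hb (funext h))

theorem tendsto_iff {α : Type*} {l : Filter α} {Φ : α → GermTuple ι} {τ : GermTuple ι} :
    Tendsto Φ l (𝓝 τ) ↔ Tendsto (fun a => (Φ a).base) l (𝓝 τ.base) ∧
      ∀ i, Tendsto (fun a => (Φ a).germ i) l (𝓝 (τ.germ i)) := by
  rw [tendsto_subtype_rng, Prod.tendsto_iff, tendsto_pi_nhds]
  rfl

theorem continuous_mk {α : Type*} [TopologicalSpace α] {b : α → Sphere} {g : α → ι → RegularGerm}
    (hb : Continuous b) (hg : ∀ i, Continuous fun a => g a i) (h : ∀ a i, (g a i).pt = b a) :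
    Continuous fun a => (⟨(b a, g a), h a⟩ : GermTuple ι) :=
  Continuous.subtype_mk (hb.prodMk (continuous_pi hg)) _

theorem isLocalHomeomorph_base [Finite ι] : IsLocalHomeomorph (base (ι := ι)) := by
  refine isLocalHomeomorph_of_injOn_of_nhds_le continuous_base (fun τ => ?_) fun τ V hV => ?_
  · refine ⟨{σ | ∀ i, (σ.germ i).IsGermOf (τ.germ i).rep}, ?_, fun σ hσ ρ hρ hb => ?_⟩
    · exact eventually_all.2 fun i => (continuous_germ i).continuousAt.eventually
        (τ.germ i).isGermOf_rep.eventually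
    · exact ext hb fun i => (hσ i).ext (hρ i) (by rw [germ_pt, germ_pt, hb])
  · let s : Sphere → GermTuple ι := fun x =>
      ⟨(x, fun i => ofFun (τ.germ i).rep x), fun i => ofFun_pt _ _⟩
    have hs : Tendsto s (𝓝 τ.base) (𝓝 τ) := by
      refine tendsto_iff.2 ⟨tendsto_id, fun i => ?_⟩
      have := tendsto_ofFun (τ.germ i).isGermOf_rep
      rwa [germ_pt] at this
    filter_upwards [hs.eventually hV] with x hx using ⟨_, hx, rfl⟩

instance [Finite ι] : ChartedSpace ℂ (GermTuple ι) :=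
  chartedSpaceOfLocalHomeomorph ℂ isLocalHomeomorph_base

instance [Finite ι] : LocallyPathConnectedSpace (GermTuple ι) :=
  ChartedSpace.locallyPathConnectedSpace ℂ _

theorem exists_path {a b : Sphere} {γ : Path a b} {τ τ' : GermTuple ι} (hτ : τ.base = a)
    (hτ' : τ'.base = b) (h : ∀ i, ContinuesTo γ (τ.germ i) (τ'.germ i)) :
    ∃ P : Path τ τ', ∀ t, (P t).base = γ t := by
  choose Γ hΓ using h
  refine ⟨⟨⟨fun t => ⟨(γ t, fun i => Γ i t), fun i => hΓ i t⟩,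
    continuous_mk γ.continuous (fun i => (Γ i).continuous) _⟩, ?_, ?_⟩, fun t => rfl⟩
  · exact ext (γ.source.trans hτ.symm) fun i => (Γ i).source
  · exact ext (γ.target.trans hτ'.symm) fun i => (Γ i).target

theorem continuesTo_of_path {τ τ' : GermTuple ι} (P : Path τ τ') (i : ι) :
    ContinuesTo (P.map continuous_base) (τ.germ i) (τ'.germ i) :=
  ⟨P.map (continuous_germ i), fun t => (P t).germ_pt i⟩

end GermTuple

theorem GermTuple.locallyCountable_preimage_base {ι : Type*} [Finite ι] {A : Set Sphere}
    (hA : A.Countable) : LocallyCountable (GermTuple.base (ι := ι) ⁻¹' A) :=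
  .preimage isLocalHomeomorph_base.isLocallyInjective hA

theorem exists_path_notMem_continuesTo {ι : Type*} [Finite ι] {A : Set Sphere} (hA : A.Countable)
    {x y : Sphere} (hx : x ∉ A) (hy : y ∉ A) {γ : Path x y} {p q : ι → RegularGerm}
    (hp : ∀ i, (p i).pt = x) (hq : ∀ i, (q i).pt = y) (h : ∀ i, ContinuesTo γ (p i) (q i)) :
    ∃ γ' : Path x y, (∀ t, γ' t ∉ A) ∧ ∀ i, ContinuesTo γ' (p i) (q i) := by
  obtain ⟨P, -⟩ := GermTuple.exists_path (τ := ⟨(x, p), hp⟩) (τ' := ⟨(y, q), hq⟩) rfl rfl h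
  obtain ⟨Q, hQ⟩ := (GermTuple.locallyCountable_preimage_base hA).joinedIn_diff
    one_lt_rank_real_complex isOpen_univ (joinedIn_univ.2 ⟨P⟩) hx hy
  exact ⟨Q.map GermTuple.continuous_base, fun t => (hQ t).2, GermTuple.continuesTo_of_path Q⟩

/-! ### Iterated commutators of loops -/

/-- Loops in `C` that are products of `n`-fold iterated commutators: the loop-level counterpart of
the `n`-th term of the derived series. Loops are not taken up to homotopy, so the trivial loop and
the inverses have constructors of their own. -/
inductive DerivedLoop {Y : Type*} [TopologicalSpace Y] (C : Set Y) {y : Y} :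
    ℕ → Path y y → Prop
  | loop {γ : Path y y} : (∀ t, γ t ∈ C) → DerivedLoop C 0 γ
  | refl (n : ℕ) : y ∈ C → DerivedLoop C n (Path.refl y)
  | trans {n : ℕ} {γ δ : Path y y} : DerivedLoop C n γ → DerivedLoop C n δ →
      DerivedLoop C n (γ.trans δ)
  | symm {n : ℕ} {γ : Path y y} : DerivedLoop C n γ → DerivedLoop C n γ.symm
  | commutator {n : ℕ} {γ δ : Path y y} : DerivedLoop C n γ → DerivedLoop C n δ →
      DerivedLoop C (n + 1) ((γ.trans δ).trans (γ.symm.trans δ.symm))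

theorem forall_path_trans_mem {Y : Type*} [TopologicalSpace Y] {C : Set Y} {x y z : Y}
    {γ : Path x y} {δ : Path y z} (hγ : ∀ t, γ t ∈ C) (hδ : ∀ t, δ t ∈ C) (t : unitInterval) :
    γ.trans δ t ∈ C := by
  rw [Path.trans_apply]
  split_ifs
  exacts [hγ _, hδ _]

namespace DerivedLoop

variable {Y : Type*} [TopologicalSpace Y] {C C' : Set Y} {y : Y} {n : ℕ} {γ : Path y y}

theorem mem (h : DerivedLoop C n γ) : ∀ t, γ t ∈ C := by
  induction h with
  | loop h => exact h
  | refl _ h => exact fun _ => h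
  | trans _ _ h h' => exact forall_path_trans_mem h h'
  | symm _ h => exact fun t => h _
  | commutator _ _ h h' =>
    exact forall_path_trans_mem (forall_path_trans_mem h h')
      (forall_path_trans_mem (fun _ => h _) fun _ => h' _)

theorem mono_set (h : DerivedLoop C n γ) (hC : C ⊆ C') : DerivedLoop C' n γ := by
  induction h with
  | loop h => exact loop fun t => hC (h t)
  | refl n h => exact refl n (hC h)
  | trans _ _ h h' => exact trans h h'
  | symm _ h => exact symm h
  | commutator _ _ h h' => exact commutator h h'

theorem succ_induction {P : Path y y → Prop} (refl : y ∈ C → P (Path.refl y))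
    (trans : ∀ γ δ, P γ → P δ → P (γ.trans δ)) (symm : ∀ γ, P γ → P γ.symm)
    (commutator : ∀ γ δ, DerivedLoop C n γ → DerivedLoop C n δ →
      P ((γ.trans δ).trans (γ.symm.trans δ.symm)))
    (h : DerivedLoop C (n + 1) γ) : P γ := by
  generalize hm : n + 1 = m at h
  induction h with
  | loop _ => exact absurd hm n.succ_ne_zero
  | refl _ h => exact refl h
  | trans _ _ h h' => exact trans _ _ (h hm) (h' hm)
  | symm _ h => exact symm _ (h hm)
  | commutator h h' _ _ =>
    obtain rfl := Nat.succ.inj hm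
    exact commutator _ _ h h'

theorem of_succ (h : DerivedLoop C (n + 1) γ) : DerivedLoop C n γ :=
  h.succ_induction (refl n) (fun _ _ => trans) (fun _ => symm)
    fun _ _ hγ hδ => trans (trans hγ hδ) (trans hγ.symm hδ.symm)

theorem anti {m : ℕ} (hmn : m ≤ n) (h : DerivedLoop C n γ) : DerivedLoop C m γ := by
  induction hmn with
  | refl => exact h
  | step _ ih => exact ih h.of_succ

end DerivedLoop

/-! ### Monodromy -/

theorem ContinuesTo.exists_of_trans {a b c : Sphere} {γ : Path a b} {δ : Path b c}
    {p r : RegularGerm} (h : ContinuesTo (γ.trans δ) p r) :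
    ∃ q, ContinuesTo γ p q ∧ ContinuesTo δ q r := by
  obtain ⟨R, hR⟩ := h
  have hext (s : ℝ) : (R.extend s).pt = (γ.trans δ).extend s := hR _
  refine ⟨R.extend (1 / 2), ⟨⟨⟨fun t => R.extend (t / 2), by fun_prop⟩, by simp, by simp⟩,
    fun t => (hext _).trans ?_⟩, ⟨⟨⟨fun t => R.extend ((1 + t) / 2), by fun_prop⟩, by simp, ?_⟩,
    fun t => (hext _).trans ?_⟩⟩
  · rw [Path.extend_trans_of_le_half _ _ (by linarith [t.2.2]), mul_div_cancel₀ _ two_ne_zero,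
      Path.extend_apply _ t.2]
  · norm_num
  · rw [Path.extend_trans_of_half_le _ _ (by linarith [t.2.1]), mul_div_cancel₀ _ two_ne_zero,
      add_sub_cancel_left, Path.extend_apply _ t.2]

theorem ContinuesUpTo.exists_path {a b : Sphere} {γ : Path a b} {p : RegularGerm}
    {τ : unitInterval} (h : ContinuesUpTo γ p τ) :
    ∃ (q : RegularGerm) (Γ : Path p q), ∀ t ≤ τ, (Γ t).pt = γ t := by
  obtain ⟨G, hG, rfl, hpt⟩ := h
  have hmin (t : unitInterval) : min t τ ∈ Set.Icc 0 τ := ⟨le_min t.2.1 τ.2.1, min_le_right _ _⟩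
  refine ⟨G τ, ⟨⟨fun t => G (min t τ), hG.comp_continuous (by fun_prop) hmin⟩,
    congrArg G (min_eq_left τ.2.1), congrArg G (min_eq_right τ.2.2)⟩, fun t ht => ?_⟩
  exact (congrArg (fun s => (G s).pt) (min_eq_left ht)).trans (hpt t ⟨t.2.1, ht⟩)

theorem ContinuesTo.trans_continuesUpTo {a b c : Sphere} {γ : Path a b} {δ : Path b c}
    {p q : RegularGerm} (h : ContinuesTo γ p q) {τ : unitInterval} (h' : ContinuesUpTo δ q τ) :
    ContinuesUpTo (γ.trans δ) p τ := by
  obtain ⟨Γ, hΓ⟩ := h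
  obtain ⟨r, Δ, hΔ⟩ := h'.exists_path
  refine ⟨Γ.trans Δ, (Γ.trans Δ).continuous.continuousOn, (Γ.trans Δ).source, fun t ht => ?_⟩
  have htτ : (t : ℝ) ≤ τ := ht.2
  rw [Path.trans_apply, Path.trans_apply]
  split_ifs
  · exact hΓ _
  · exact hΔ _ (Subtype.coe_le_coe.1 (show 2 * (t : ℝ) - 1 ≤ τ by linarith [t.2.2]))

theorem IsSingularPoint.of_joined {p q : RegularGerm} {b : Sphere} (hb : IsSingularPoint q b)
    (hpq : Joined p q) : IsSingularPoint p b := by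
  obtain ⟨Δ⟩ := hpq
  obtain ⟨γ, hγ1, hγ⟩ := hb
  have hΔ : ContinuesTo (Δ.map continuous_pt) p q := ⟨Δ, fun _ => rfl⟩
  refine ⟨(Δ.map continuous_pt).trans γ, fun h => hγ1 ?_,
    fun τ hτ => hΔ.trans_continuesUpTo (hγ τ hτ)⟩
  obtain ⟨r, hr⟩ := continuesUpTo_one_iff.1 h
  obtain ⟨q', hq', hr'⟩ := hr.exists_of_trans
  obtain rfl := hq'.unique hΔ
  exact continuesUpTo_one_iff.2 ⟨r, hr'⟩

namespace MultivaluedFunction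

variable {f : MultivaluedFunction}

theorem exists_hasGerm (f : MultivaluedFunction) : ∃ p, f.HasGerm p := Quotient.exists_rep f

theorem HasGerm.joined {p q : RegularGerm} (hp : f.HasGerm p) (hq : f.HasGerm q) : Joined p q :=
  joined_of_generatedBy_eq (hp.trans hq.symm)

theorem HasGerm.of_joined {p q : RegularGerm} (hp : f.HasGerm p) (hpq : Joined p q) :
    f.HasGerm q := (Quotient.sound hpq.symm : generatedBy q = generatedBy p).trans hp

theorem HasGerm.of_continuesTo {a b : Sphere} {γ : Path a b} {p q : RegularGerm}
    (hp : f.HasGerm p) (h : ContinuesTo γ p q) : f.HasGerm q := h.generatedBy_eq.symm.trans hp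

theorem HasGerm.singularSet_eq {p : RegularGerm} (hp : f.HasGerm p) :
    f.singularSet = {b | IsSingularPoint p b} := by
  ext b
  constructor
  · rintro ⟨q, hq, hb⟩
    exact hb.of_joined (hp.joined hq)
  · exact fun hb => ⟨p, hp, hb⟩

theorem IsSFunction.countable_singularSet (hf : f.IsSFunction) : f.singularSet.Countable := by
  obtain ⟨p, hp⟩ := f.exists_hasGerm
  rw [hp.singularSet_eq]
  exact hf p hp

theorem HasGerm.exists_continuesTo {p : RegularGerm} (hp : f.HasGerm p) {a b : Sphere}
    (γ : Path a b) (hpa : p.pt = a) (hγ : ∀ t, γ t ∉ f.singularSet) :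
    ∃ q, f.HasGerm q ∧ ContinuesTo γ p q := by
  subst hpa
  obtain ⟨q, hq⟩ := continuesUpTo_one_iff.1
    (continuesUpTo_one_of_forall_not_isSingularPoint γ fun t ht => hγ t ⟨p, hp, ht⟩)
  exact ⟨q, hp.of_continuesTo hq, hq⟩

theorem exists_isInducedBy {x₀ : Sphere} (γ : Path x₀ x₀) (hγ : ∀ t, γ t ∉ f.singularSet) :
    ∃ σ : Equiv.Perm (f.Fiber x₀), f.IsInducedBy γ σ := by
  choose F hF using fun y : f.Fiber x₀ => y.2.1.exists_continuesTo γ y.2.2 hγ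
  choose G hG using fun y : f.Fiber x₀ => y.2.1.exists_continuesTo γ.symm y.2.2 fun t => hγ _
  exact ⟨⟨fun y => ⟨F y, (hF y).1, (hF y).2.pt_eq_right⟩,
    fun y => ⟨G y, (hG y).1, (hG y).2.pt_eq_right⟩,
    fun y => Subtype.ext ((hG _).2.unique (hF y).2.symm),
    fun y => Subtype.ext ((hF _).2.unique (by simpa using (hG y).2.symm))⟩, fun y => (hF y).2⟩

theorem IsInducedBy.trans {x₀ : Sphere} {γ δ : Path x₀ x₀} {σ τ : Equiv.Perm (f.Fiber x₀)}
    (h : f.IsInducedBy γ σ) (h' : f.IsInducedBy δ τ) : f.IsInducedBy (γ.trans δ) (τ * σ) :=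
  fun y => (h y).trans (h' (σ y))

theorem IsInducedBy.symm {x₀ : Sphere} {γ : Path x₀ x₀} {σ : Equiv.Perm (f.Fiber x₀)}
    (h : f.IsInducedBy γ σ) : f.IsInducedBy γ.symm σ⁻¹ := fun y => by
  have := h (σ⁻¹ y)
  rw [show σ (σ⁻¹ y) = y from σ.apply_symm_apply y] at this
  exact this.symm

theorem exists_mem_derivedSeries {x₀ : Sphere} (hx₀ : x₀ ∉ f.singularSet) {n : ℕ}
    {γ : Path x₀ x₀} (hγ : DerivedLoop f.singularSetᶜ n γ) :
    ∃ σ ∈ derivedSeries (f.monodromyGroup x₀ hx₀) n, f.IsInducedBy γ σ.1 := by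
  induction hγ with
  | @loop γ h =>
    obtain ⟨σ, hσ⟩ := exists_isInducedBy γ h
    exact ⟨⟨σ, γ, h, hσ⟩, trivial, hσ⟩
  | refl n _ => exact ⟨1, one_mem _, fun y => ContinuesTo.refl y.2.2⟩
  | trans _ _ h h' =>
    obtain ⟨σ, hσ, hσ'⟩ := h
    obtain ⟨τ, hτ, hτ'⟩ := h'
    exact ⟨τ * σ, mul_mem hτ hσ, hσ'.trans hτ'⟩
  | symm _ h =>
    obtain ⟨σ, hσ, hσ'⟩ := h
    exact ⟨σ⁻¹, inv_mem hσ, hσ'.symm⟩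
  | commutator _ _ h h' =>
    obtain ⟨σ, hσ, hσ'⟩ := h
    obtain ⟨τ, hτ, hτ'⟩ := h'
    refine ⟨⁅τ⁻¹, σ⁻¹⁆, Subgroup.commutator_mem_commutator (inv_mem hτ) (inv_mem hσ), ?_⟩
    have := (hσ'.trans hτ').trans (hσ'.symm.trans hτ'.symm)
    convert! this using 1

/-- Continuation along the loop `γ` at `x₀`, transported to `x₁` along `δ`, sends `y` to `y'`. It
compares the monodromy at the two base points without conjugating paths. -/
def ActsVia {x₁ x₀ : Sphere} (δ : Path x₁ x₀) (γ : Path x₀ x₀) (y y' : RegularGerm) : Prop :=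
  ∃ z z', ContinuesTo δ y z ∧ ContinuesTo δ y' z' ∧ ContinuesTo γ z z'

theorem ActsVia.trans {x₁ x₀ : Sphere} {δ : Path x₁ x₀} {γ γ' : Path x₀ x₀} {y y' y'' : RegularGerm}
    (h : ActsVia δ γ y y') (h' : ActsVia δ γ' y' y'') : ActsVia δ (γ.trans γ') y y'' := by
  obtain ⟨z, z', hz, hz', hγ⟩ := h
  obtain ⟨w, w', hw, hw', hγ'⟩ := h'
  obtain rfl := hz'.unique hw
  exact ⟨z, w', hz, hw', hγ.trans hγ'⟩

theorem ActsVia.symm {x₁ x₀ : Sphere} {δ : Path x₁ x₀} {γ : Path x₀ x₀} {y y' : RegularGerm}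
    (h : ActsVia δ γ y y') : ActsVia δ γ.symm y' y := by
  obtain ⟨z, z', hz, hz', hγ⟩ := h
  exact ⟨z', z, hz', hz, hγ.symm⟩

/-- On every finite set of germs of `f` at `x₁` the permutation `σ` is continuation, transported
along `δ`, along a product of `n`-fold commutators of loops avoiding `A`. Only finitely many germs
are controlled at once because only finite families of germs form a surface. -/
def IsFinitelyRealized (A : Set Sphere) {x₁ x₀ : Sphere} (δ : Path x₁ x₀) (n : ℕ)
    (σ : Equiv.Perm (f.Fiber x₁)) : Prop :=
  ∀ S : Set (f.Fiber x₁), S.Finite →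
    ∃ γ : Path x₀ x₀, DerivedLoop Aᶜ n γ ∧ ∀ y ∈ S, ActsVia δ γ y.1 (σ y).1

namespace IsFinitelyRealized

variable {A : Set Sphere} {x₁ x₀ : Sphere} {δ : Path x₁ x₀} {n : ℕ} {σ τ : Equiv.Perm (f.Fiber x₁)}

theorem of_isInducedBy (hA : A.Countable) (hx₀ : x₀ ∉ A) (hδ : ∀ t, δ t ∉ f.singularSet)
    {c : Path x₁ x₁} (hc : f.IsInducedBy c σ) : IsFinitelyRealized A δ 0 σ := fun S hS => by
  choose z _ hz using fun y : f.Fiber x₁ => y.2.1.exists_continuesTo δ y.2.2 hδ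
  have := hS.to_subtype
  obtain ⟨γ, hγA, hγ⟩ := exists_path_notMem_continuesTo (γ := (δ.symm.trans c).trans δ)
    (p := fun y : S => z y) (q := fun y => z (σ y)) hA hx₀ hx₀ (fun y => (hz y).pt_eq_right)
    (fun y => (hz _).pt_eq_right) fun y => ((hz y).symm.trans (hc y)).trans (hz (σ y))
  exact ⟨γ, .loop hγA, fun y hy => ⟨z y, z (σ y), hz y, hz (σ y), hγ ⟨y, hy⟩⟩⟩

theorem one (hx₀ : x₀ ∉ A) (hδ : ∀ t, δ t ∉ f.singularSet) :
    IsFinitelyRealized A δ n (1 : Equiv.Perm (f.Fiber x₁)) := fun S _ => by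
  refine ⟨Path.refl x₀, .refl _ hx₀, fun y _ => ?_⟩
  obtain ⟨z, -, hz⟩ := y.2.1.exists_continuesTo δ y.2.2 hδ
  exact ⟨z, z, hz, hz, ContinuesTo.refl hz.pt_eq_right⟩

theorem mul (hσ : IsFinitelyRealized A δ n σ) (hτ : IsFinitelyRealized A δ n τ) :
    IsFinitelyRealized A δ n (σ * τ) := fun S hS => by
  obtain ⟨β, hβ, hβS⟩ := hτ S hS
  obtain ⟨α, hα, hαS⟩ := hσ (τ '' S) (hS.image _)
  exact ⟨_, .trans hβ hα, fun y hy => (hβS y hy).trans (hαS _ ⟨y, hy, rfl⟩)⟩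

theorem inv (hσ : IsFinitelyRealized A δ n σ) : IsFinitelyRealized A δ n σ⁻¹ := fun S hS => by
  obtain ⟨α, hα, hαS⟩ := hσ ((fun y => σ⁻¹ y) '' S) (hS.image _)
  refine ⟨_, .symm hα, fun y hy => ?_⟩
  have := hαS _ ⟨y, hy, rfl⟩
  rw [show σ (σ⁻¹ y) = y from σ.apply_symm_apply y] at this
  exact this.symm

theorem commutator (hσ : IsFinitelyRealized A δ n σ) (hτ : IsFinitelyRealized A δ n τ) :
    IsFinitelyRealized A δ (n + 1) ⁅σ, τ⁆ := fun S hS => by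
  obtain ⟨α, hα, hαS⟩ := hσ.inv ((fun y => τ⁻¹ y) '' S ∪ (fun y => ⁅σ, τ⁆ y) '' S)
    ((hS.image _).union (hS.image _))
  obtain ⟨β, hβ, hβS⟩ := hτ.inv (S ∪ (fun y => (τ * σ⁻¹ * τ⁻¹) y) '' S) (hS.union (hS.image _))
  refine ⟨_, .commutator hβ hα, fun y hy => ?_⟩
  have hστ : ActsVia δ (β.trans α) y.1 (σ⁻¹ (τ⁻¹ y)).1 :=
    (hβS y (Or.inl hy)).trans (hαS _ (Or.inl ⟨y, hy, rfl⟩))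
  have hβ' := hβS _ (Or.inr ⟨y, hy, rfl⟩)
  have hα' := hαS _ (Or.inr ⟨y, hy, rfl⟩)
  have hinv (e : Equiv.Perm (f.Fiber x₁)) (u) : e⁻¹ (e u) = u := e.symm_apply_apply u
  simp only [commutatorElement_def, Equiv.Perm.mul_apply, hinv] at hβ' hα' ⊢
  exact hστ.trans (hβ'.symm.trans hα'.symm)

theorem of_mem_derivedSeries (hA : A.Countable) (hx₁ : x₁ ∉ f.singularSet) (hx₀ : x₀ ∉ A)
    (hδ : ∀ t, δ t ∉ f.singularSet) {σ : f.monodromyGroup x₁ hx₁}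
    (hσ : σ ∈ derivedSeries (f.monodromyGroup x₁ hx₁) n) : IsFinitelyRealized A δ n σ.1 := by
  induction n generalizing σ with
  | zero =>
    obtain ⟨σ, c, -, hc⟩ := σ
    exact of_isInducedBy hA hx₀ hδ hc
  | succ n ih =>
    rw [derivedSeries_succ, Subgroup.commutator_def] at hσ
    induction hσ using Subgroup.closure_induction with
    | mem σ hσ =>
      obtain ⟨a, ha, b, hb, rfl⟩ := hσ
      exact (ih ha).commutator (ih hb)
    | one => exact one hx₀ hδ
    | mul σ τ _ _ hσ hτ => exact hσ.mul hτ
    | inv σ _ hσ => exact hσ.inv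

end IsFinitelyRealized

theorem frequently_notMem_of_countable {A : Set Sphere} (hA : A.Countable) (x : Sphere) :
    ∃ᶠ y in 𝓝 x, y ∉ A :=
  LocallyCountable.frequently_notMem (fun _ => ⟨Set.univ, univ_mem, hA.mono Set.inter_subset_left⟩)
    one_lt_rank_real_complex x

theorem exists_derivedLoop_trivial (hf : f ∈ SolvableSFunctions) :
    ∃ n, ∀ (x₀ : Sphere) (γ : Path x₀ x₀), DerivedLoop f.singularSetᶜ n γ →
      ∀ p, f.HasGerm p → p.pt = x₀ → ContinuesTo γ p p := by
  have hc := hf.1.countable_singularSet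
  obtain ⟨x₀, hx₀⟩ := (frequently_notMem_of_countable hc OnePoint.infty).exists
  obtain ⟨⟨n, hn⟩⟩ := hf.2 x₀ hx₀
  refine ⟨n, fun x₁ γ hγ p hp hpx => ?_⟩
  have hx₁ : x₁ ∉ f.singularSet := by simpa using hγ.mem 0
  obtain ⟨δ, hδ⟩ := exists_path_notMem hc hx₁ hx₀
  obtain ⟨σ, hσ, hσγ⟩ := exists_mem_derivedSeries hx₁ hγ
  obtain ⟨γ', hγ', hact⟩ := IsFinitelyRealized.of_mem_derivedSeries hc hx₁ hx₀ hδ hσ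
    {⟨p, hp, hpx⟩} (Set.finite_singleton _)
  obtain ⟨z, z', hz, hz', hzz'⟩ := hact _ rfl
  obtain ⟨τ, hτ, hτγ⟩ := exists_mem_derivedSeries hx₀ hγ'
  rw [hn, Subgroup.mem_bot] at hτ
  subst hτ
  obtain rfl : z' = z := hzz'.unique (hτγ ⟨z, hp.of_continuesTo hz, hz.pt_eq_right⟩)
  have hpσ := hσγ ⟨p, hp, hpx⟩
  rwa [← hz.symm.unique hz'.symm] at hpσ

theorem mem_solvableSFunctions_of_derivedLoop {A : Set Sphere} (hA : A.Countable)
    {q : RegularGerm} (hq : q.pt ∉ A) (hc : ContinuableOff A q) (n : ℕ)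
    (h : ∀ γ : Path q.pt q.pt, DerivedLoop Aᶜ n γ → ∀ r, JoinedIn {r | r.pt ∉ A} q r →
      r.pt = q.pt → ContinuesTo γ r r) : generatedBy q ∈ SolvableSFunctions := by
  have hgq : (generatedBy q).HasGerm q := rfl
  have hsub : (generatedBy q).singularSet ⊆ A := by
    rw [hgq.singularSet_eq]
    exact fun b hb => hb.mem_of_continuableOff hA hq hc
  have hcount := hA.mono hsub
  refine ⟨fun p hp => hp.singularSet_eq ▸ hcount, fun x₁ hx₁ => ⟨n, ?_⟩⟩
  rw [Subgroup.eq_bot_iff_forall]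
  intro σ hσ
  obtain ⟨δ, hδ⟩ := exists_path_notMem hcount hx₁ (fun hx => hq (hsub hx))
  refine Subtype.ext (Equiv.ext fun y => Subtype.ext ?_)
  obtain ⟨γ, hγ, hact⟩ := IsFinitelyRealized.of_mem_derivedSeries hA hx₁ hq hδ hσ {y}
    (Set.finite_singleton y)
  obtain ⟨z, z', hz, hz', hzz'⟩ := hact y rfl
  have hqz : JoinedIn {r | r.pt ∉ A} q z :=
    ((LocallyCountable.preimage isLocalHomeomorph_pt.isLocallyInjective hA).joinedIn_diff
      one_lt_rank_real_complex isOpen_univ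
      (joinedIn_univ.2 (hgq.joined (y.2.1.of_continuesTo hz))) hq
      (show z.pt ∉ A by rwa [hz.pt_eq_right])).mono Set.inter_subset_right
  obtain rfl := hzz'.unique (h γ hγ z hqz hz.pt_eq_right)
  exact hz'.symm.unique hz.symm

end MultivaluedFunction

/-! ### Operations that are continuous on germs -/

theorem RegularGerm.IsGermOf.eventually_generatedBy {p : RegularGerm} {h : Sphere → ℂ}
    (hp : p.IsGermOf h) :
    ∀ᶠ x in 𝓝 p.pt, (ofFun h x).IsGermOf h ∧ generatedBy (ofFun h x) = generatedBy p := by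
  filter_upwards [hp.holomorphicAt.eventually, (tendsto_ofFun hp).eventually
    (pathComponentIn_mem_nhds univ_mem)] with x hx hj
  exact ⟨isGermOf_ofFun hx, Quotient.sound (JoinedIn.joined hj).symm⟩

theorem exists_continuesTo_of_joinedIn {A : Set Sphere} {q r : RegularGerm}
    (h : JoinedIn {r | r.pt ∉ A} q r) :
    ∃ δ : Path q.pt r.pt, (∀ t, δ t ∉ A) ∧ ContinuesTo δ q r := by
  obtain ⟨R, hR⟩ := h
  exact ⟨R.map continuous_pt, hR, R, fun _ => rfl⟩

theorem joined_path_apply {X : Type*} [TopologicalSpace X] {x y : X} (γ : Path x y)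
    (t : unitInterval) : Joined x (γ t) :=
  ⟨(γ.truncateOfLE (t₀ := 0) (t₁ := t) t.2.1).cast (by simp) (by simp)⟩

section GermTuple

variable {ι : Type*} {τ₀ τ τ' : GermTuple ι} {a b : Sphere} {γ : Path a b}

theorem GermTuple.exists_continuesTo {f : ι → MultivaluedFunction}
    (hf : ∀ i, (f i).HasGerm (τ.germ i)) (hγ : ∀ i t, γ t ∉ (f i).singularSet)
    (ha : τ.base = a) :
    ∃ τ' : GermTuple ι, Joined τ τ' ∧ τ'.base = b ∧
      ∀ i, ContinuesTo γ (τ.germ i) (τ'.germ i) := by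
  choose z _ hz using fun i => (hf i).exists_continuesTo γ ((τ.germ_pt i).trans ha) (hγ i)
  let τ' : GermTuple ι := ⟨(b, z), fun i => (hz i).pt_eq_right⟩
  obtain ⟨P, -⟩ := GermTuple.exists_path (τ' := τ') ha rfl hz
  exact ⟨τ', ⟨P⟩, rfl, hz⟩

variable {A : Set Sphere} {Φ : GermTuple ι → RegularGerm}

theorem GermTuple.continuesTo_of_continuousAt
    (hΦ : ∀ τ, Joined τ₀ τ → τ.base ∉ A → ContinuousAt Φ τ ∧ (Φ τ).pt = τ.base)
    (hγ : ∀ t, γ t ∉ A) (hτ : Joined τ₀ τ) (ha : τ.base = a) (hb : τ'.base = b)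
    (h : ∀ i, ContinuesTo γ (τ.germ i) (τ'.germ i)) : ContinuesTo γ (Φ τ) (Φ τ') := by
  obtain ⟨P, hP⟩ := GermTuple.exists_path ha hb h
  have hjoined (t) : Joined τ₀ (P t) := hτ.trans (joined_path_apply P t)
  have hΦP (t) : ContinuousAt Φ (P t) ∧ (Φ (P t)).pt = (P t).base :=
    hΦ _ (hjoined t) ((hP t).symm ▸ hγ t)
  have hcont : Continuous (Φ ∘ P) := continuous_iff_continuousAt.2 fun t =>
    (hΦP t).1.comp P.continuous.continuousAt
  simpa using continuesTo_of_continuous γ hcont fun t => (hΦP t).2.trans (hP t)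

/- A loop that fixes the germs of all `f i` also fixes their image under `Φ`, so the derived
length of the image is at most the maximum of those of the `f i`. -/
theorem generatedBy_mem_of_continuousAt [Finite ι] {f : ι → MultivaluedFunction}
    (hf : ∀ i, f i ∈ SolvableSFunctions) (hA : A.Countable)
    (hfA : ∀ i, (f i).singularSet ⊆ A) (hτ₀ : ∀ i, (f i).HasGerm (τ₀.germ i))
    (hτ₀A : τ₀.base ∉ A)
    (hΦ : ∀ τ, Joined τ₀ τ → τ.base ∉ A → ContinuousAt Φ τ ∧ (Φ τ).pt = τ.base) :
    generatedBy (Φ τ₀) ∈ SolvableSFunctions := by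
  have hpt : (Φ τ₀).pt = τ₀.base := (hΦ τ₀ (Joined.refl _) hτ₀A).2
  have hlift {b : Sphere} (γ : Path (Φ τ₀).pt b) (hγ : ∀ t, γ t ∉ A) :
      ∃ τ, Joined τ₀ τ ∧ τ.base = b ∧ ContinuesTo γ (Φ τ₀) (Φ τ) := by
    obtain ⟨τ, hτ, hb, h⟩ := GermTuple.exists_continuesTo hτ₀ (fun i t ht => hγ t (hfA i ht))
      hpt.symm
    exact ⟨τ, hτ, hb, GermTuple.continuesTo_of_continuousAt hΦ hγ (Joined.refl _) hpt.symm hb h⟩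
  choose n hn using fun i => exists_derivedLoop_trivial (hf i)
  obtain ⟨N, hN⟩ := (Set.finite_range n).bddAbove
  refine mem_solvableSFunctions_of_derivedLoop hA (hpt ▸ hτ₀A) (fun b γ hγ => ?_) N
    fun γ hγ r hr hrpt => ?_
  · obtain ⟨τ, -, -, h⟩ := hlift γ hγ
    exact continuesUpTo_one_iff.2 ⟨_, h⟩
  · obtain ⟨δ, hδ, hδr⟩ := exists_continuesTo_of_joinedIn hr
    obtain ⟨τ, hτ, hb, hδτ⟩ := hlift δ hδ
    obtain rfl := hδτ.unique hδr
    have hbase := hb.trans hrpt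
    refine GermTuple.continuesTo_of_continuousAt hΦ hγ.mem hτ hbase hbase fun i => ?_
    exact hn i _ γ ((hγ.anti (hN ⟨i, rfl⟩)).mono_set (Set.compl_subset_compl.2 (hfA i))) _
      ((hτ₀ i).of_joined (hτ.map (GermTuple.continuous_germ i))) ((τ.germ_pt i).trans hbase)

end GermTuple

/-! ### Differentiation -/

theorem exists_coe_eq {x : Sphere} (hx : x ≠ OnePoint.infty) : ∃ z : ℂ, x = z := by
  obtain ⟨z, hz⟩ := OnePoint.ne_infty_iff_exists.1 hx
  exact ⟨z, hz.symm⟩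

theorem HolomorphicAt.sphereDeriv {h : Sphere → ℂ} {x : Sphere} (hx : x ≠ OnePoint.infty)
    (hh : HolomorphicAt h x) : HolomorphicAt (sphereDeriv h) x := by
  obtain ⟨z, rfl⟩ := exists_coe_eq hx
  exact AnalyticAt.deriv hh

theorem sphereDeriv_congr {h k : Sphere → ℂ} {x : Sphere} (hx : x ≠ OnePoint.infty)
    (hhk : h =ᶠ[𝓝 x] k) : sphereDeriv h =ᶠ[𝓝 x] sphereDeriv k := by
  obtain ⟨z, rfl⟩ := exists_coe_eq hx
  refine eventually_nhds_coe.2 ?_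
  filter_upwards [(eventually_nhds_coe.1 hhk).eventually_nhds] with w hw
  exact EventuallyEq.deriv_eq hw

namespace RegularGerm

/-- The derivative with respect to the coordinate `x` of a germ at a finite point. At infinity the
value is junk. -/
def derivGerm (p : RegularGerm) : RegularGerm := ofFun (sphereDeriv p.rep) p.pt

@[simp] theorem derivGerm_pt (p : RegularGerm) : p.derivGerm.pt = p.pt := ofFun_pt _ _

theorem IsGermOf.derivGerm {p : RegularGerm} {h : Sphere → ℂ} (hp : p.IsGermOf h)
    (hpt : p.pt ≠ OnePoint.infty) : p.derivGerm.IsGermOf (sphereDeriv h) := by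
  refine IsGermOf.congr (isGermOf_ofFun (p.isGermOf_rep.holomorphicAt.sphereDeriv hpt)) ?_
  rw [derivGerm_pt]
  exact sphereDeriv_congr hpt (p.isGermOf_rep.eventuallyEq hp)

theorem continuousAt_derivGerm {p : RegularGerm} (hpt : p.pt ≠ OnePoint.infty) :
    ContinuousAt RegularGerm.derivGerm p := by
  refine continuousAt_of_isGermOf (k := sphereDeriv p.rep) ?_ ?_
  · simpa only [derivGerm_pt] using continuous_pt.continuousAt
  · have hfinite : ∀ᶠ q : RegularGerm in 𝓝 p, q.pt ≠ OnePoint.infty :=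
      continuous_pt.continuousAt.eventually (isOpen_ne.mem_nhds hpt)
    filter_upwards [p.isGermOf_rep.eventually, hfinite] with q hq hqpt
    exact hq.derivGerm hqpt

end RegularGerm

theorem countable_singularSet_union_infty {f : MultivaluedFunction} (hf : f ∈ SolvableSFunctions) :
    (f.singularSet ∪ {OnePoint.infty}).Countable :=
  hf.1.countable_singularSet.union (Set.countable_singleton _)

theorem IsDerivativeOf.exists_derivGerm {φ f : MultivaluedFunction} (h : IsDerivativeOf φ f)
    {A : Set Sphere} (hA : A.Countable) (hAinf : OnePoint.infty ∈ A) :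
    ∃ p, f.HasGerm p ∧ φ.HasGerm p.derivGerm ∧ p.pt ∉ A := by
  obtain ⟨q, p, hq, hp, hpt, h, hph, hqh⟩ := h
  obtain ⟨x, hxA, ⟨hhx, hf⟩, hdx, hφ⟩ := ((frequently_notMem_of_countable hA p.pt).and_eventually
    (hph.eventually_generatedBy.and (hpt ▸ hqh.eventually_generatedBy))).exists
  have hxfin : (ofFun h x).pt ≠ OnePoint.infty := fun hx => hxA (by rwa [← ofFun_pt h x, hx])
  have hderiv : (ofFun h x).derivGerm = ofFun (sphereDeriv h) x :=
    (hhx.derivGerm hxfin).ext hdx (by simp)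
  exact ⟨ofFun h x, hf.trans hp, (congrArg generatedBy hderiv).trans (hφ.trans hq),
    by rwa [ofFun_pt]⟩

theorem stableUnderDifferentiation_solvableSFunctions :
    StableUnderDifferentiation SolvableSFunctions := by
  intro f hf φ hφ
  have hA := countable_singularSet_union_infty hf
  obtain ⟨p, hp, hφp, hpA⟩ := hφ.exists_derivGerm hA (Or.inr rfl)
  rw [← show generatedBy p.derivGerm = φ from hφp]
  let τ₀ : GermTuple Unit := ⟨(p.pt, fun _ => p), fun _ => rfl⟩
  refine generatedBy_mem_of_continuousAt (τ₀ := τ₀) (f := fun _ : Unit => f) (fun _ => hf) hA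
    (fun _ => Set.subset_union_left) (fun _ => hp) hpA (Φ := fun τ => (τ.germ ()).derivGerm)
    fun τ _ hτ => ⟨?_, (derivGerm_pt _).trans (τ.germ_pt ())⟩
  have hfinite : (τ.germ ()).pt ≠ OnePoint.infty := fun h => hτ (Or.inr (τ.germ_pt () ▸ h))
  exact ContinuousAt.comp (g := RegularGerm.derivGerm) (continuousAt_derivGerm hfinite)
    (GermTuple.continuous_germ ()).continuousAt

/-! ### Integration -/

theorem HolomorphicAt.exists_primitive {k : Sphere → ℂ} {x : Sphere} (hx : x ≠ OnePoint.infty)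
    (hk : HolomorphicAt k x) : ∃ (U : Set Sphere) (H : Sphere → ℂ), IsOpen U ∧ x ∈ U ∧
      ∀ y ∈ U, HolomorphicAt H y ∧ _root_.sphereDeriv H =ᶠ[𝓝 y] k := by
  obtain ⟨z, rfl⟩ := exists_coe_eq hx
  obtain ⟨r, hr, hball⟩ := Metric.eventually_nhds_iff_ball.1 (eventually_nhds_coe.1 hk.eventually)
  have hd : DifferentiableOn ℂ (fun w : ℂ => k w) (Metric.ball z r) := fun w hw =>
    (show AnalyticAt ℂ (fun w : ℂ => k w) w from hball w hw).differentiableAt.differentiableWithinAt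
  obtain ⟨g, hg⟩ := hd.isExactOn_ball
  have hgd : DifferentiableOn ℂ g (Metric.ball z r) := fun v hv =>
    (hg v hv).differentiableAt.differentiableWithinAt
  refine ⟨(↑) '' Metric.ball z r, fun y => y.elim 0 g,
    OnePoint.isOpen_image_coe.2 Metric.isOpen_ball, ⟨z, Metric.mem_ball_self hr, rfl⟩, ?_⟩
  rintro _ ⟨w, hw, rfl⟩
  have hnhds := Metric.isOpen_ball.mem_nhds hw
  refine ⟨hgd.analyticAt hnhds, eventually_nhds_coe.2 ?_⟩
  filter_upwards [hnhds] with v hv using (hg v hv).deriv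

theorem HolomorphicAt.add_const {h : Sphere → ℂ} {x : Sphere} (hh : HolomorphicAt h x) (c : ℂ) :
    HolomorphicAt (fun y => h y + c) x := by
  obtain ⟨e, w, he, rfl⟩ := exists_isSphereChart x
  rw [he.holomorphicAt_iff] at hh ⊢
  exact hh.add analyticAt_const

theorem eventually_sub_eq_of_deriv_eventuallyEq {u v : ℂ → ℂ} {z : ℂ} (hu : AnalyticAt ℂ u z)
    (hv : AnalyticAt ℂ v z) (h : deriv u =ᶠ[𝓝 z] deriv v) :
    ∀ᶠ w in 𝓝 z, v w = u w + (v z - u z) := by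
  obtain ⟨r, hr, hball⟩ := Metric.eventually_nhds_iff_ball.1
    (h.and (hu.eventually_analyticAt.and hv.eventually_analyticAt))
  have hconst : Set.EqOn (deriv (v - u)) 0 (Metric.ball z r) := fun w hw => by
    obtain ⟨hderiv, huw, hvw⟩ := hball w hw
    rw [deriv_sub hvw.differentiableAt huw.differentiableAt, hderiv, sub_self, Pi.zero_apply]
  have hdiff : DifferentiableOn ℂ (v - u) (Metric.ball z r) := fun w hw =>
    ((hball w hw).2.2.sub (hball w hw).2.1).differentiableAt.differentiableWithinAt
  filter_upwards [Metric.ball_mem_nhds z hr] with w hw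
  have hwz := Metric.isOpen_ball.is_const_of_deriv_eq_zero (convex_ball z r).isPreconnected hdiff
    hconst hw (Metric.mem_ball_self hr)
  rw [← Pi.sub_apply v u z, ← hwz, Pi.sub_apply, add_sub_cancel]

namespace RegularGerm

/-- The sum of a germ and a constant. -/
def addConst (c : ℂ) (p : RegularGerm) : RegularGerm := ofFun (fun x => p.rep x + c) p.pt

@[simp] theorem addConst_pt (c : ℂ) (p : RegularGerm) : (p.addConst c).pt = p.pt := ofFun_pt _ _

theorem IsGermOf.addConst {p : RegularGerm} {h : Sphere → ℂ} (hp : p.IsGermOf h) (c : ℂ) :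
    (p.addConst c).IsGermOf (fun x => h x + c) := by
  refine IsGermOf.congr (isGermOf_ofFun (p.isGermOf_rep.holomorphicAt.add_const c)) ?_
  rw [addConst_pt]
  filter_upwards [p.isGermOf_rep.eventuallyEq hp] with x hx
  rw [hx]

theorem continuous_addConst (c : ℂ) : Continuous (RegularGerm.addConst c) := by
  refine continuous_iff_continuousAt.2 fun p => continuousAt_of_isGermOf ?_ ?_
      (k := fun x => p.rep x + c)
  · simpa only [addConst_pt] using continuous_pt.continuousAt
  · filter_upwards [p.isGermOf_rep.eventually] with q hq using hq.addConst c

theorem addConst_addConst (c d : ℂ) (p : RegularGerm) :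
    (p.addConst c).addConst d = p.addConst (c + d) := by
  refine ((p.isGermOf_rep.addConst c).addConst d).ext
    ((p.isGermOf_rep.addConst (c + d)).congr ?_) (by simp)
  exact Eventually.of_forall fun x => (add_assoc _ _ _).symm

theorem exists_eq_addConst {p q : RegularGerm} (hpq : p.pt = q.pt) (hpt : p.pt ≠ OnePoint.infty)
    (h : p.derivGerm = q.derivGerm) : ∃ c, q = p.addConst c := by
  obtain ⟨z, hz⟩ := exists_coe_eq hpt
  have hp := p.isGermOf_rep.holomorphicAt
  have hq := q.isGermOf_rep.holomorphicAt
  have hderiv : sphereDeriv p.rep =ᶠ[𝓝 p.pt] sphereDeriv q.rep := by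
    have hqd := q.isGermOf_rep.derivGerm (hpq ▸ hpt)
    rw [← h] at hqd
    simpa using (p.isGermOf_rep.derivGerm hpt).eventuallyEq hqd
  rw [← hpq] at hq
  rw [hz] at hp hq hderiv
  have hsub := eventually_sub_eq_of_deriv_eventuallyEq (holomorphicAt_coe.1 hp)
    (holomorphicAt_coe.1 hq) (eventually_nhds_coe.1 hderiv)
  refine ⟨q.rep z - p.rep z, q.isGermOf_rep.ext ((p.isGermOf_rep.addConst _).congr ?_)
    (by simp [hpq])⟩
  rw [addConst_pt, hz]
  exact eventually_nhds_coe.2 (hsub.mono fun w hw => hw.symm)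

end RegularGerm

theorem ContinuesTo.addConst {a b : Sphere} {γ : Path a b} {p q : RegularGerm}
    (h : ContinuesTo γ p q) (c : ℂ) : ContinuesTo γ (p.addConst c) (q.addConst c) := by
  obtain ⟨Γ, hΓ⟩ := h
  exact ⟨Γ.map (continuous_addConst c), fun t => (addConst_pt _ _).trans (hΓ t)⟩

theorem ContinuesTo.derivGerm {a b : Sphere} {γ : Path a b} {p q : RegularGerm}
    (h : ContinuesTo γ p q) (hγ : ∀ t, γ t ≠ OnePoint.infty) :
    ContinuesTo γ p.derivGerm q.derivGerm := by
  obtain ⟨Γ, hΓ⟩ := h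
  have hcont : Continuous fun t => (Γ t).derivGerm := continuous_iff_continuousAt.2 fun t =>
    ContinuousAt.comp (g := RegularGerm.derivGerm)
      (continuousAt_derivGerm ((hΓ t).symm ▸ hγ t)) Γ.continuous.continuousAt
  simpa using continuesTo_of_continuous γ hcont fun t => (derivGerm_pt _).trans (hΓ t)

/- Near the end of the part of the path already reached, a local primitive of the continued
derivative agrees with the continued germ up to a constant, and extends it. -/
theorem ContinuesTo.exists_of_derivGerm {a b : Sphere} {γ : Path a b} {p q : RegularGerm}
    (h : ContinuesTo γ p.derivGerm q) (hγ : ∀ t, γ t ≠ OnePoint.infty) :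
    ∃ r, ContinuesTo γ p r ∧ r.derivGerm = q := by
  have hpa : p.pt = a := by simpa using h.pt_eq_left
  suffices ContinuesUpTo γ p 1 by
    obtain ⟨r, hr⟩ := continuesUpTo_one_iff.1 this
    exact ⟨r, hr, (hr.derivGerm hγ).unique h⟩
  obtain ⟨Γ, hΓ⟩ := h
  refine continuesUpTo_one_of_closed hpa fun τ hτ hσ => ?_
  have hk := (Γ τ).isGermOf_rep.holomorphicAt
  rw [hΓ] at hk
  obtain ⟨U, H, hU, hτU, hH⟩ := hk.exists_primitive (hγ τ)
  have hnear : ∀ᶠ s in 𝓝 τ, γ s ∈ U ∧ (Γ s).IsGermOf (Γ τ).rep :=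
    (γ.continuous.continuousAt.eventually (hU.mem_nhds hτU)).and
      (Γ.continuous.continuousAt.eventually (Γ τ).isGermOf_rep.eventually)
  obtain ⟨t₀, ht₀, hsub⟩ := exists_Ioc_subset_of_mem_nhds hnear ⟨0, hτ⟩
  obtain ⟨t, ht₀t, htτ⟩ := exists_between ht₀
  have hHγ (s) (hs : s ∈ Set.Icc t τ) := hH _ (hsub ⟨ht₀t.trans_le hs.1, hs.2⟩).1
  obtain ⟨G, hG, hG0, hGpt⟩ := hσ t htτ
  have ht : t ∈ Set.Icc 0 t := ⟨t.2.1, le_rfl⟩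
  have hGΓ : (Set.Icc 0 t).EqOn (fun s => (G s).derivGerm) Γ := by
    refine lift_eqOn (isPathConnected_Icc_unitInterval t.2.1).isConnected.isPreconnected
      (fun s hs => ?_) Γ.continuous.continuousOn (fun s hs => ?_) ⟨le_rfl, t.2.1⟩
      (by rw [hG0, Γ.source])
    · exact ContinuousAt.comp_continuousWithinAt (g := RegularGerm.derivGerm)
        (continuousAt_derivGerm ((hGpt s hs).symm ▸ hγ s)) (hG s hs)
    · rw [derivGerm_pt, hGpt s hs, hΓ]
  have hHt := hHγ t ⟨le_rfl, htτ.le⟩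
  have hderiv : (ofFun H (γ t)).derivGerm = (G t).derivGerm := by
    refine (((isGermOf_ofFun hHt.1).derivGerm (by simpa using hγ t)).congr ?_).ext
      ((hsub ⟨ht₀t, htτ.le⟩).2) (by simp [hΓ]) |>.trans (hGΓ ht).symm
    simpa using hHt.2
  obtain ⟨c, hc⟩ := exists_eq_addConst (by simp [hGpt t ht]) (by simpa using hγ t) hderiv
  exact continuesUpTo_extend hG hG0 hGpt htτ.le (fun s hs => (hHγ s hs).1.add_const c)
    (hc ▸ (isGermOf_ofFun hHt.1).addConst c)

theorem ContinuesTo.exists_addConst {a : Sphere} {γ : Path a a} {r : RegularGerm}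
    (h : ContinuesTo γ r.derivGerm r.derivGerm) (hγ : ∀ t, γ t ≠ OnePoint.infty) :
    ∃ c, ContinuesTo γ r (r.addConst c) := by
  obtain ⟨s, hs, hsr⟩ := h.exists_of_derivGerm hγ
  have hra : r.pt = a := by simpa using h.pt_eq_left
  obtain ⟨c, rfl⟩ := exists_eq_addConst (hra.trans hs.pt_eq_right.symm)
    (by simpa [hra] using hγ 0) hsr.symm
  exact ⟨c, hs⟩

/- Translations by constants commute, so one more commutator kills the additive monodromy. -/
theorem DerivedLoop.continuesTo_of_addConst {C : Set Sphere} {n : ℕ} {x : Sphere} {γ : Path x x}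
    (hγ : DerivedLoop C (n + 1) γ) {r : RegularGerm} (hr : r.pt = x)
    (h : ∀ δ : Path x x, DerivedLoop C n δ → ∃ c, ContinuesTo δ r (r.addConst c)) :
    ContinuesTo γ r r := by
  refine hγ.succ_induction (P := fun γ => ContinuesTo γ r r) (fun _ => ContinuesTo.refl hr)
    (fun _ _ => ContinuesTo.trans) (fun _ => ContinuesTo.symm) fun α β hα hβ => ?_
  obtain ⟨c, hc⟩ := h α hα
  obtain ⟨d, hd⟩ := h β hβ
  have hdc := hd.addConst c
  have hcd := (hc.addConst d).symm
  rw [addConst_addConst] at hdc hcd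
  rw [add_comm] at hdc
  exact (hc.trans hdc).trans (hcd.trans hd.symm)

theorem stableUnderIntegration_solvableSFunctions :
    StableUnderIntegration SolvableSFunctions := by
  intro f hf φ hφ
  have hA := countable_singularSet_union_infty hf
  set A := f.singularSet ∪ {OnePoint.infty}
  obtain ⟨p, hp, hfp, hpA⟩ := IsDerivativeOf.exists_derivGerm hφ hA (Or.inr rfl)
  rw [← show generatedBy p = φ from hp]
  obtain ⟨n, hn⟩ := exists_derivedLoop_trivial hf
  have hfinite {x : Sphere} (hx : x ∉ A) : x ≠ OnePoint.infty := fun h => hx (Or.inr h)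
  have hAf : Aᶜ ⊆ f.singularSetᶜ := Set.compl_subset_compl.2 Set.subset_union_left
  refine mem_solvableSFunctions_of_derivedLoop hA hpA (fun b γ hγ => ?_) (n + 1)
    fun γ hγ r hr hrp => hγ.continuesTo_of_addConst hrp fun δ hδ => ?_
  · obtain ⟨q, -, hq⟩ := HasGerm.exists_continuesTo hfp γ (derivGerm_pt p) fun t => hAf (hγ t)
    obtain ⟨r, hr, -⟩ := hq.exists_of_derivGerm fun t => hfinite (hγ t)
    exact continuesUpTo_one_iff.2 ⟨r, hr⟩
  · obtain ⟨ε, hε, hpr⟩ := exists_continuesTo_of_joinedIn hr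
    have hfr : f.HasGerm r.derivGerm :=
      hfp.of_continuesTo (hpr.derivGerm fun t => hfinite (hε t))
    exact (hn _ δ (hδ.mono_set hAf) _ hfr (by simpa using hrp)).exists_addConst
      fun t => hfinite (hδ.mem t)

/-! ### Germs of functions that are holomorphic off a countable closed set -/

namespace RegularGerm

theorem IsGermOf.continuesTo {a b : Sphere} {γ : Path a b} {p q : RegularGerm} {h : Sphere → ℂ}
    (hp : p.IsGermOf h) (hq : q.IsGermOf h) (hpa : p.pt = a) (hqb : q.pt = b)
    (hγ : ∀ t, HolomorphicAt h (γ t)) : ContinuesTo γ p q := by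
  have hcont : Continuous fun t => ofFun h (γ t) := continuous_iff_continuousAt.2 fun t =>
    ContinuousAt.comp (g := ofFun h) (continuousAt_ofFun (hγ t)) γ.continuous.continuousAt
  have hγh := continuesTo_of_continuous γ hcont fun t => ofFun_pt _ _
  rwa [γ.source, γ.target, ← (eq_ofFun hp).trans (congrArg _ hpa),
    ← (eq_ofFun hq).trans (congrArg _ hqb)] at hγh

theorem IsGermOf.generatedBy_mem {p : RegularGerm} {h : Sphere → ℂ} (hp : p.IsGermOf h)
    {V : Set Sphere} (hV : Vᶜ.Countable) (hh : ∀ x ∈ V, HolomorphicAt h x) :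
    generatedBy p ∈ SolvableSFunctions := by
  obtain ⟨x, hxV, hx, hxp⟩ :=
    ((frequently_notMem_of_countable hV p.pt).and_eventually hp.eventually_generatedBy).exists
  rw [← hxp]
  have hhγ {a b : Sphere} {γ : Path a b} (hγ : ∀ t, γ t ∉ Vᶜ) (t) : HolomorphicAt h (γ t) :=
    hh _ (not_not.1 (hγ t))
  refine mem_solvableSFunctions_of_derivedLoop hV (by rwa [ofFun_pt]) (fun b γ hγ => ?_) 0
    fun γ hγ r hr hrx => ?_
  · have hb : (ofFun h b).IsGermOf h := isGermOf_ofFun (γ.target ▸ hhγ hγ 1)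
    exact continuesUpTo_one_iff.2 ⟨_, hx.continuesTo hb rfl (ofFun_pt _ _) (hhγ hγ)⟩
  · have hrh : r.IsGermOf h :=
      isGermOf_of_joinedIn (U := V) hh (hr.mono fun y hy => not_not.1 hy) hx
    exact hrh.continuesTo hrh hrx hrx (hhγ hγ.mem)

theorem IsGermOf.generatedBy_mem_of_const {p : RegularGerm} {c : ℂ}
    (hp : p.IsGermOf fun _ => c) : generatedBy p ∈ SolvableSFunctions :=
  hp.generatedBy_mem (V := Set.univ) (by simp) fun x _ => holomorphicAt_const c x

end RegularGerm

/-! ### Composition -/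

theorem HolomorphicAt.tendsto_coe {h : Sphere → ℂ} {x : Sphere} (hh : HolomorphicAt h x) :
    Tendsto (fun y => ((h y : ℂ) : Sphere)) (𝓝 x) (𝓝 ((h x : ℂ) : Sphere)) :=
  (OnePoint.continuous_coe.tendsto _).comp hh.continuousAt

theorem HolomorphicAt.comp_coe {h k : Sphere → ℂ} {x : Sphere}
    (hk : HolomorphicAt k ((h x : ℂ) : Sphere)) (hh : HolomorphicAt h x) :
    HolomorphicAt (fun y => k ((h y : ℂ) : Sphere)) x := by
  obtain ⟨e, w, he, rfl⟩ := exists_isSphereChart x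
  rw [he.holomorphicAt_iff] at hh ⊢
  exact AnalyticAt.comp (g := fun v : ℂ => k v) hk hh

namespace RegularGerm

/-- The value of a germ as a point of the sphere, which is where a germ composed with it must
live. -/
def sval (p : RegularGerm) : Sphere := (p.val : Sphere)

theorem continuous_sval : Continuous sval := OnePoint.continuous_coe.comp continuous_val

theorem IsGermOf.sval_eq {p : RegularGerm} {h : Sphere → ℂ} (hp : p.IsGermOf h) :
    p.sval = ((h p.pt : ℂ) : Sphere) := by rw [sval, hp.val_eq]

/-- The composition `q ∘ p` of germs. The value is junk unless `q` is a germ at the value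
of `p`. -/
def compGerm (q p : RegularGerm) : RegularGerm :=
  ofFun (fun x => q.rep ((p.rep x : ℂ) : Sphere)) p.pt

@[simp] theorem compGerm_pt (q p : RegularGerm) : (compGerm q p).pt = p.pt := ofFun_pt _ _

theorem IsGermOf.compGerm {p q : RegularGerm} {h k : Sphere → ℂ} (hp : p.IsGermOf h)
    (hq : q.IsGermOf k) (hpq : q.pt = p.sval) :
    (compGerm q p).IsGermOf (fun x => k ((h x : ℂ) : Sphere)) := by
  have hrep := q.isGermOf_rep.holomorphicAt
  rw [hpq, p.isGermOf_rep.sval_eq] at hrep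
  refine IsGermOf.congr (isGermOf_ofFun (hrep.comp_coe p.isGermOf_rep.holomorphicAt)) ?_
  rw [compGerm_pt]
  have hqk := q.isGermOf_rep.eventuallyEq hq
  rw [hpq, hp.sval_eq] at hqk
  filter_upwards [hp.holomorphicAt.tendsto_coe.eventually hqk, p.isGermOf_rep.eventuallyEq hp]
    with x hkx hhx
  rw [hhx, hkx]

theorem continuesTo_compGerm {a b : Sphere} {γ : Path a b} {p p' q q' : RegularGerm}
    {Γ : Path p p'} (hΓ : ∀ t, (Γ t).pt = γ t)
    (hq : ContinuesTo (Γ.map continuous_sval) q q') :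
    ContinuesTo γ (compGerm q p) (compGerm q' p') := by
  obtain ⟨Δ, hΔ⟩ := hq
  have hcont : Continuous fun t => compGerm (Δ t) (Γ t) := by
    refine continuous_iff_continuousAt.2 fun t => continuousAt_of_isGermOf
      (k := fun x => (Δ t).rep (((Γ t).rep x : ℂ) : Sphere)) ?_ ?_
    · simp only [compGerm_pt]
      exact (continuous_pt.comp Γ.continuous).continuousAt
    · filter_upwards [Γ.continuous.continuousAt.eventually (Γ t).isGermOf_rep.eventually,
        Δ.continuous.continuousAt.eventually (Δ t).isGermOf_rep.eventually] with s hs hs'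
      exact hs.compGerm hs' (hΔ s)
  simpa using continuesTo_of_continuous γ hcont fun t => (compGerm_pt _ _).trans (hΓ t)

/- By Poincaré–Volterra it suffices to count locally, where the values of a non-constant germ are
attained at isolated points. -/
theorem countable_setOf_joined_sval_mem {p : RegularGerm} (hp : ∀ c : ℂ, ¬ p.IsGermOf fun _ => c)
    {B : Set Sphere} (hB : B.Countable) : {q | Joined p q ∧ q.sval ∈ B}.Countable := by
  have hunion : {q | Joined p q ∧ q.sval ∈ B} ⊆ ⋃ b ∈ B, {q | Joined p q ∧ q.sval = b} :=
    fun q hq => Set.mem_biUnion hq.2 ⟨hq.1, rfl⟩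
  refine (hB.biUnion fun b _ => ?_).mono hunion
  refine countable_of_subset_pathComponent isLocalHomeomorph_pt (x := p) (fun q hq => hq.1)
    fun z hz => ?_
  obtain ⟨hpz, rfl⟩ := hz
  have hzrep := z.isGermOf_rep
  rcases hzrep.holomorphicAt.eventually_eq_or_eventually_ne (holomorphicAt_const z.val z.pt)
    with hconst | hne
  · exact absurd (isGermOf_of_joinedIn (U := Set.univ) (fun x _ => holomorphicAt_const z.val x)
      (joinedIn_univ.2 hpz.symm) (hzrep.congr hconst)) (hp _)
  · refine ⟨_, hzrep.eventually.and (continuous_pt.continuousAt.eventually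
      (eventually_nhdsWithin_iff.1 hne)), (Set.countable_singleton z).mono ?_⟩
    rintro q ⟨⟨-, hqz⟩, hqrep, hqne⟩
    refine hqrep.ext hzrep (by_contra fun hpt => hqne hpt ?_)
    rw [← hqrep.val_eq]
    exact OnePoint.coe_injective hqz

end RegularGerm

theorem DerivedLoop.exists_lift_map {X Y Z : Type*} [TopologicalSpace X] [TopologicalSpace Y]
    [TopologicalSpace Z] {π : X → Y} {v : X → Z} (hv : Continuous v) {C : Set Y} {D : Set Z}
    {x : X} {y : Y} (hx : π x = y) (hxD : v x ∈ D) {n m : ℕ}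
    (hlift : ∀ γ : Path y y, DerivedLoop C n γ →
      ∃ Γ : Path x x, (∀ t, π (Γ t) = γ t) ∧ ∀ t, v (Γ t) ∈ D)
    {γ : Path y y} (hγ : DerivedLoop C (n + m) γ) :
    ∃ Γ : Path x x, (∀ t, π (Γ t) = γ t) ∧ DerivedLoop D m (Γ.map hv) := by
  induction m generalizing γ with
  | zero =>
    obtain ⟨Γ, hΓ, hΓD⟩ := hlift γ hγ
    exact ⟨Γ, hΓ, .loop hΓD⟩
  | succ m ih =>
    have htrans {α β : Path y y} {Γ Δ : Path x x} (hΓ : ∀ t, π (Γ t) = α t)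
        (hΔ : ∀ t, π (Δ t) = β t) (t : unitInterval) : π (Γ.trans Δ t) = α.trans β t := by
      rw [Path.trans_apply, Path.trans_apply]
      split_ifs
      exacts [hΓ _, hΔ _]
    refine hγ.succ_induction
      (P := fun γ => ∃ Γ : Path x x, (∀ t, π (Γ t) = γ t) ∧ DerivedLoop D (m + 1) (Γ.map hv))
      (fun _ => ⟨Path.refl x, fun _ => hx, .refl _ hxD⟩) ?_ ?_ ?_
    · rintro α β ⟨Γ, hΓ, hΓD⟩ ⟨Δ, hΔ, hΔD⟩
      exact ⟨Γ.trans Δ, htrans hΓ hΔ, by rw [Path.map_trans]; exact hΓD.trans hΔD⟩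
    · rintro α ⟨Γ, hΓ, hΓD⟩
      exact ⟨Γ.symm, fun t => hΓ _, hΓD.symm⟩
    · intro α β hα hβ
      obtain ⟨Γ, hΓ, hΓD⟩ := ih hα
      obtain ⟨Δ, hΔ, hΔD⟩ := ih hβ
      refine ⟨(Γ.trans Δ).trans (Γ.symm.trans Δ.symm),
        htrans (htrans hΓ hΔ) (htrans (fun t => hΓ _) fun t => hΔ _), ?_⟩
      rw [Path.map_trans, Path.map_trans, Path.map_trans]
      exact hΓD.commutator hΔD

section Composition

variable {f g : MultivaluedFunction} {p q : RegularGerm} {A : Set Sphere}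

theorem exists_continuesTo_compGerm (hf : f.HasGerm p) (hg : g.HasGerm q) (hq : q.pt = p.sval)
    (hfA : f.singularSet ⊆ A) (hgA : ∀ s, Joined p s → s.pt ∉ A → s.sval ∉ g.singularSet)
    {a b : Sphere} {γ : Path a b} (hγ : ∀ t, γ t ∉ A) (ha : p.pt = a) :
    ∃ p' q', Joined p p' ∧ g.HasGerm q' ∧ p'.pt = b ∧ q'.pt = p'.sval ∧
      ContinuesTo γ (compGerm q p) (compGerm q' p') := by
  obtain ⟨p', -, hγp⟩ := hf.exists_continuesTo γ ha fun t ht => hγ t (hfA ht)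
  obtain ⟨Γ, hΓ⟩ := id hγp
  obtain ⟨q', hq', hqq'⟩ := hg.exists_continuesTo (Γ.map continuous_sval) hq fun t =>
    hgA _ (joined_path_apply Γ t) ((hΓ t).symm ▸ hγ t)
  exact ⟨p', q', ⟨Γ⟩, hq', hγp.pt_eq_right, hqq'.pt_eq_right, continuesTo_compGerm hΓ hqq'⟩

/- If `n`-fold commutators of loops fix the germs of `f` and `m`-fold ones those of `g`, then the
values of `f` along an `(n + m)`-fold commutator form an `m`-fold commutator of loops. -/
theorem generatedBy_compGerm_mem (hf : f ∈ SolvableSFunctions) (hg : g ∈ SolvableSFunctions)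
    (hfp : f.HasGerm p) (hgq : g.HasGerm q) (hq : q.pt = p.sval) (hA : A.Countable)
    (hpA : p.pt ∉ A) (hfA : f.singularSet ⊆ A)
    (hgA : ∀ s, Joined p s → s.pt ∉ A → s.sval ∉ g.singularSet) :
    generatedBy (compGerm q p) ∈ SolvableSFunctions := by
  have hpt : (compGerm q p).pt = p.pt := compGerm_pt q p
  obtain ⟨n, hn⟩ := exists_derivedLoop_trivial hf
  obtain ⟨m, hm⟩ := exists_derivedLoop_trivial hg
  refine mem_solvableSFunctions_of_derivedLoop hA (hpt ▸ hpA) (fun b γ hγ => ?_) (n + m)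
    fun γ hγ s hs hsp => ?_
  · obtain ⟨p', q', -, -, -, -, h⟩ :=
      exists_continuesTo_compGerm hfp hgq hq hfA hgA hγ hpt.symm
    exact continuesUpTo_one_iff.2 ⟨_, h⟩
  · obtain ⟨δ, hδ, hδs⟩ := exists_continuesTo_of_joinedIn hs
    obtain ⟨p', q', hpp', hgq', hp's, hq', h⟩ :=
      exists_continuesTo_compGerm hfp hgq hq hfA hgA hδ hpt.symm
    obtain rfl := h.unique hδs
    have hp'p : p'.pt = (compGerm q p).pt := hp's.trans hsp
    have hgΓ {α : Path (compGerm q p).pt (compGerm q p).pt} {Γ : Path p' p'}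
        (hα : ∀ t, α t ∉ A) (hΓ : ∀ t, (Γ t).pt = α t) (t) : (Γ t).sval ∉ g.singularSet :=
      hgA _ (hpp'.trans (joined_path_apply Γ t)) ((hΓ t).symm ▸ hα t)
    obtain ⟨Γ, hΓ, hΓg⟩ := DerivedLoop.exists_lift_map (π := pt) (D := g.singularSetᶜ)
      continuous_sval hp'p (hgA p' hpp' (hp'p.trans hpt ▸ hpA)) (fun α hα => by
        obtain ⟨Γ, hΓ⟩ := hn _ α (hα.mono_set (Set.compl_subset_compl.2 hfA)) p'
          (hfp.of_joined hpp') hp'p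
        exact ⟨Γ, hΓ, hgΓ hα.mem hΓ⟩) hγ
    exact continuesTo_compGerm hΓ (hm _ _ hΓg q' hgq' hq')

end Composition

theorem RegularGerm.IsGermOf.exists_compGerm {p q r : RegularGerm} {h k : Sphere → ℂ}
    (hp : p.IsGermOf h) (hq : q.IsGermOf k) (hqp : q.pt = p.sval) (hrp : r.pt = p.pt)
    (hr : r.IsGermOf fun x => k ((h x : ℂ) : Sphere)) {A : Set Sphere} (hA : A.Countable) :
    ∃ p' q', generatedBy p' = generatedBy p ∧ generatedBy q' = generatedBy q ∧ p'.pt ∉ A ∧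
      q'.pt = p'.sval ∧ generatedBy (RegularGerm.compGerm q' p') = generatedBy r := by
  have hk := hq.eventually_generatedBy
  rw [hqp, hp.sval_eq] at hk
  obtain ⟨x, hxA, ⟨hpx, hpp⟩, ⟨hrx, hrr⟩, hqx, hqq⟩ :=
    ((frequently_notMem_of_countable hA p.pt).and_eventually (hp.eventually_generatedBy.and
      ((hrp ▸ hr.eventually_generatedBy).and (hp.holomorphicAt.tendsto_coe.eventually hk)))).exists
  have hpt : (ofFun k ((h x : ℂ) : Sphere)).pt = (ofFun h x).sval := by
    rw [hpx.sval_eq, ofFun_pt, ofFun_pt]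
  have hcomp : RegularGerm.compGerm (ofFun k ((h x : ℂ) : Sphere)) (ofFun h x) =
      ofFun (fun x => k ((h x : ℂ) : Sphere)) x :=
    (hpx.compGerm hqx hpt).ext hrx (by simp)
  exact ⟨_, _, hpp, hqq, by rwa [ofFun_pt], hpt, (congrArg generatedBy hcomp).trans hrr⟩

theorem stableUnderComposition_solvableSFunctions :
    StableUnderComposition SolvableSFunctions := by
  rintro g hg f hf φ ⟨r, q, p, hφr, hgq, hfp, hrp, h, k, hph, hqp, hqk, hrk⟩
  rw [← show generatedBy r = φ from hφr]
  by_cases hconst : ∃ c : ℂ, p.IsGermOf fun _ => c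
  · obtain ⟨c, hc⟩ := hconst
    refine IsGermOf.generatedBy_mem_of_const (c := k c) (hrk.congr ?_)
    rw [hrp]
    filter_upwards [hph.eventuallyEq hc] with x hx
    rw [hx]
  push Not at hconst
  set Z := {s | Joined p s ∧ s.sval ∈ g.singularSet}
  have hA : (f.singularSet ∪ pt '' Z).Countable := hf.1.countable_singularSet.union
    ((countable_setOf_joined_sval_mem hconst hg.1.countable_singularSet).image _)
  obtain ⟨p', q', hp', hq', hpA, hpt, hr⟩ :=
    hph.exists_compGerm hqk (hqp.trans hph.sval_eq.symm) hrp hrk hA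
  rw [← hr]
  exact generatedBy_compGerm_mem hf hg (hp'.trans hfp) (hq'.trans hgq) hpt hA hpA
    Set.subset_union_left fun s hs hsA hsg =>
      hsA (Or.inr ⟨s, ⟨(joined_of_generatedBy_eq hp'.symm).trans hs, hsg⟩, rfl⟩)

/-! ### Generic limits of meromorphic functions along lines -/

section GenericLimit

theorem residual_neBot {E : Type*} [NormedAddCommGroup E] [CompleteSpace E] : (residual E).NeBot :=
  ⟨fun h => by simpa using (dense_of_mem_residual (X := E) (s := ∅) (h ▸ mem_bot)).nonempty⟩

variable {E : Type*} [NormedAddCommGroup E] [NormedSpace ℂ E]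

/-- The `k`-th derivative at `y` of `Q` in the direction `w`, which controls how `Q` vanishes along
the line through `y` in that direction. -/
def iteratedDirDeriv (Q : E → ℂ) (k : ℕ) (w y : E) : ℂ := iteratedFDeriv ℂ k Q y fun _ => w

section DirDeriv

variable {P Q : E → ℂ} {y w : E}

theorem analyticAt_iteratedDirDeriv (hQ : AnalyticAt ℂ Q y) (k : ℕ) (w : E) :
    AnalyticAt ℂ (iteratedDirDeriv Q k w) y := by
  obtain ⟨s, hs, hQs⟩ := eventually_iff_exists_mem.1 hQ.eventually_analyticAt
  exact ((ContinuousMultilinearMap.apply ℂ (fun _ : Fin k => E) ℂ fun _ => w).analyticAt _).comp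
    (AnalyticOnNhd.iteratedFDeriv (s := s) (fun x hx => hQs x hx) k y (mem_of_mem_nhds hs))

theorem analyticAt_iteratedDirDeriv_direction (Q : E → ℂ) (k : ℕ) (y w : E) :
    AnalyticAt ℂ (fun w => iteratedDirDeriv Q k w y) w :=
  AnalyticAt.comp (g := iteratedFDeriv ℂ k Q y) (ContinuousMultilinearMap.analyticAt _)
    (analyticAt_pi_iff.2 fun _ => analyticAt_id)

theorem iteratedDirDeriv_sub_const_mul (hP : AnalyticAt ℂ P y) (hQ : AnalyticAt ℂ Q y) (m : ℂ)
    (k : ℕ) : iteratedDirDeriv (P - m • Q) k w y =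
      iteratedDirDeriv P k w y - m * iteratedDirDeriv Q k w y := by
  rw [iteratedDirDeriv, iteratedFDeriv_sub_apply hP.contDiffAt (hQ.const_smul).contDiffAt,
    iteratedFDeriv_const_smul_apply hQ.contDiffAt]
  rfl

theorem exists_iteratedDirDeriv_ne_zero (hQ : AnalyticAt ℂ Q y) (h : ¬ ∀ᶠ z in 𝓝 y, Q z = 0) :
    ∃ k w, iteratedDirDeriv Q k w y ≠ 0 := by
  by_contra! hzero
  obtain ⟨p, r, hp⟩ := hQ
  refine h ?_
  filter_upwards [Metric.eball_mem_nhds y hp.r_pos] with z hz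
  have hsum := hp.hasSum_iteratedFDeriv (y := z - y) (by simpa [edist_eq_enorm_sub] using hz)
  simp_rw [show ∀ k, iteratedFDeriv ℂ k Q y (fun _ => z - y) = 0 from fun k => hzero k (z - y),
    smul_zero, add_sub_cancel] at hsum
  exact hsum.unique hasSum_zero

theorem iteratedDeriv_comp_line (hQ : AnalyticAt ℂ Q y) (w : E) (k : ℕ) :
    iteratedDeriv k (fun s : ℂ => Q (y + s • w)) 0 = iteratedDirDeriv Q k w y := by
  obtain ⟨p, r, hp⟩ := hQ
  let u : ℂ →L[ℂ] E := ContinuousLinearMap.toSpanSingleton ℂ w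
  have hpu : HasFPowerSeriesOnBall (fun z => Q (z - -y)) p (u 0) r := by
    simpa [u] using hp.comp_sub (-y)
  have hline : (fun s : ℂ => Q (y + s • w)) = (fun z => Q (z - -y)) ∘ u := by
    ext s
    simp [u, add_comm]
  rw [iteratedDeriv_eq_iteratedFDeriv, hline, ← hpu.compContinuousLinearMap.factorial_smul,
    iteratedDirDeriv, ← hp.factorial_smul, FormalMultilinearSeries.compContinuousLinearMap_apply]
  congr 3
  ext
  simp [u]

theorem analyticAt_comp_line (hQ : AnalyticAt ℂ Q y) (w : E) :
    AnalyticAt ℂ (fun s : ℂ => Q (y + s • w)) 0 :=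
  AnalyticAt.comp (g := Q) (by simpa using hQ)
    (analyticAt_const.add (analyticAt_id.smul analyticAt_const))

theorem meromorphicAt_line_div_pow (hQ : AnalyticAt ℂ Q y) (w : E) (k : ℕ) :
    MeromorphicAt (fun s : ℂ => Q (y + s • w) / s ^ k) 0 :=
  (analyticAt_comp_line hQ w).meromorphicAt.div (by fun_prop)

theorem meromorphicOrderAt_line_div_pow (hQ : AnalyticAt ℂ Q y) (w : E) (k : ℕ) :
    meromorphicOrderAt (fun s : ℂ => Q (y + s • w) / s ^ k) 0 =
      (analyticOrderAt (fun s : ℂ => Q (y + s • w)) 0).map (↑) - (k : WithTop ℤ) := by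
  rw [fun_meromorphicOrderAt_div (analyticAt_comp_line hQ w).meromorphicAt (by fun_prop),
    (analyticAt_comp_line hQ w).meromorphicOrderAt_eq, fun_meromorphicOrderAt_pow (by fun_prop),
    show (fun s : ℂ => s) = id from rfl, meromorphicOrderAt_id, mul_one]

theorem tendsto_line_div_pow_zero_iff (hQ : AnalyticAt ℂ Q y) (k : ℕ) :
    Tendsto (fun s : ℂ => Q (y + s • w) / s ^ k) (𝓝[≠] 0) (𝓝 0) ↔
      ∀ j ≤ k, iteratedDirDeriv Q j w y = 0 := by
  have hline := analyticAt_comp_line hQ w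
  simp_rw [← Nat.lt_succ_iff, ← iteratedDeriv_comp_line hQ]
  rw [← natCast_le_analyticOrderAt_iff_iteratedDeriv_eq_zero hline,
    tendsto_zero_iff_meromorphicOrderAt_pos (meromorphicAt_line_div_pow hQ w k),
    meromorphicOrderAt_line_div_pow hQ]
  cases analyticOrderAt (fun s : ℂ => Q (y + s • w)) 0 with
  | top => simp
  | coe n =>
    change 0 < (((n : ℤ) - (k : ℤ) : ℤ) : WithTop ℤ) ↔ _
    rw [WithTop.coe_pos, Nat.cast_le]
    omega

theorem exists_tendsto_line_div_pow_ne_zero (hQ : AnalyticAt ℂ Q y) {k : ℕ}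
    (hlow : ∀ j < k, iteratedDirDeriv Q j w y = 0) (hk : iteratedDirDeriv Q k w y ≠ 0) :
    ∃ c ≠ 0, Tendsto (fun s : ℂ => Q (y + s • w) / s ^ k) (𝓝[≠] 0) (𝓝 c) := by
  have hline := analyticAt_comp_line hQ w
  have horder : analyticOrderAt (fun s : ℂ => Q (y + s • w)) 0 = k := by
    rw [analyticOrderAt_eq_nat_iff_iteratedDeriv_eq_zero hline]
    simpa only [iteratedDeriv_comp_line hQ] using And.intro hlow hk
  rw [tendsto_ne_zero_iff_meromorphicOrderAt_eq_zero (meromorphicAt_line_div_pow hQ w k),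
    meromorphicOrderAt_line_div_pow hQ, horder]
  exact congrArg WithTop.some (sub_self (k : ℤ))

end DirDeriv

theorem eventually_residual_ne_zero {c : E → ℂ} (hc : ∀ w, AnalyticAt ℂ c w) {w₁ : E}
    (h : c w₁ ≠ 0) : ∀ᶠ w in residual E, c w ≠ 0 := by
  have hcont : Continuous c := continuous_iff_continuousAt.2 fun w => (hc w).continuousAt
  refine residual_of_dense_open (isOpen_ne_fun hcont continuous_const) fun w => ?_
  by_contra hw
  have hzero : c =ᶠ[𝓝 w] 0 := by
    filter_upwards [isClosed_closure.isOpen_compl.mem_nhds hw] with v hv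
    exact not_not.1 fun hv' => hv (subset_closure hv')
  exact h (AnalyticOnNhd.eqOn_zero_of_preconnected_of_eventuallyEq_zero (U := Set.univ)
    (fun w _ => hc w) isPreconnected_univ (Set.mem_univ w) hzero (Set.mem_univ w₁))

/-- The function `F` tends to `m` at `y` along a generic complex line. This determines the value of
a meromorphic function from the function itself, whatever numerator and denominator represent it,
and may make sense at points where the denominator vanishes. -/
def HasGenericLimit (F : E → ℂ) (y : E) (m : ℂ) : Prop :=
  ∀ᶠ w in residual E, Tendsto (fun s : ℂ => F (y + s • w)) (𝓝[≠] 0) (𝓝 m)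

/-- The function `F` agrees near `y` with the quotient of the analytic functions `P` and `Q`, except
perhaps at the zeros of `Q`. This is `IsLocalQuotient` on an arbitrary normed space and without the
requirement that `Q` is not identically zero. -/
structure IsQuotientAt (F P Q : E → ℂ) (y : E) : Prop where
  numerator : AnalyticAt ℂ P y
  denominator : AnalyticAt ℂ Q y
  eq_div : ∀ᶠ x in 𝓝 y, Q x ≠ 0 → F x = P x / Q x

theorem tendsto_line (y w : E) : Tendsto (fun s : ℂ => y + s • w) (𝓝[≠] 0) (𝓝 y) := by
  have hcont : Continuous fun s : ℂ => y + s • w := by fun_prop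
  simpa using (hcont.tendsto 0).mono_left (nhdsWithin_le_nhds (s := {0}ᶜ))

theorem HasGenericLimit.unique [CompleteSpace E] {F : E → ℂ} {y : E} {m m' : ℂ}
    (h : HasGenericLimit F y m) (h' : HasGenericLimit F y m') : m = m' := by
  have := residual_neBot (E := E)
  obtain ⟨w, hw, hw'⟩ := (h.and h').exists
  exact tendsto_nhds_unique hw hw'

namespace IsQuotientAt

variable {F P Q : E → ℂ} {y : E} {k : ℕ} {m : ℂ}

protected theorem eventually (h : IsQuotientAt F P Q y) : ∀ᶠ x in 𝓝 y, IsQuotientAt F P Q x := by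
  filter_upwards [h.numerator.eventually_analyticAt, h.denominator.eventually_analyticAt,
    h.eq_div.eventually_nhds] with x hP hQ hF using ⟨hP, hQ, hF⟩

theorem hasGenericLimit (h : IsQuotientAt F P Q y) (hQ : Q y ≠ 0) :
    HasGenericLimit F y (P y / Q y) :=
  .of_forall fun w =>
    ((h.numerator.continuousAt.div h.denominator.continuousAt hQ).tendsto.comp
      (tendsto_line y w)).congr' <| by
      filter_upwards [(tendsto_line y w).eventually h.eq_div,
        (tendsto_line y w).eventually (h.denominator.continuousAt.eventually_ne hQ)]
        with s hs hQs using (hs hQs).symm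

/- Divide `F - m = (P - m Q) / Q` by `s ^ k` above and below: the denominator then has a nonzero
limit. -/
theorem tendsto_line_iff (h : IsQuotientAt F P Q y)
    (hlow : ∀ j < k, ∀ w, iteratedDirDeriv Q j w y = 0) {w : E}
    (hk : iteratedDirDeriv Q k w y ≠ 0) :
    Tendsto (fun s : ℂ => F (y + s • w)) (𝓝[≠] 0) (𝓝 m) ↔
      ∀ j ≤ k, iteratedDirDeriv P j w y = m * iteratedDirDeriv Q j w y := by
  have hPQ : AnalyticAt ℂ (P - m • Q) y := h.numerator.sub h.denominator.const_smul
  obtain ⟨c, hc, hQc⟩ :=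
    exists_tendsto_line_div_pow_ne_zero h.denominator (fun j hj => hlow j hj w) hk
  have hF : ∀ᶠ s in 𝓝[≠] (0 : ℂ), Q (y + s • w) / s ^ k ≠ 0 ∧
      F (y + s • w) - m = (P - m • Q) (y + s • w) / s ^ k / (Q (y + s • w) / s ^ k) := by
    filter_upwards [hQc.eventually_ne hc, (tendsto_line y w).eventually h.eq_div] with s hs hFs
    obtain ⟨hQs, hs0⟩ := div_ne_zero_iff.1 hs
    refine ⟨hs, ?_⟩
    rw [hFs hQs, div_div_div_cancel_right₀ hs0, Pi.sub_apply, Pi.smul_apply, smul_eq_mul, sub_div,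
      mul_div_cancel_right₀ _ hQs]
  simp_rw [← sub_eq_zero (b := m * _), ← iteratedDirDeriv_sub_const_mul h.numerator h.denominator]
  rw [← tendsto_line_div_pow_zero_iff hPQ, ← tendsto_sub_nhds_zero_iff]
  constructor
  · intro hlim
    have hmul := (hlim.mul hQc).congr' <| hF.mono fun s hs => by
      rw [hs.2, div_mul_cancel₀ _ hs.1]
    rwa [zero_mul] at hmul
  · intro hlim
    have hdiv := (hlim.div hQc hc).congr' (hF.mono fun s hs => hs.2.symm)
    rwa [zero_div] at hdiv

theorem hasGenericLimit_iff [CompleteSpace E] (h : IsQuotientAt F P Q y)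
    (hlow : ∀ j < k, ∀ w, iteratedDirDeriv Q j w y = 0) {w₁ : E}
    (hk : iteratedDirDeriv Q k w₁ y ≠ 0) :
    HasGenericLimit F y m ↔
      ∀ j ≤ k, ∀ w, iteratedDirDeriv P j w y = m * iteratedDirDeriv Q j w y := by
  have hgeneric := eventually_residual_ne_zero (analyticAt_iteratedDirDeriv_direction Q k y) hk
  constructor
  · intro hm j hj w
    by_contra hne
    have := residual_neBot (E := E)
    obtain ⟨v, ⟨hmv, hQv⟩, hPv⟩ := ((hm.and hgeneric).and (eventually_residual_ne_zero
      (fun w => (analyticAt_iteratedDirDeriv_direction P j y w).sub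
        (analyticAt_const.mul (analyticAt_iteratedDirDeriv_direction Q j y w)))
      (sub_ne_zero.2 hne))).exists
    exact hPv (sub_eq_zero.2 ((h.tendsto_line_iff hlow hQv).1 hmv j hj))
  · intro hPQ
    filter_upwards [hgeneric] with w hw
    exact (h.tendsto_line_iff hlow hw).2 fun j hj => hPQ j hj w

end IsQuotientAt

section Curve

variable {F P Q : E → ℂ} {f : ℂ → E} {U : Set ℂ} {z : ℂ}

theorem eqOn_zero_or_eventually_nhdsNE_ne_zero {g : ℂ → ℂ} (hg : AnalyticOnNhd ℂ g U)
    (hU : IsPreconnected U) (hz : z ∈ U) :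
    (∀ x ∈ U, g x = 0) ∨ ∀ᶠ x in 𝓝[≠] z, g x ≠ 0 :=
  (hg z hz).eventually_eq_zero_or_eventually_ne_zero.imp_left
    (hg.eqOn_zero_of_preconnected_of_eventuallyEq_zero hU hz)

theorem analyticOnNhd_iteratedDirDeriv_comp (hf : AnalyticOnNhd ℂ f U)
    (hQ : ∀ x ∈ U, AnalyticAt ℂ Q (f x)) (k : ℕ) (w : E) :
    AnalyticOnNhd ℂ (fun x => iteratedDirDeriv Q k w (f x)) U :=
  fun x hx => (analyticAt_iteratedDirDeriv (hQ x hx) k w).comp (hf x hx)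

theorem exists_iteratedDirDeriv_comp_ne_zero (hf : AnalyticOnNhd ℂ f U)
    (hQ : ∀ x ∈ U, AnalyticAt ℂ Q (f x)) (hU : IsPreconnected U) (hz : z ∈ U)
    (hQ0 : ¬ ∀ᶠ x in 𝓝 (f z), Q x = 0) :
    ∃ k, (∀ j < k, ∀ w, ∀ x ∈ U, iteratedDirDeriv Q j w (f x) = 0) ∧
      ∃ w, ∀ᶠ x in 𝓝[≠] z, iteratedDirDeriv Q k w (f x) ≠ 0 := by
  have halt (k w) := eqOn_zero_or_eventually_nhdsNE_ne_zero
    (analyticOnNhd_iteratedDirDeriv_comp hf hQ k w) hU hz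
  have hex : ∃ k w, ∀ᶠ x in 𝓝[≠] z, iteratedDirDeriv Q k w (f x) ≠ 0 := by
    obtain ⟨k, w, hkw⟩ := exists_iteratedDirDeriv_ne_zero (hQ z hz) hQ0
    exact ⟨k, w, (halt k w).resolve_left fun h => hkw (h z hz)⟩
  classical
  exact ⟨Nat.find hex, fun j hj w => (halt j w).resolve_right fun h => Nat.find_min hex hj ⟨w, h⟩,
    Nat.find_spec hex⟩

/- If `k` is the vanishing order of `Q` along the curve and `Q` has a nonzero `k`-th derivative in
the direction `w₁`, the limit can only be the quotient of the `k`-th derivatives of `P` and `Q` in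
this direction, and it exists where the determinants below vanish. -/
theorem exists_hasGenericLimit_or_forall_not [CompleteSpace E] (hf : AnalyticAt ℂ f z)
    (h : IsQuotientAt F P Q (f z)) (hQ0 : ¬ ∀ᶠ x in 𝓝 (f z), Q x = 0) :
    (∃ M : ℂ → ℂ, MeromorphicAt M z ∧ ∀ᶠ x in 𝓝[≠] z, HasGenericLimit F (f x) (M x)) ∨
      ∀ᶠ x in 𝓝[≠] z, ∀ m, ¬ HasGenericLimit F (f x) m := by
  obtain ⟨δ, hδ, hball⟩ := Metric.eventually_nhds_iff_ball.1
    (hf.eventually_analyticAt.and (hf.continuousAt.eventually h.eventually))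
  set U := Metric.ball z δ
  have hzU : z ∈ U := Metric.mem_ball_self hδ
  have hU : IsPreconnected U := (convex_ball z δ).isPreconnected
  have hUz : ∀ᶠ x in 𝓝[≠] z, x ∈ U := nhdsWithin_le_nhds (Metric.ball_mem_nhds z hδ)
  have hfU : AnalyticOnNhd ℂ f U := fun x hx => (hball x hx).1
  have hPa := analyticOnNhd_iteratedDirDeriv_comp hfU fun x hx => (hball x hx).2.numerator
  have hQa := analyticOnNhd_iteratedDirDeriv_comp hfU fun x hx => (hball x hx).2.denominator
  obtain ⟨k, hlow, w₁, hw₁⟩ := exists_iteratedDirDeriv_comp_ne_zero hfU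
    (fun x hx => (hball x hx).2.denominator) hU hzU hQ0
  have hiff (x) (hx : x ∈ U) (hx₁ : iteratedDirDeriv Q k w₁ (f x) ≠ 0) (m : ℂ) :=
    (hball x hx).2.hasGenericLimit_iff (m := m) (fun j hj w => hlow j hj w x hx) hx₁
  let D (j : ℕ) (w : E) (x : ℂ) : ℂ :=
    iteratedDirDeriv P j w (f x) * iteratedDirDeriv Q k w₁ (f x) -
      iteratedDirDeriv P k w₁ (f x) * iteratedDirDeriv Q j w (f x)
  have hD (j w) := eqOn_zero_or_eventually_nhdsNE_ne_zero
    (((hPa j w).mul (hQa k w₁)).sub ((hPa k w₁).mul (hQa j w))) hU hzU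
  by_cases hD0 : ∀ j ≤ k, ∀ w, ∀ x ∈ U, D j w x = 0
  · refine Or.inl ⟨fun x => iteratedDirDeriv P k w₁ (f x) / iteratedDirDeriv Q k w₁ (f x),
      (hPa k w₁ z hzU).meromorphicAt.div (hQa k w₁ z hzU).meromorphicAt, ?_⟩
    filter_upwards [hUz, hw₁] with x hx hx₁
    refine (hiff x hx hx₁ _).2 fun j hj w => ?_
    rw [div_mul_eq_mul_div, eq_div_iff hx₁]
    exact sub_eq_zero.1 (hD0 j hj w x hx)
  · push Not at hD0
    obtain ⟨j, hj, w, x₀, hx₀, hne⟩ := hD0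
    right
    filter_upwards [hUz, hw₁, (hD j w).resolve_left fun hzero => hne (hzero x₀ hx₀)]
      with x hx hx₁ hDx m hm
    refine hDx ?_
    have hm' := (hiff x hx hx₁ m).1 hm
    simp only [Pi.sub_apply, hm' j hj w, hm' k le_rfl w₁]
    ring

end Curve

end GenericLimit

/-! ### Meromorphic operations -/

theorem eventually_nhdsNE_coe {z : ℂ} {p : Sphere → Prop} :
    (∀ᶠ x in 𝓝[≠] (z : Sphere), p x) ↔ ∀ᶠ w : ℂ in 𝓝[≠] z, p w := by
  simp only [eventually_nhdsWithin_iff, eventually_nhds_coe, Set.mem_compl_singleton_iff, ne_eq,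
    OnePoint.coe_eq_coe]

theorem HolomorphicAt.comp_pi {n : ℕ} {h : Fin n → Sphere → ℂ} {Q : (Fin n → ℂ) → ℂ} {x : Sphere}
    (hQ : AnalyticAt ℂ Q fun i => h i x) (hh : ∀ i, HolomorphicAt (h i) x) :
    HolomorphicAt (fun y => Q fun i => h i y) x := by
  obtain ⟨e, w, he, rfl⟩ := exists_isSphereChart x
  simp only [he.holomorphicAt_iff] at hh ⊢
  exact AnalyticAt.comp (g := Q) hQ (analyticAt_pi_iff.2 hh)

namespace GermTuple

variable {ι : Type*} [Finite ι]

/-- The values near the base point of functions representing the germs, as the argument of a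
function of several variables. -/
def repVal (τ : GermTuple ι) (x : Sphere) (i : ι) : ℂ := (τ.germ i).rep x

theorem frequently_joined_base_notMem {A : Set Sphere} (hA : A.Countable) (τ : GermTuple ι) :
    ∃ᶠ σ in 𝓝 τ, σ.base ∉ A ∧ Joined τ σ :=
  ((locallyCountable_preimage_base hA).frequently_notMem one_lt_rank_real_complex τ).and_eventually
    (mem_of_superset (pathComponentIn_mem_nhds univ_mem) fun _ => JoinedIn.joined)

theorem eventually_isGermOf_rep (τ : GermTuple ι) :
    ∀ᶠ σ in 𝓝 τ, ∀ i, (σ.germ i).IsGermOf (τ.germ i).rep :=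
  eventually_all.2 fun i => (continuous_germ i).continuousAt.eventually
    (τ.germ i).isGermOf_rep.eventually

theorem repVal_eventuallyEq {τ : GermTuple ι} {h : ι → Sphere → ℂ}
    (hτ : ∀ i, (τ.germ i).IsGermOf (h i)) : ∀ᶠ x in 𝓝 τ.base, τ.repVal x = fun i => h i x := by
  have hall : ∀ᶠ x in 𝓝 τ.base, ∀ i, (τ.germ i).rep x = h i x := eventually_all.2 fun i =>
    τ.germ_pt i ▸ (τ.germ i).isGermOf_rep.eventuallyEq (hτ i)
  exact hall.mono fun x hx => funext hx

theorem eventually_nhdsNE {τ : GermTuple ι} {G : Sphere → (ι → ℂ) → Prop}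
    (h : ∀ᶠ x in 𝓝[≠] τ.base, G x (τ.repVal x)) :
    ∀ᶠ σ in 𝓝[≠] τ, ∀ᶠ x in 𝓝 σ.base, G x (σ.repVal x) := by
  have hbase := continuous_base.continuousAt.eventually (eventually_nhdsWithin_iff.1
    (eventually_nhdsNE_eventually_nhds_iff.2 h))
  refine eventually_nhdsWithin_iff.2 ?_
  filter_upwards [τ.eventually_isGermOf_rep, hbase] with σ hrep hσ hne
  have hbne : σ.base ≠ τ.base := fun hb => hne <| ext hb fun i =>
    (hrep i).ext (τ.germ i).isGermOf_rep (by rw [germ_pt, germ_pt, hb])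
  filter_upwards [hσ hbne, repVal_eventuallyEq hrep] with x hx hx'
  rwa [hx']

end GermTuple

variable {n : ℕ} {F : (Fin n → ℂ) → ℂ} {τ : GermTuple (Fin n)}

/-- Near the base point of `τ`, but perhaps not at this point itself, the function `F` of the germs
of `τ` has generic limits and these form the holomorphic function `M`. -/
def IsPuncturedValue (F : (Fin n → ℂ) → ℂ) (τ : GermTuple (Fin n)) (M : Sphere → ℂ) : Prop :=
  ∀ᶠ x in 𝓝[≠] τ.base, HolomorphicAt M x ∧ HasGenericLimit F (τ.repVal x) (M x)

/-- The function `F` of the germs of `τ` extends to the function `H`, holomorphic at the base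
point. -/
def IsRegularValue (F : (Fin n → ℂ) → ℂ) (τ : GermTuple (Fin n)) (H : Sphere → ℂ) : Prop :=
  HolomorphicAt H τ.base ∧ IsPuncturedValue F τ H

theorem IsPuncturedValue.eventually_isRegularValue {M : Sphere → ℂ} (h : IsPuncturedValue F τ M) :
    ∀ᶠ σ in 𝓝[≠] τ, IsRegularValue F σ M := by
  filter_upwards [GermTuple.eventually_nhdsNE
    (G := fun x v => HolomorphicAt M x ∧ HasGenericLimit F v (M x)) h] with σ hσ
  exact ⟨hσ.self_of_nhds.1, nhdsWithin_le_nhds hσ⟩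

theorem IsPuncturedValue.eventually {M : Sphere → ℂ} (h : IsPuncturedValue F τ M) :
    ∀ᶠ σ in 𝓝 τ, IsPuncturedValue F σ M := by
  filter_upwards [eventually_nhdsWithin_iff.1 h.eventually_isRegularValue] with σ hσ
  rcases eq_or_ne σ τ with rfl | hne
  · exact h
  · exact (hσ hne).2

theorem IsRegularValue.eventually {H : Sphere → ℂ} (h : IsRegularValue F τ H) :
    ∀ᶠ σ in 𝓝 τ, IsRegularValue F σ H := by
  filter_upwards [GermTuple.continuous_base.continuousAt.eventually h.1.eventually,
    h.2.eventually] with σ hσ hσ' using ⟨hσ, hσ'⟩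

theorem IsRegularValue.eventuallyEq {H K : Sphere → ℂ} (h : IsRegularValue F τ H)
    (h' : IsRegularValue F τ K) : H =ᶠ[𝓝 τ.base] K := by
  refine (h.1.eventually_eq_or_eventually_ne h'.1).resolve_right fun hne => ?_
  obtain ⟨x, hx, hH, hK⟩ := (hne.and (h.2.and h'.2)).exists
  exact hx (hH.2.unique hK.2)

theorem exists_isPuncturedValue_or (hF : IsMeromorphicFunction F)
    (hτ : τ.base ≠ OnePoint.infty) :
    (∃ M, IsPuncturedValue F τ M) ∨
      ∀ᶠ x in 𝓝[≠] τ.base, ∀ m, ¬ HasGenericLimit F (τ.repVal x) m := by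
  obtain ⟨z, hz⟩ := exists_coe_eq hτ
  obtain ⟨P, Q, hP, hQ, hQ0, hPQ⟩ := hF (τ.repVal z)
  have hf : AnalyticAt ℂ (fun w : ℂ => τ.repVal w) z := analyticAt_pi_iff.2 fun i =>
    holomorphicAt_coe.1 ((τ.germ_pt i).trans hz ▸ (τ.germ i).isGermOf_rep.holomorphicAt)
  rw [hz]
  refine (exists_hasGenericLimit_or_forall_not hf ⟨hP, hQ, hPQ⟩ hQ0).imp ?_ eventually_nhdsNE_coe.2
  rintro ⟨M, hM, hlim⟩
  refine ⟨fun x => x.elim 0 M, ?_⟩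
  rw [IsPuncturedValue, hz, eventually_nhdsNE_coe]
  filter_upwards [hM.eventually_analyticAt, hlim] with x hMx hx using ⟨hMx, hx⟩

theorem eventually_not_exists_isPuncturedValue (hF : IsMeromorphicFunction F)
    (hτ : τ.base ≠ OnePoint.infty) (h : ¬ ∃ M, IsPuncturedValue F τ M) :
    ∀ᶠ σ in 𝓝 τ, ¬ ∃ M, IsPuncturedValue F σ M := by
  have hnone := GermTuple.eventually_nhdsNE (G := fun _ v => ∀ m, ¬ HasGenericLimit F v m)
    ((exists_isPuncturedValue_or hF hτ).resolve_left h)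
  filter_upwards [eventually_nhdsWithin_iff.1 hnone] with σ hσ
  rcases eq_or_ne σ τ with rfl | hne
  · exact h
  · rintro ⟨M, hM⟩
    obtain ⟨x, hx, hMx⟩ := ((eventually_nhdsWithin_of_eventually_nhds (hσ hne)).and hM).exists
    exact hx _ hMx.2

theorem exists_isPuncturedValue_of_joined (hF : IsMeromorphicFunction F)
    {τ₀ : GermTuple (Fin n)} {M : Sphere → ℂ} (hM : IsPuncturedValue F τ₀ M) (h : Joined τ₀ τ)
    (hτ : τ.base ≠ OnePoint.infty) : ∃ M, IsPuncturedValue F τ M := by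
  have hinf := Set.countable_singleton (OnePoint.infty : Sphere)
  obtain ⟨σ, ⟨hσ, hjoin⟩, hMσ⟩ :=
    ((τ₀.frequently_joined_base_notMem hinf).and_eventually hM.eventually).exists
  obtain ⟨P, hP⟩ := (GermTuple.locallyCountable_preimage_base hinf).joinedIn_diff
    one_lt_rank_real_complex isOpen_univ (joinedIn_univ.2 (hjoin.symm.trans h)) hσ hτ
  have hclopen : IsClopen {t | ∃ M, IsPuncturedValue F (P t) M} :=
    ⟨isOpen_compl_iff.1 <| isOpen_iff_mem_nhds.2 fun t ht => P.continuous.continuousAt.eventually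
      (eventually_not_exists_isPuncturedValue hF (hP t).2 ht),
      isOpen_iff_mem_nhds.2 fun t ⟨M, ht⟩ =>
        (P.continuous.continuousAt.eventually ht.eventually).mono fun _ hs => ⟨M, hs⟩⟩
  have hone := hclopen.eq_univ ⟨0, M, by rwa [P.source]⟩ ▸ Set.mem_univ (1 : unitInterval)
  rwa [Set.mem_ofPred_eq, P.target] at hone

open Classical in
/-- The germ of the function `F` of the germs of `τ`; it is the germ of `0`, a junk value, if this
function is not holomorphic at the base point. -/
def meromorphicGerm (F : (Fin n → ℂ) → ℂ) (τ : GermTuple (Fin n)) : RegularGerm :=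
  ofFun (if h : ∃ H, IsRegularValue F τ H then h.choose else 0) τ.base

@[simp] theorem meromorphicGerm_pt : (meromorphicGerm F τ).pt = τ.base := ofFun_pt _ _

namespace IsRegularValue

variable {H : Sphere → ℂ}

theorem isGermOf (h : IsRegularValue F τ H) : (meromorphicGerm F τ).IsGermOf H := by
  have hex : ∃ H, IsRegularValue F τ H := ⟨H, h⟩
  rw [meromorphicGerm, dif_pos hex]
  refine (isGermOf_ofFun hex.choose_spec.1).congr ?_
  rw [ofFun_pt]
  exact hex.choose_spec.eventuallyEq h

theorem continuousAt (h : IsRegularValue F τ H) : ContinuousAt (meromorphicGerm F) τ := by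
  refine continuousAt_of_isGermOf (k := H) ?_ (h.eventually.mono fun σ hσ => hσ.isGermOf)
  simpa only [meromorphicGerm_pt] using GermTuple.continuous_base.continuousAt

theorem countable_setOf_joined_not (hF : IsMeromorphicFunction F) (h : IsRegularValue F τ H) :
    {σ | Joined τ σ ∧ σ.base ≠ OnePoint.infty ∧ ¬ ∃ K, IsRegularValue F σ K}.Countable := by
  refine countable_of_subset_pathComponent GermTuple.isLocalHomeomorph_base (x := τ)
    (fun σ hσ => hσ.1) fun σ hσ => ?_
  obtain ⟨M, hM⟩ := exists_isPuncturedValue_of_joined hF h.2 hσ.1 hσ.2.1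
  refine ⟨_, eventually_nhdsWithin_iff.1 hM.eventually_isRegularValue,
    (Set.countable_singleton σ).mono ?_⟩
  rintro ρ ⟨hρZ, hρ⟩
  by_contra hne
  exact hρZ.2.2 ⟨M, hρ hne⟩

theorem generatedBy_mem {f : Fin n → MultivaluedFunction} (hf : ∀ i, f i ∈ SolvableSFunctions)
    (hF : IsMeromorphicFunction F) (hτf : ∀ i, (f i).HasGerm (τ.germ i))
    (h : IsRegularValue F τ H) {q : RegularGerm} (hpt : q.pt = τ.base) (hq : q.IsGermOf H) :
    generatedBy q ∈ SolvableSFunctions := by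
  set A := (⋃ i, (f i).singularSet) ∪ {OnePoint.infty} ∪ GermTuple.base ''
    {σ | Joined τ σ ∧ σ.base ≠ OnePoint.infty ∧ ¬ ∃ K, IsRegularValue F σ K}
  have hA : A.Countable := ((Set.countable_iUnion fun i =>
    (hf i).1.countable_singularSet).union (Set.countable_singleton _)).union
      ((countable_setOf_joined_not hF h).image _)
  obtain ⟨σ, ⟨hσA, hτσ⟩, hσH, hσg⟩ := ((τ.frequently_joined_base_notMem hA).and_eventually
    (h.eventually.and (GermTuple.continuous_base.continuousAt.eventually
      (hpt ▸ hq.eventually_generatedBy)))).exists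
  rw [← hσg.2, hσg.1.ext hσH.isGermOf (by simp)]
  refine generatedBy_mem_of_continuousAt hf hA (fun i x hx => Or.inl (Or.inl
    (Set.mem_iUnion.2 ⟨i, hx⟩))) (fun i => (hτf i).of_joined
    (hτσ.map (GermTuple.continuous_germ i))) hσA fun ρ hρ hρA => ⟨?_, meromorphicGerm_pt⟩
  have hreg : ∃ K, IsRegularValue F ρ K := by
    by_contra hnone
    exact hρA (Or.inr ⟨ρ, ⟨hτσ.trans hρ, fun hb => hρA (Or.inl (Or.inr hb)), hnone⟩, rfl⟩)
  obtain ⟨K, hK⟩ := hreg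
  exact hK.continuousAt

end IsRegularValue

theorem isRegularValue_of_mul_eq {P Q : (Fin n → ℂ) → ℂ} {h : Fin n → Sphere → ℂ} {k : Sphere → ℂ}
    (hτ : ∀ i, (τ.germ i).IsGermOf (h i)) (hk : HolomorphicAt k τ.base)
    (hPQ : IsQuotientAt F P Q fun i => h i τ.base)
    (hQ0 : ¬ ∀ᶠ x in 𝓝 τ.base, Q (fun i => h i x) = 0)
    (hkQ : ∀ᶠ x in 𝓝 τ.base, k x * Q (fun i => h i x) = P fun i => h i x) :
    IsRegularValue F τ k := by
  have hh (i) : HolomorphicAt (h i) τ.base := τ.germ_pt i ▸ (hτ i).holomorphicAt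
  have hcont : ContinuousAt (fun x i => h i x) τ.base :=
    continuousAt_pi.2 fun i => (hh i).continuousAt
  have hQ := ((HolomorphicAt.comp_pi hPQ.denominator hh).eventually_eq_or_eventually_ne
    (holomorphicAt_const 0 _)).resolve_left hQ0
  refine ⟨hk, ?_⟩
  filter_upwards [hQ, nhdsWithin_le_nhds hk.eventually, nhdsWithin_le_nhds hkQ,
    nhdsWithin_le_nhds (GermTuple.repVal_eventuallyEq hτ),
    nhdsWithin_le_nhds (hcont.eventually hPQ.eventually)] with x hQx hkx hkQx hrep hPQx
  rw [hrep, eq_div_of_mul_eq hQx hkQx]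
  exact ⟨hkx, hPQx.hasGenericLimit hQx⟩

theorem stableUnderMeromorphicOperations_solvableSFunctions :
    StableUnderMeromorphicOperations SolvableSFunctions := by
  rintro n F hF f hf φ ⟨q, p, hq, hp, h, k, P, Q, hph, hqk, ⟨hP, hQ, -, hPQ⟩, hQ0, hkQ⟩
  let τ : GermTuple (Fin n) := ⟨(q.pt, p), fun i => (hph i).1⟩
  have hreg : IsRegularValue F τ k :=
    isRegularValue_of_mul_eq (fun i => (hph i).2) hqk.holomorphicAt ⟨hP, hQ, hPQ⟩ hQ0 hkQ
  rw [← show generatedBy q = φ from hq]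
  exact hreg.generatedBy_mem hf hF (τ := τ) hp rfl hqk

/-! ### Germs of functions on the plane -/

/-- The germ at `z` of the function `k` of a complex variable, seen as a function on the sphere
whose value at infinity is the junk value `0`. -/
def planeGerm (k : ℂ → ℂ) (z : ℂ) : RegularGerm := ofFun (fun x => x.elim 0 k) z

@[simp] theorem planeGerm_pt (k : ℂ → ℂ) (z : ℂ) : (planeGerm k z).pt = z := ofFun_pt _ _

variable {k r u : ℂ → ℂ} {z : ℂ} {C : Set ℂ}

theorem isGermOf_planeGerm (hk : AnalyticAt ℂ k z) :
    (planeGerm k z).IsGermOf fun x => x.elim 0 k :=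
  isGermOf_ofFun (h := fun x : Sphere => x.elim 0 k) (x := (z : Sphere)) hk

theorem RegularGerm.IsGermOf.eq_planeGerm {p : RegularGerm} {h : Sphere → ℂ} (hp : p.IsGermOf h)
    (hpt : p.pt = z) (hk : ∀ᶠ w : ℂ in 𝓝 z, h w = k w) : p = planeGerm k z := by
  have hpk : p.IsGermOf fun x => x.elim 0 k := hp.congr (hpt ▸ eventually_nhds_coe.2 hk)
  exact hpk.ext (isGermOf_planeGerm (holomorphicAt_coe.1 (hpt ▸ hpk.holomorphicAt))) (by simp [hpt])

theorem RegularGerm.IsGermOf.eventually_generatedBy_planeGerm {p : RegularGerm} {h : Sphere → ℂ}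
    (hp : p.IsGermOf h) (hpt : p.pt = z) :
    ∀ᶠ w : ℂ in 𝓝 z, AnalyticAt ℂ (fun v : ℂ => h v) w ∧
      generatedBy (planeGerm (fun v : ℂ => h v) w) = generatedBy p := by
  filter_upwards [eventually_nhds_coe.1 (hpt ▸ hp.eventually_generatedBy)] with w ⟨hw, hgen⟩
  refine ⟨holomorphicAt_coe.1 (ofFun_pt h (w : Sphere) ▸ hw.holomorphicAt), ?_⟩
  rw [← hgen, ← hw.eq_planeGerm (ofFun_pt _ _) (Eventually.of_forall fun _ => rfl)]

theorem planeGerm_congr (hk : AnalyticAt ℂ k z) (h : k =ᶠ[𝓝 z] u) :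
    planeGerm k z = planeGerm u z :=
  (isGermOf_planeGerm hk).eq_planeGerm (planeGerm_pt _ _) h

theorem generatedBy_planeGerm_mem (hk : AnalyticAt ℂ k z) (hC : C.Countable)
    (h : ∀ w ∉ C, AnalyticAt ℂ k w) : generatedBy (planeGerm k z) ∈ SolvableSFunctions := by
  refine (isGermOf_planeGerm hk).generatedBy_mem (V := (insert OnePoint.infty ((↑) '' C))ᶜ)
    (by rw [compl_compl]; exact (hC.image _).insert _) fun x hx => ?_
  obtain ⟨w, rfl⟩ := exists_coe_eq fun hinf => hx (Or.inl hinf)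
  exact h w fun hw => hx (Or.inr ⟨w, hw, rfl⟩)

theorem generatedBy_planeGerm_mem_of_differentiable (hk : Differentiable ℂ k) :
    generatedBy (planeGerm k z) ∈ SolvableSFunctions :=
  generatedBy_planeGerm_mem (hk.analyticAt z) Set.countable_empty fun w _ => hk.analyticAt w

theorem generatedBy_planeGerm_mem_of_deriv (hk : AnalyticAt ℂ k z)
    (h : generatedBy (planeGerm (deriv k) z) ∈ SolvableSFunctions) :
    generatedBy (planeGerm k z) ∈ SolvableSFunctions :=
  stableUnderIntegration_solvableSFunctions _ h _ ⟨_, _, rfl, rfl, by simp,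
    _, isGermOf_planeGerm hk, isGermOf_planeGerm hk.deriv⟩

theorem generatedBy_planeGerm_comp_mem {g : ℂ → ℂ} (hg : Differentiable ℂ g)
    (hk : AnalyticAt ℂ k z) (hkS : generatedBy (planeGerm k z) ∈ SolvableSFunctions) :
    generatedBy (planeGerm (fun w => g (k w)) z) ∈ SolvableSFunctions := by
  refine stableUnderComposition_solvableSFunctions _
    (generatedBy_planeGerm_mem_of_differentiable (z := k z) hg) _ hkS _ ⟨_, _, _, rfl, rfl, rfl,
      by simp, _, _, isGermOf_planeGerm hk, by simp, isGermOf_planeGerm (hg.analyticAt _), ?_⟩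
  refine (isGermOf_planeGerm ((hg.analyticAt _).comp hk)).congr ?_
  rw [planeGerm_pt]
  exact eventually_nhds_coe.2 (Eventually.of_forall fun _ => rfl)

theorem generatedBy_planeGerm_mem_of_const_sub (c : ℂ) (hk : AnalyticAt ℂ k z)
    (h : generatedBy (planeGerm (fun w => c - k w) z) ∈ SolvableSFunctions) :
    generatedBy (planeGerm k z) ∈ SolvableSFunctions := by
  have hcomp := generatedBy_planeGerm_comp_mem (differentiable_fun_id.const_sub c)
    (k := fun w => c - k w) (analyticAt_const.sub hk) h
  simpa only [sub_sub_cancel] using hcomp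

/-! ### First order linear differential equations -/

theorem generatedBy_planeGerm_mem_of_deriv_eq (hk : AnalyticAt ℂ k z) (hkr : deriv k =ᶠ[𝓝 z] r)
    (hC : C.Countable) (h : ∀ w ∉ C, AnalyticAt ℂ r w) :
    generatedBy (planeGerm k z) ∈ SolvableSFunctions := by
  refine generatedBy_planeGerm_mem_of_deriv hk ?_
  rw [planeGerm_congr hk.deriv hkr]
  exact generatedBy_planeGerm_mem (hk.deriv.congr hkr) hC h

theorem exists_analyticAt_eventually_eq_exp (hu : AnalyticAt ℂ u z) (hz : u z ≠ 0) :
    ∃ l : ℂ → ℂ, AnalyticAt ℂ l z ∧ u =ᶠ[𝓝 z] fun w => Complex.exp (l w) := by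
  have hslit : ∀ᶠ w in 𝓝 z, u w / u z ∈ Complex.slitPlane :=
    (hu.continuousAt.div_const _).eventually_mem (Complex.isOpen_slitPlane.mem_nhds
      (by rw [div_self hz]; exact Complex.one_mem_slitPlane))
  refine ⟨fun w => Complex.log (u w / u z) + Complex.log (u z),
    ((hu.div analyticAt_const hz).clog hslit.self_of_nhds).add analyticAt_const, ?_⟩
  filter_upwards [hslit] with w hw
  rw [Complex.exp_add, Complex.exp_log (Complex.slitPlane_ne_zero hw), Complex.exp_log hz,
    div_mul_cancel₀ _ hz]

theorem generatedBy_planeGerm_mem_of_deriv_eq_mul (hu : AnalyticAt ℂ u z) (hz : u z ≠ 0)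
    (hur : ∀ᶠ w in 𝓝 z, deriv u w = r w * u w) (hC : C.Countable)
    (h : ∀ w ∉ C, AnalyticAt ℂ r w) : generatedBy (planeGerm u z) ∈ SolvableSFunctions := by
  obtain ⟨l, hl, hul⟩ := exists_analyticAt_eventually_eq_exp hu hz
  have hlr : deriv l =ᶠ[𝓝 z] r := by
    filter_upwards [hul.eventually_nhds, hur, hl.eventually_analyticAt] with w hw hurw hlw
    rw [EventuallyEq.deriv_eq hw, hlw.differentiableAt.hasDerivAt.cexp.deriv, hw.self_of_nhds,
      mul_comm] at hurw
    exact mul_right_cancel₀ (Complex.exp_ne_zero _) hurw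
  rw [planeGerm_congr hu hul]
  exact generatedBy_planeGerm_comp_mem Complex.differentiable_exp hl
    (generatedBy_planeGerm_mem_of_deriv_eq hl hlr hC h)

/-! ### Elementary functions -/

theorem hasDerivAt_mul_deriv_eq_one {T : ℂ → ℂ} {T' w : ℂ} (hT : HasDerivAt T T' (k w))
    (hk : DifferentiableAt ℂ k w) (h : ∀ᶠ v in 𝓝 w, T (k v) = v) : T' * deriv k w = 1 :=
  ((hT.comp w hk.hasDerivAt).congr_of_eventuallyEq (h.mono fun _ hv => hv.symm)).unique
    (hasDerivAt_id w)

theorem deriv_sq_mul_one_sub_sq_of_sin {w : ℂ} (hk : DifferentiableAt ℂ k w)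
    (h : ∀ᶠ v in 𝓝 w, Complex.sin (k v) = v) : deriv k w ^ 2 * (1 - w ^ 2) = 1 := by
  have hcos : Complex.cos (k w) ^ 2 = 1 - w ^ 2 := by rw [Complex.cos_sq', h.self_of_nhds]
  rw [← hcos, ← mul_pow, mul_comm, hasDerivAt_mul_deriv_eq_one (Complex.hasDerivAt_sin _) hk h,
    one_pow]

theorem deriv_eq_inv_one_add_sq_of_tan {w : ℂ} (hk : DifferentiableAt ℂ k w) (hw : w ≠ 0)
    (h : ∀ᶠ v in 𝓝 w, Complex.tan (k v) = v) : deriv k w = (1 + w ^ 2)⁻¹ := by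
  have htan : Complex.tan (k w) = w := h.self_of_nhds
  have hcos : Complex.cos (k w) ≠ 0 := fun hcos => hw <| by
    rw [← htan, Complex.tan_eq_sin_div_cos, hcos, div_zero]
  have hchain := hasDerivAt_mul_deriv_eq_one (Complex.hasDerivAt_tan hcos) hk h
  rw [one_div_mul_eq_div, div_eq_one_iff_eq (pow_ne_zero 2 hcos)] at hchain
  rw [hchain, ← Complex.inv_one_add_tan_sq hcos, htan]

theorem deriv_eq_of_sq_mul_one_sub_sq_eq_one {w : ℂ} (hu : DifferentiableAt ℂ u w)
    (h : ∀ᶠ v in 𝓝 w, u v ^ 2 * (1 - v ^ 2) = 1) : deriv u w = w / (1 - w ^ 2) * u w := by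
  have hne : u w ≠ 0 ∧ 1 - w ^ 2 ≠ 0 := by
    have := h.self_of_nhds
    constructor <;> intro h0 <;> simp [h0] at this
  have hprod := (((hu.hasDerivAt.pow 2).mul (((hasDerivAt_id w).pow 2).const_sub 1))
    |>.congr_of_eventuallyEq (h.mono fun v hv => hv.symm)).unique (hasDerivAt_const w 1)
  have hfactor : 2 * u w * (deriv u w * (1 - w ^ 2) - w * u w) = 0 := by
    simp only [Nat.cast_ofNat, Nat.add_one_sub_one, pow_one, id_eq, Pi.pow_apply] at hprod
    linear_combination hprod
  have hode := (mul_eq_zero.1 hfactor).resolve_left (mul_ne_zero two_ne_zero hne.1)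
  rw [div_mul_eq_mul_div, eq_div_iff hne.2, sub_eq_zero.1 hode]

theorem generatedBy_planeGerm_mem_of_sin (hk : AnalyticAt ℂ k z)
    (h : ∀ᶠ w in 𝓝 z, Complex.sin (k w) = w) :
    generatedBy (planeGerm k z) ∈ SolvableSFunctions := by
  have hsq : ∀ᶠ w in 𝓝 z, deriv k w ^ 2 * (1 - w ^ 2) = 1 := by
    filter_upwards [hk.eventually_analyticAt, h.eventually_nhds] with w hkw hw
      using deriv_sq_mul_one_sub_sq_of_sin hkw.differentiableAt hw
  have hne : deriv k z ≠ 0 := fun h0 => by simpa [h0] using hsq.self_of_nhds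
  refine generatedBy_planeGerm_mem_of_deriv hk (generatedBy_planeGerm_mem_of_deriv_eq_mul
    (r := fun w => w / (1 - w ^ 2)) (C := {1, -1}) hk.deriv hne ?_
    ((Set.countable_singleton _).insert _) fun w hw => ?_)
  · filter_upwards [hsq.eventually_nhds, hk.deriv.eventually_analyticAt] with w hw hkw
      using deriv_eq_of_sq_mul_one_sub_sq_eq_one hkw.differentiableAt hw
  · exact analyticAt_id.div (analyticAt_const.sub (analyticAt_id.pow 2)) fun h0 =>
      hw (sq_eq_one_iff.1 (sub_eq_zero.1 h0).symm)

theorem generatedBy_planeGerm_mem_of_tan (hk : AnalyticAt ℂ k z) (hz : z ≠ 0)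
    (h : ∀ᶠ w in 𝓝 z, Complex.tan (k w) = w) :
    generatedBy (planeGerm k z) ∈ SolvableSFunctions := by
  refine generatedBy_planeGerm_mem_of_deriv_eq (r := fun w => (1 + w ^ 2)⁻¹)
    (C := {Complex.I, -Complex.I}) hk ?_ ((Set.countable_singleton _).insert _) fun w hw => ?_
  · filter_upwards [hk.eventually_analyticAt, eventually_ne_nhds hz, h.eventually_nhds]
      with w hkw hw htan using deriv_eq_inv_one_add_sq_of_tan hkw.differentiableAt hw htan
  · refine (analyticAt_const.add (analyticAt_id.pow 2)).inv fun h0 => hw ?_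
    refine sq_eq_sq_iff_eq_or_eq_neg.1 ?_
    rw [Complex.I_sq]
    exact eq_neg_of_add_eq_zero_right h0

theorem dense_slitPlane : Dense Complex.slitPlane :=
  ((dense_compl_singleton (0 : ℝ)).preimage Complex.isOpenMap_im).mono fun _ => Or.inr

theorem IsGeneratedByFunction.exists_mem_slitPlane {f : MultivaluedFunction}
    (hf : IsGeneratedByFunction k f) :
    ∃ z ∈ Complex.slitPlane, AnalyticAt ℂ k z ∧ generatedBy (planeGerm k z) = f := by
  obtain ⟨p, z₀, rfl, hpt, hpk⟩ := hf
  exact ((mem_closure_iff_frequently.1 (dense_slitPlane z₀)).and_eventually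
    (hpk.eventually_generatedBy_planeGerm hpt)).exists

theorem IsInverseFunctionOf.exists_mem_slitPlane {T : ℂ → ℂ} {f : MultivaluedFunction}
    (hf : IsInverseFunctionOf T f) :
    ∃ k : ℂ → ℂ, ∃ z ∈ Complex.slitPlane, AnalyticAt ℂ k z ∧ (∀ᶠ w in 𝓝 z, T (k w) = w) ∧
      generatedBy (planeGerm k z) = f := by
  obtain ⟨p, z₀, h, rfl, hpt, hph, hT⟩ := hf
  obtain ⟨z, hz, ⟨hh, hgen⟩, hTz⟩ :=
    ((mem_closure_iff_frequently.1 (dense_slitPlane z₀)).and_eventually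
      ((hph.eventually_generatedBy_planeGerm hpt).and hT.eventually_nhds)).exists
  exact ⟨_, z, hz, hh, hTz, hgen⟩

theorem countable_setOf_cos_eq_zero : {z : ℂ | Complex.cos z = 0}.Countable :=
  (Set.countable_range fun k : ℤ => (2 * k + 1) * (Real.pi : ℂ) / 2).mono fun _ hz =>
    (Complex.cos_eq_zero_iff.1 hz).imp fun _ hk => hk.symm

theorem countable_setOf_sin_eq_zero : {z : ℂ | Complex.sin z = 0}.Countable :=
  (Set.countable_range fun k : ℤ => k * (Real.pi : ℂ)).mono fun _ hz =>
    (Complex.sin_eq_zero_iff.1 hz).imp fun _ hk => hk.symm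

namespace IsGeneratedByFunction

variable {f : MultivaluedFunction}

theorem mem_of_analyticAt (hf : IsGeneratedByFunction k f) (hC : C.Countable)
    (hk : ∀ w ∉ C, AnalyticAt ℂ k w) : f ∈ SolvableSFunctions := by
  obtain ⟨z, -, hz, rfl⟩ := hf.exists_mem_slitPlane
  exact generatedBy_planeGerm_mem hz hC hk

theorem mem_of_differentiable (hf : IsGeneratedByFunction k f) (hk : Differentiable ℂ k) :
    f ∈ SolvableSFunctions :=
  hf.mem_of_analyticAt Set.countable_empty fun w _ => hk.analyticAt w

theorem mem_of_tan (hf : IsGeneratedByFunction Complex.tan f) : f ∈ SolvableSFunctions :=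
  hf.mem_of_analyticAt countable_setOf_cos_eq_zero fun w hw =>
    (Complex.differentiable_sin.analyticAt w).div (Complex.differentiable_cos.analyticAt w) hw

theorem mem_of_cot (hf : IsGeneratedByFunction Complex.cot f) : f ∈ SolvableSFunctions :=
  hf.mem_of_analyticAt countable_setOf_sin_eq_zero fun w hw =>
    (Complex.differentiable_cos.analyticAt w).div (Complex.differentiable_sin.analyticAt w) hw

theorem mem_of_log (hf : IsGeneratedByFunction Complex.log f) : f ∈ SolvableSFunctions := by
  obtain ⟨z, hz, hlog, rfl⟩ := hf.exists_mem_slitPlane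
  refine generatedBy_planeGerm_mem_of_deriv_eq hlog (r := fun w => w⁻¹) ?_
    (Set.countable_singleton (0 : ℂ)) fun w hw => analyticAt_inv hw
  filter_upwards [Complex.isOpen_slitPlane.mem_nhds hz] with w hw
    using (Complex.hasDerivAt_log hw).deriv

theorem mem_of_cpow {α : ℂ} (hf : IsGeneratedByFunction (fun z => z ^ α) f) :
    f ∈ SolvableSFunctions := by
  obtain ⟨z, hz, hpow, rfl⟩ := hf.exists_mem_slitPlane
  refine generatedBy_planeGerm_mem_of_deriv_eq_mul hpow (r := fun w => α * w⁻¹) ?_ ?_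
    (Set.countable_singleton (0 : ℂ)) fun w hw => analyticAt_const.mul (analyticAt_inv hw)
  · simp [Complex.cpow_eq_zero_iff, Complex.slitPlane_ne_zero hz]
  · filter_upwards [Complex.isOpen_slitPlane.mem_nhds hz] with w hw
    rw [((hasDerivAt_id' w).cpow_const hw).deriv,
      Complex.cpow_sub _ _ (Complex.slitPlane_ne_zero hw), Complex.cpow_one]
    ring

end IsGeneratedByFunction

namespace IsInverseFunctionOf

variable {f : MultivaluedFunction}

theorem mem_of_sin (hf : IsInverseFunctionOf Complex.sin f) : f ∈ SolvableSFunctions := by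
  obtain ⟨k, z, -, hk, hsin, rfl⟩ := hf.exists_mem_slitPlane
  exact generatedBy_planeGerm_mem_of_sin hk hsin

theorem mem_of_cos (hf : IsInverseFunctionOf Complex.cos f) : f ∈ SolvableSFunctions := by
  obtain ⟨k, z, -, hk, hcos, rfl⟩ := hf.exists_mem_slitPlane
  refine generatedBy_planeGerm_mem_of_const_sub (Real.pi / 2) hk
    (generatedBy_planeGerm_mem_of_sin (analyticAt_const.sub hk) ?_)
  simpa only [Complex.sin_pi_div_two_sub] using hcos

theorem mem_of_tan (hf : IsInverseFunctionOf Complex.tan f) : f ∈ SolvableSFunctions := by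
  obtain ⟨k, z, hz, hk, htan, rfl⟩ := hf.exists_mem_slitPlane
  exact generatedBy_planeGerm_mem_of_tan hk (Complex.slitPlane_ne_zero hz) htan

theorem mem_of_cot (hf : IsInverseFunctionOf Complex.cot f) : f ∈ SolvableSFunctions := by
  obtain ⟨k, z, hz, hk, hcot, rfl⟩ := hf.exists_mem_slitPlane
  refine generatedBy_planeGerm_mem_of_const_sub (Real.pi / 2) hk
    (generatedBy_planeGerm_mem_of_tan (analyticAt_const.sub hk) (Complex.slitPlane_ne_zero hz) ?_)
  simpa only [Complex.tan_pi_div_two_sub, Complex.tan_inv_eq_cot] using hcot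

end IsInverseFunctionOf

theorem IsBasicElementary.mem_solvableSFunctions {f : MultivaluedFunction}
    (hf : IsBasicElementary f) : f ∈ SolvableSFunctions := by
  cases hf with
  | const c _ h => exact h.mem_of_differentiable (differentiable_const c)
  | var _ h => exact h.mem_of_differentiable differentiable_id
  | exp _ h => exact h.mem_of_differentiable Complex.differentiable_exp
  | log _ h => exact h.mem_of_log
  | pow _ _ h => exact h.mem_of_cpow
  | sin _ h => exact h.mem_of_differentiable Complex.differentiable_sin
  | cos _ h => exact h.mem_of_differentiable Complex.differentiable_cos
  | tan _ h => exact h.mem_of_tan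
  | cot _ h => exact h.mem_of_cot
  | arcsin _ h => exact h.mem_of_sin
  | arccos _ h => exact h.mem_of_cos
  | arctan _ h => exact h.mem_of_tan
  | arccot _ h => exact h.mem_of_cot

theorem mem_solvableSFunctions_of_isSingleValued {f : MultivaluedFunction} (hf : f.IsSFunction)
    (hs : f.IsSingleValued) : f ∈ SolvableSFunctions := by
  refine ⟨hf, fun x₀ _ => ?_⟩
  have : Subsingleton (f.Fiber x₀) :=
    ⟨fun p q => Subtype.ext (hs _ _ p.2.1 q.2.1 (p.2.2.trans q.2.2.symm))⟩
  infer_instance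

theorem InExtendedQuadratureClass.mem_solvableSFunctions {f : MultivaluedFunction}
    (hf : InExtendedQuadratureClass f) : f ∈ SolvableSFunctions := by
  induction hf with
  | elementary f h => exact h.mem_solvableSFunctions
  | singleValued f h h' => exact mem_solvableSFunctions_of_isSingleValued h h'
  | composition φ g f _ _ h hg hf => exact stableUnderComposition_solvableSFunctions g hg f hf φ h
  | meromorphic F φ f hF _ h hf =>
    exact stableUnderMeromorphicOperations_solvableSFunctions _ F hF f hf φ h
  | differentiation φ f _ h hf => exact stableUnderDifferentiation_solvableSFunctions f hf φ h
  | integration φ f _ h hf => exact stableUnderIntegration_solvableSFunctions f hf φ h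

end

theorem theorem6_general :
    (StableUnderComposition SolvableSFunctions ∧
      StableUnderMeromorphicOperations SolvableSFunctions ∧
      StableUnderIntegration SolvableSFunctions ∧
      StableUnderDifferentiation SolvableSFunctions) ∧
    ∀ f : MultivaluedFunction, f ∉ SolvableSFunctions → StronglyNonRepresentableByQuadratures f :=
  ⟨⟨stableUnderComposition_solvableSFunctions,
      stableUnderMeromorphicOperations_solvableSFunctions,
      stableUnderIntegration_solvableSFunctions, stableUnderDifferentiation_solvableSFunctions⟩,
    fun _ hf hq => hf hq.mem_solvableSFunctions⟩

theorem theorem6 :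
    (StableUnderComposition SolvableSFunctions ∧
      StableUnderMeromorphicOperations SolvableSFunctions ∧
      StableUnderIntegration SolvableSFunctions ∧
      StableUnderDifferentiation SolvableSFunctions) ∧
    ∀ f : MultivaluedFunction, f.IsSFunction → ¬ f.HasSolvableMonodromyGroup →
      StronglyNonRepresentableByQuadratures f :=
  ⟨theorem6_general.1, fun f _ hns => theorem6_general.2 f fun hf => hns hf.2⟩
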